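/- **Pieri rule.** Work over $\mathbb{Q}(q,t)$. Boxes $\square=(\text{row},\text{column})$ of a Young diagram (English notation) have content $c(\square)=\text{column}-\text{row}$. *Tableaux.* For a partition $\mu$ of $n$, $\mathrm{RSSYT}(\mu)$ is the set of labellings $T:\mu\to\mathbb{Z}_{\ge0}$ that decrease weakly along rows and strictly down columns. $\mathrm{PSYT}(\mu)$ is the set of labellings $\tau$ of $\mu$ by formal products $jq^{b}$ ($1\le j\le n$, $b\ge0$), each $j$ occurring in exactly one box, strictly increasing along rows and columns, where $jq^m<kq^\ell$ iff $m>\ell$, or $m=\ell$ and $j<k$; $\mathrm{SYT}(\mu)$ consists of those with all exponents $0$, and $\mathrm{PSYT}(\mu;T)$ of those with exponents given by $T$. Write $c_\tau(i)$, $w_\tau(i)$ for the content of the box with label $iq^b$ and for its exponent $b$. $\Psi(\tau)$ replaces $kq^a$ by $(k-1)q^a$ for $k\ge2$ and $1q^a$ by $nq^{a+1}$; $s_i(\tau)$ exchanges $i$ and $i+1$ (keeping exponents), when this is again in $\mathrm{PSYT}(\mu)$. $\mathrm{PSYT}(\mu)$ is partially ordered by the covers $\Psi(\tau)>\tau$;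 $s_i(\tau)>\tau$ if $w_\tau(i)<w_\tau(i+1)$; $s_i(\tau)>\tau$ if $w_\tau(i)=w_\tau(i+1)$ and $c_\tau(i)-c_\tau(i+1)>1$. $\mathrm{Top}(T)$ and $\mathrm{Min}(T)$ are the largest and smallest elements of $\mathrm{PSYT}(\mu;T)$. For $\tau\in \mathrm{PSYT}(\mu;T)$, $\mathrm{Inv}(\tau)$ is the set of pairs $(\square_1,\square_2)$ such that $T(\square_1)>T(\square_2)$, or $T(\square_1)=T(\square_2)$ and $\square_1$ precedes $\square_2$ when boxes are read column by column, from left to right and downwards, while the label index of $\tau$ at $\square_1$ exceeds that at $\square_2$. *Modules.* $\mathscr{D}_n$ is the algebra generated by $T_1,\dots,T_{n-1}$, $\theta_1,\dots,\theta_n$, $X_1,\dots,X_n$ with relations: $(T_i-1)(T_i+t)=0$, the braid relations for the $T_i$; the $\theta$'s commute, $\theta_{i+1}=tT_i^{-1}\theta_iT_i^{-1}$, $T_i\theta_j=\theta_jT_i$ for $j\ne i,i+1$; the same three relations with $X$ in place of $\theta$; and, for $\pi_n=t^{n-1}\theta_1T_1^{-1}\cdots T_{n-1}^{-1}$, $\pi_nX_i=X_{i+1}\pi_n$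 $(i<n)$ and $\pi_nX_n=qX_1\pi_n$. $V_\mu$ is the $\mathscr{D}_n$-module induced from the module over the subalgebra of the $T_i,\theta_i$ that is generated by the $\tau\in\mathrm{SYT}(\mu)$ with relations $\theta_i\tau=t^{c_\tau(i)}\tau$; $\big(tT_i^{-1}\theta_i-\theta_itT_i^{-1}\big)\tau=(t^{c_\tau(i)}-t^{c_\tau(i+1)})s_i(\tau)$ if $s_i(\tau)>\tau$; $T_i\tau=\tau$ (resp. $-t\tau$) if $i,i+1$ lie in the same row (resp. column) of $\tau$. It has the basis $X^\alpha\otimes\tau$. $W_\mu\subset V_\mu$ is the space of vectors fixed by all $T_i$. $(F_\tau)_{\tau\in\mathrm{PSYT}(\mu)}$ is the basis of $V_\mu$ determined by $\theta_iF_\tau=q^{w_\tau(i)}t^{c_\tau(i)}F_\tau$; $F_\tau=1\otimes\tau$ for $\tau\in\mathrm{SYT}(\mu)$; $F_{s_i(\tau)}=\Big(tT_i^{-1}+\frac{(t-1)q^{w_\tau(i+1)}t^{c_\tau(i+1)}}{q^{w_\tau(i)}t^{c_\tau(i)}-q^{w_\tau(i+1)}t^{c_\tau(i+1)}}\Big)F_\tau$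 if $s_i(\tau)>\tau$; $F_{\Psi(\tau)}=q^{w_\tau(1)}X_n\pi_n^{-1}F_\tau$. For $T\in\mathrm{RSSYT}(\mu)$, $P_T$ is the unique element of $W_\mu$ of the form $F_{\mathrm{Top}(T)}+\sum_{y\in\mathrm{PSYT}(\mu;T),\,y\ne\mathrm{Top}(T)}\kappa_yF_y$. *Stable limit.* For a partition $\lambda$ put $n_\lambda=|\lambda|+\lambda_1$, $\lambda^{(n)}=(n-|\lambda|,\lambda_1,\lambda_2,\dots)$ for $n\ge n_\lambda$, and $\lambda^{(\infty)}=\bigcup_n\lambda^{(n)}$. The linear map $\Phi^{(n)}:V_{\lambda^{(n+1)}}\to V_{\lambda^{(n)}}$ sends $X^\alpha\otimes\tau$ to $X_1^{\alpha_1}\cdots X_n^{\alpha_n}\otimes\tau|_{\lambda^{(n)}}$ if $\alpha_{n+1}=0$ and the box $\lambda^{(n+1)}/\lambda^{(n)}$ has label $n+1$ in $\tau$, and to $0$ otherwise. $\widetilde W_\lambda$ is the space of elements of bounded $X$-degree of $\varprojlim W_{\lambda^{(n)}}$. $\Omega(\lambda)$ is the set of finitely supported labellings $T:\lambda^{(\infty)}\to\mathbb{Z}_{\ge0}$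 that decrease weakly along rows and strictly down columns; $\mathrm{rk}(T)$ is the least $n\ge n_\lambda$ with $T=0$ outside $\lambda^{(n)}$; $\mathfrak{P}_T=\lim_nP_{T|_{\lambda^{(n)}}}\in\widetilde W_\lambda$; and $e_r[X]^\bullet$ acts on the $n$-th component as $e_r(X_1,\dots,X_n)$. *Statement.* Let $T\in\Omega(\lambda)$ and $r\ge1$. There are unique coefficients $\mathfrak{d}^{(r)}_{S,T}\in\mathbb{Q}(q,t)$, almost all zero, with $$e_r[X]^\bullet(\mathfrak{P}_T)=\sum_{S\in\Omega(\lambda)}\mathfrak{d}^{(r)}_{S,T}\,\mathfrak{P}_S .$$ Let $n\ge\mathrm{rk}(T)+r$, $\mu=\lambda^{(n)}$ and $T_n=T|_{\mu}$. There are unique coefficients $d^{(r)}_{S,T_n}$, almost all zero, with $e_r(X_1,\dots,X_n)P_{T_n}=\sum_{S\in\mathrm{RSSYT}(\mu)}d^{(r)}_{S,T_n}P_S$, and they are given by $$d^{(r)}_{S,T_n}=e_r(1,t,\dots,t^{n-1})\,K_S\sum_{\substack{\tau\in\mathrm{PSYT}(\mu;T_n)\\ \Psi^r(\tau)\in\mathrm{PSYT}(\mu;S)}}t^{c_\tau(1)+\dots+c_\tau(r)}\prod_{(\square_1,\square_2)\in\mathrm{Inv}(\tau)}\frac{t\,x_{T_n}(\square_1)-x_{T_n}(\square_2)}{x_{T_n}(\square_1)-x_{T_n}(\square_2)}\prod_{(\square_1,\square_2)\in\mathrm{Inv}(\Psi^r(\tau))}\frac{x_S(\square_1)-x_S(\square_2)}{x_S(\square_1)-t\,x_S(\square_2)},$$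 where $x_S(\square)=q^{S(\square)}t^{c(\square)}$ and $K_S=\frac{[\mu(S)]_t!}{[n]_t!}\prod_{(\square_1,\square_2)\in\mathrm{Inv}(\mathrm{Min}(S))}\frac{x_S(\square_1)-t\,x_S(\square_2)}{x_S(\square_1)-x_S(\square_2)}$; here $[m]_t!=\prod_{i=1}^m\frac{1-t^i}{1-t}$ and $[\mu(S)]_t!=\prod_j[\mu_j]_t!$ for the sizes $\mu_j$ of the maximal intervals of labels in which any two consecutive labels $i,i+1$ lie in the same row of $\mathrm{Min}(S)$ with the same exponent of $q$. The stable coefficients are computed by truncation: for every $S\in\Omega(\lambda)$, $$\mathfrak{d}^{(r)}_{S,T}=d^{(r)}_{S|_{\lambda^{(n)}},\,T|_{\lambda^{(n)}}}\quad\text{if } \mathrm{rk}(S)\le n,\qquad \mathfrak{d}^{(r)}_{S,T}=0\quad\text{if }\mathrm{rk}(S)>n .$$ If $n>\mathrm{rk}(T)+r$, then $\mathfrak{d}^{(r)}_{S,T}=d^{(r)}_{S|_{\lambda^{(n)}},T|_{\lambda^{(n)}}}$ for all $S\in\Omega(\lambda)$ without restriction. -/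

import Mathlib

namespace VVMac

/-! ### The ground field `ℚ(q,t)` -/

/-- The field `ℚ(q,t)` of rational functions in two variables. -/
abbrev Kqt : Type := FractionRing (MvPolynomial (Fin 2) ℚ)

noncomputable def q : Kqt := algebraMap (MvPolynomial (Fin 2) ℚ) Kqt (MvPolynomial.X 0)

noncomputable def t : Kqt := algebraMap (MvPolynomial (Fin 2) ℚ) Kqt (MvPolynomial.X 1)

/-- The `t`-integer `[m]_t = (1 - t^m)/(1 - t)`. -/
noncomputable def tInt (m : ℕ) : Kqt := (1 - t ^ m) / (1 - t)

/-- `[m]_t! = [1]_t [2]_t ⋯ [m]_t`. -/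
noncomputable def tFact (m : ℕ) : Kqt := ∏ i ∈ Finset.range m, tInt (i + 1)

/-- If `c` satisfies this, then `c` gives the one and only way to write `x` as a finite linear
combination of the vectors `v i`. -/
def IsUniqueExpansion {ι M : Type*} [AddCommGroup M] [Module Kqt M] (v : ι → M) (x : M)
    (c : ι →₀ Kqt) : Prop :=
  ∀ c' : ι →₀ Kqt, Finsupp.linearCombination Kqt v c' = x ↔ c' = c

/-! ### Diagrams and tableaux

Boxes are pairs `(row, column)`, counted from `0`, in English notation. -/

/-- The boxes of a Young diagram. -/
abbrev Box (mu : YoungDiagram) : Type := {b : ℕ × ℕ // b ∈ mu}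

instance (mu : YoungDiagram) : Fintype (Box mu) :=
  Fintype.subtype mu.cells fun b => YoungDiagram.mem_cells b

/-- The content of a box: column index minus row index. -/
def content {mu : YoungDiagram} (b : Box mu) : ℤ := (b.1.2 : ℤ) - (b.1.1 : ℤ)

/-- The column-standard order of boxes: columns from left to right, each one downwards. -/
def colBefore {mu : YoungDiagram} (a b : Box mu) : Prop :=
  a.1.2 < b.1.2 ∨ (a.1.2 = b.1.2 ∧ a.1.1 < b.1.1)

/-- Reverse semi-standard Young tableaux: non-negative labellings that decrease weakly along rows
and strictly down columns. -/
@[ext]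
structure RSSYT (mu : YoungDiagram) where
  toFun : Box mu → ℕ
  row_weak : ∀ a b : Box mu, a.1.1 = b.1.1 → a.1.2 < b.1.2 → toFun b ≤ toFun a
  col_strict : ∀ a b : Box mu, a.1.2 = b.1.2 → a.1.1 < b.1.1 → toFun b < toFun a

/-- The order on the formal labels `j q^m`, encoded as pairs `(j, m)`. -/
def labelLT (x y : ℕ × ℕ) : Prop := y.2 < x.2 ∨ (x.2 = y.2 ∧ x.1 < y.1)

/-- Non-negative periodic standard Young tableaux with `n` boxes. The box `b` carries the label
`j q^m` with `j = idx b + 1` and `m = wt b`; every `j ∈ {1,…,n}` occurs in exactly one box. -/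
@[ext]
structure PSYT (n : ℕ) (mu : YoungDiagram) where
  idx : Box mu ≃ Fin n
  wt : Box mu → ℕ
  row_lt : ∀ a b : Box mu, a.1.1 = b.1.1 → a.1.2 < b.1.2 →
    labelLT ((idx a : ℕ), wt a) ((idx b : ℕ), wt b)
  col_lt : ∀ a b : Box mu, a.1.2 = b.1.2 → a.1.1 < b.1.1 →
    labelLT ((idx a : ℕ), wt a) ((idx b : ℕ), wt b)

/-- Standard Young tableaux are the periodic ones without powers of `q`. -/
abbrev SYT (n : ℕ) (mu : YoungDiagram) : Type := {τ : PSYT n mu // ∀ b, τ.wt b = 0}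

namespace PSYT

variable {n : ℕ} {mu : YoungDiagram}

/-- The content `c_τ(i)` of the box with label `i q^*` (labels counted from `0`). -/
def c (τ : PSYT n mu) (i : Fin n) : ℤ := content (τ.idx.symm i)

/-- The exponent `w_τ(i)` of `q` at the label `i` (labels counted from `0`). -/
def w (τ : PSYT n mu) (i : Fin n) : ℕ := τ.wt (τ.idx.symm i)

/-- `σ = s_i(τ)` and this is a step upwards, `s_i(τ) > τ`: the labels `i`, `i + 1` are exchanged,
and either `w_τ(i) < w_τ(i+1)`, or the exponents agree and `c_τ(i) - c_τ(i+1) > 1`. -/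
def SwapUp (i : ℕ) (h : i + 1 < n) (τ σ : PSYT n mu) : Prop :=
  σ.wt = τ.wt ∧
  σ.idx = τ.idx.trans (Equiv.swap ⟨i, Nat.lt_of_succ_lt h⟩ ⟨i + 1, h⟩) ∧
  (τ.w ⟨i, Nat.lt_of_succ_lt h⟩ < τ.w ⟨i + 1, h⟩ ∨
    (τ.w ⟨i, Nat.lt_of_succ_lt h⟩ = τ.w ⟨i + 1, h⟩ ∧
      1 < τ.c ⟨i, Nat.lt_of_succ_lt h⟩ - τ.c ⟨i + 1, h⟩))

theorem rotate_symm_val (i : Fin n) :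
    (((finRotate n).symm i : Fin n) : ℕ) = if (i : ℕ) = 0 then n - 1 else (i : ℕ) - 1 := by
  obtain _ | m := n
  · exact i.elim0
  · by_cases h : i = 0
    · subst h
      have h1 : (finRotate (m + 1)).symm 0 = Fin.last m := by
        rw [Equiv.symm_apply_eq]; exact finRotate_last.symm
      simp [h1]
    · have h' : (i : ℕ) ≠ 0 := fun hh => h (Fin.ext hh)
      rw [coe_finRotate_symm_of_ne_zero h, if_neg h']

/-- The map `Ψ`: the label `k q^a` becomes `(k-1) q^a` if `k ≥ 2`, and `n q^(a+1)` if `k = 1`. -/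
def psi (τ : PSYT n mu) : PSYT n mu where
  idx := τ.idx.trans (finRotate n).symm
  wt b := if (τ.idx b : ℕ) = 0 then τ.wt b + 1 else τ.wt b
  row_lt a b h1 h2 := by
    have h := τ.row_lt a b h1 h2
    have ha := (τ.idx a).2
    have hb := (τ.idx b).2
    simp only [labelLT, Equiv.trans_apply, rotate_symm_val] at h ⊢
    split_ifs <;> omega
  col_lt a b h1 h2 := by
    have h := τ.col_lt a b h1 h2
    have ha := (τ.idx a).2
    have hb := (τ.idx b).2
    simp only [labelLT, Equiv.trans_apply, rotate_symm_val] at h ⊢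
    split_ifs <;> omega

/-- The covering relations of the partial order on periodic standard Young tableaux. -/
def Cover (τ σ : PSYT n mu) : Prop :=
  σ = τ.psi ∨ ∃ (i : ℕ) (h : i + 1 < n), SwapUp i h τ σ

/-- The partial order on periodic standard Young tableaux. -/
def LE (τ σ : PSYT n mu) : Prop := Relation.ReflTransGen Cover τ σ

/-- `τ = Top(T)`: the largest periodic standard Young tableau with exponents `T`. -/
def IsTop (T : Box mu → ℕ) (τ : PSYT n mu) : Prop :=
  τ.wt = T ∧ ∀ σ : PSYT n mu, σ.wt = T → σ.LE τ

/-- `τ = Min(T)`: the smallest periodic standard Young tableau with exponents `T`. -/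
def IsMin (T : Box mu → ℕ) (τ : PSYT n mu) : Prop :=
  τ.wt = T ∧ ∀ σ : PSYT n mu, σ.wt = T → τ.LE σ

open Classical in
/-- The inversion pairs `(a, b)` of `τ`: the box `a` precedes `b` when the boxes are listed by
decreasing exponent, ties being broken by the column-standard order (that is, `S(T)(a) < S(T)(b)`
for the exponents `T` of `τ`), but the label index at `a` is the larger one. -/
noncomputable def inv (τ : PSYT n mu) : Finset (Box mu × Box mu) :=
  Finset.univ.filter fun p =>
    (τ.wt p.2 < τ.wt p.1 ∨ (τ.wt p.1 = τ.wt p.2 ∧ colBefore p.1 p.2)) ∧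
      τ.idx p.2 < τ.idx p.1

/-- The labels `k`, `k + 1` (counted from `0`) occur in the same row of `τ` with the same exponent
of `q`. -/
def Linked (τ : PSYT n mu) (k : ℕ) : Prop :=
  ∃ a b : Box mu, (τ.idx a : ℕ) = k ∧ (τ.idx b : ℕ) = k + 1 ∧ a.1.1 = b.1.1 ∧ τ.wt a = τ.wt b

open Classical in
/-- The position (counted from `1`) of the label `i` in its block, the blocks being the maximal
intervals `{j, j+1, …}` of labels in which consecutive labels are linked. -/
noncomputable def blockPos (τ : PSYT n mu) (i : Fin n) : ℕ :=
  (Finset.univ.filter fun j : Fin n =>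
    j ≤ i ∧ ∀ k : ℕ, (j : ℕ) ≤ k → k < (i : ℕ) → τ.Linked k).card

/-- `[μ]_t! = ∏ [μ_j]_t!` for the composition `μ` of `n` formed by the block sizes. -/
noncomputable def blockFact (τ : PSYT n mu) : Kqt := ∏ i : Fin n, tInt (τ.blockPos i)

end PSYT

/-! ### The positive double affine Hecke algebra

All indices are counted from `0`. -/

/-- Generators `T_i`, `θ_i`, `X_i`. -/
inductive DGen (n : ℕ) : Type
  | T (i : ℕ) (h : i + 1 < n) : DGen n
  | theta (i : ℕ) (h : i < n) : DGen n
  | X (i : ℕ) (h : i < n) : DGen n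

section Free

variable {n : ℕ}

/-- `T_i` in the free algebra. -/
noncomputable def fT (i : ℕ) (h : i + 1 < n) : FreeAlgebra Kqt (DGen n) := FreeAlgebra.ι Kqt (DGen.T i h)

/-- `θ_i` in the free algebra. -/
noncomputable def fTheta (i : ℕ) (h : i < n) : FreeAlgebra Kqt (DGen n) := FreeAlgebra.ι Kqt (DGen.theta i h)

/-- `X_i` in the free algebra. -/
noncomputable def fX (i : ℕ) (h : i < n) : FreeAlgebra Kqt (DGen n) := FreeAlgebra.ι Kqt (DGen.X i h)

/-- `T_i⁻¹`, which is `t⁻¹ (T_i + t - 1)` by the quadratic relation `(T_i - 1)(T_i + t) = 0`. -/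
noncomputable def fTinv (i : ℕ) (h : i + 1 < n) : FreeAlgebra Kqt (DGen n) :=
  t⁻¹ • (fT i h + algebraMap Kqt _ (t - 1))

/-- `π_n = t^(n-1) θ_1 T_1⁻¹ ⋯ T_(n-1)⁻¹` (for `n ≥ 1`). -/
noncomputable def fPi (h : 0 < n) : FreeAlgebra Kqt (DGen n) :=
  t ^ (n - 1) • (fTheta 0 h *
    (List.ofFn fun i : Fin (n - 1) => fTinv (n := n) i.1 (by omega)).prod)

end Free

/-- The defining relations of the positive double affine Hecke algebra of type `GL_n`. -/
inductive DRel (n : ℕ) : FreeAlgebra Kqt (DGen n) → FreeAlgebra Kqt (DGen n) → Prop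
  | quad (i : ℕ) (h : i + 1 < n) :
      DRel n ((fT i h - 1) * (fT i h + algebraMap Kqt _ t)) 0
  | braid (i : ℕ) (h : i + 1 + 1 < n) :
      DRel n (fT i (Nat.lt_of_succ_lt h) * fT (i + 1) h * fT i (Nat.lt_of_succ_lt h))
        (fT (i + 1) h * fT i (Nat.lt_of_succ_lt h) * fT (i + 1) h)
  | far (i j : ℕ) (hi : i + 1 < n) (hj : j + 1 < n) (hij : i + 1 < j) :
      DRel n (fT i hi * fT j hj) (fT j hj * fT i hi)
  | theta_comm (i j : ℕ) (hi : i < n) (hj : j < n) :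
      DRel n (fTheta i hi * fTheta j hj) (fTheta j hj * fTheta i hi)
  | theta_succ (i : ℕ) (h : i + 1 < n) :
      DRel n (fTheta (i + 1) h)
        (t • (fTinv i h * fTheta i (Nat.lt_of_succ_lt h) * fTinv i h))
  | T_theta (i j : ℕ) (hi : i + 1 < n) (hj : j < n) (h1 : j ≠ i) (h2 : j ≠ i + 1) :
      DRel n (fT i hi * fTheta j hj) (fTheta j hj * fT i hi)
  | X_comm (i j : ℕ) (hi : i < n) (hj : j < n) :
      DRel n (fX i hi * fX j hj) (fX j hj * fX i hi)
  | X_succ (i : ℕ) (h : i + 1 < n) :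
      DRel n (fX (i + 1) h) (t • (fTinv i h * fX i (Nat.lt_of_succ_lt h) * fTinv i h))
  | T_X (i j : ℕ) (hi : i + 1 < n) (hj : j < n) (h1 : j ≠ i) (h2 : j ≠ i + 1) :
      DRel n (fT i hi * fX j hj) (fX j hj * fT i hi)
  | pi_X (i : ℕ) (h : i + 1 < n) :
      DRel n (fPi (Nat.zero_lt_of_lt h) * fX i (Nat.lt_of_succ_lt h))
        (fX (i + 1) h * fPi (Nat.zero_lt_of_lt h))
  | pi_X_last (h : 0 < n) :
      DRel n (fPi h * fX (n - 1) (Nat.sub_lt h Nat.one_pos)) (q • (fX 0 h * fPi h))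

/-- The positive double affine Hecke algebra `D_n`. -/
def Daha (n : ℕ) : Type := RingQuot (DRel n)

noncomputable instance (n : ℕ) : Ring (Daha n) := RingQuot.instRing (DRel n)

noncomputable instance (n : ℕ) : Algebra Kqt (Daha n) := RingQuot.instAlgebra (DRel n)

/-- The quotient map from the free algebra onto `D_n`. -/
noncomputable def dMk (n : ℕ) : FreeAlgebra Kqt (DGen n) →ₐ[Kqt] Daha n :=
  RingQuot.mkAlgHom Kqt (DRel n)

section Gens

variable {n : ℕ}

noncomputable def gT (i : ℕ) (h : i + 1 < n) : Daha n := dMk n (fT i h)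

noncomputable def gTinv (i : ℕ) (h : i + 1 < n) : Daha n := dMk n (fTinv i h)

noncomputable def gTheta (i : ℕ) (h : i < n) : Daha n := dMk n (fTheta i h)

noncomputable def gX (i : ℕ) (h : i < n) : Daha n := dMk n (fX i h)

noncomputable def gPi (h : 0 < n) : Daha n := dMk n (fPi h)

/-- The intertwiner `φ_i = (t T_i⁻¹) θ_i - θ_i (t T_i⁻¹)`. -/
noncomputable def gPhi (i : ℕ) (h : i + 1 < n) : Daha n :=
  (t • gTinv i h) * gTheta i (Nat.lt_of_succ_lt h) -
    gTheta i (Nat.lt_of_succ_lt h) * (t • gTinv i h)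

/-- The monomial `X^α`. -/
noncomputable def gMon (α : Fin n → ℕ) : Daha n :=
  (List.ofFn fun i : Fin n => gX i.1 i.2 ^ α i).prod

/-- The elementary symmetric polynomial `e_r(X_1, …, X_n)`. -/
noncomputable def gElem (n r : ℕ) : Daha n :=
  ∑ A ∈ (Finset.univ : Finset (Fin n)).powersetCard r, gMon fun i => if i ∈ A then 1 else 0

end Gens

/-! ### The induced modules `V_μ` -/

/-- The free generator `τ`. -/
noncomputable def freeGen {n : ℕ} {mu : YoungDiagram} (τ : SYT n mu) : SYT n mu →₀ Daha n :=
  Finsupp.single τ 1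

/-- The relations, for the generators `τ ∈ SYT(μ)`, of the irreducible module of the finite Hecke
algebra labelled by `μ`, on which `θ_i` acts through `ρ_n`, that is, with eigenvalue `t^(c_τ(i))`
on `τ`. -/
inductive VRel (n : ℕ) (mu : YoungDiagram) : (SYT n mu →₀ Daha n) → Prop
  | weight (τ : SYT n mu) (i : Fin n) :
      VRel n mu (gTheta i.1 i.2 • freeGen τ - (t ^ τ.1.c i) • freeGen τ)
  | swap (τ σ : SYT n mu) (i : ℕ) (h : i + 1 < n) (hs : PSYT.SwapUp i h τ.1 σ.1) :
      VRel n mu (gPhi i h • freeGen τ -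
        (t ^ τ.1.c ⟨i, Nat.lt_of_succ_lt h⟩ - t ^ τ.1.c ⟨i + 1, h⟩) • freeGen σ)
  | row (τ : SYT n mu) (i : ℕ) (h : i + 1 < n)
      (hr : (τ.1.idx.symm ⟨i, Nat.lt_of_succ_lt h⟩).1.1 = (τ.1.idx.symm ⟨i + 1, h⟩).1.1) :
      VRel n mu (gT i h • freeGen τ - freeGen τ)
  | col (τ : SYT n mu) (i : ℕ) (h : i + 1 < n)
      (hc : (τ.1.idx.symm ⟨i, Nat.lt_of_succ_lt h⟩).1.2 = (τ.1.idx.symm ⟨i + 1, h⟩).1.2) :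
      VRel n mu (gT i h • freeGen τ + t • freeGen τ)

/-- The `D_n`-module `V_μ` induced from the affine Hecke algebra module `ρ_n^*(μ)`. The induced
module of a module given by generators and relations is given by the same generators and relations
over the larger algebra. -/
def V (n : ℕ) (mu : YoungDiagram) : Type :=
  (SYT n mu →₀ Daha n) ⧸ Submodule.span (Daha n) {x | VRel n mu x}

noncomputable instance (n : ℕ) (mu : YoungDiagram) : AddCommGroup (V n mu) :=
  inferInstanceAs
    (AddCommGroup ((SYT n mu →₀ Daha n) ⧸ Submodule.span (Daha n) {x | VRel n mu x}))

noncomputable instance (n : ℕ) (mu : YoungDiagram) : Module (Daha n) (V n mu) :=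
  inferInstanceAs
    (Module (Daha n) ((SYT n mu →₀ Daha n) ⧸ Submodule.span (Daha n) {x | VRel n mu x}))

noncomputable instance (n : ℕ) (mu : YoungDiagram) : Module Kqt (V n mu) :=
  Module.compHom (V n mu) (algebraMap Kqt (Daha n))

instance (n : ℕ) (mu : YoungDiagram) : IsScalarTower Kqt (Daha n) (V n mu) :=
  IsScalarTower.of_algebraMap_smul fun _ _ => rfl

section Modules

variable {n : ℕ} {mu : YoungDiagram}

/-- The element `1 ⊗ τ`. -/
noncomputable def vSYT (τ : SYT n mu) : V n mu :=
  Submodule.Quotient.mk (p := Submodule.span (Daha n) {x | VRel n mu x}) (freeGen τ)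

/-- The element `X^α ⊗ τ`. -/
noncomputable def vMon (α : Fin n → ℕ) (τ : SYT n mu) : V n mu := gMon α • vSYT τ

/-- The elements of `X`-degree at most `d`. -/
noncomputable def degLE (n : ℕ) (mu : YoungDiagram) (d : ℕ) : Submodule Kqt (V n mu) :=
  Submodule.span Kqt {x | ∃ (α : Fin n → ℕ) (τ : SYT n mu), ∑ i, α i ≤ d ∧ x = vMon α τ}

/-- The spherical subspace `W_μ` of Hecke invariants of `V_μ`: the image of the trivial
idempotent, i.e. the vectors fixed by all `T_i`. -/
def W (n : ℕ) (mu : YoungDiagram) : Set (V n mu) :=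
  {v | ∀ (i : ℕ) (h : i + 1 < n), gT i h • v = v}

/-- The properties that determine the non-symmetric vector-valued Macdonald polynomials `F_τ`:
they are `θ`-weight vectors, they extend the standard tableaux, and they satisfy the Knop–Sahi
relations, among them `F_{Ψ(τ)} = q^(w_τ(1)) X_n π_n⁻¹ F_τ`. -/
structure IsNonsymMac (F : PSYT n mu → V n mu) : Prop where
  weight : ∀ (τ : PSYT n mu) (i : Fin n),
    gTheta i.1 i.2 • F τ = (q ^ τ.w i * t ^ τ.c i) • F τ
  standard : ∀ τ : SYT n mu, F τ.1 = vSYT τ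
  swap : ∀ (τ σ : PSYT n mu) (i : ℕ) (h : i + 1 < n), PSYT.SwapUp i h τ σ →
    (t • gTinv i h) • F τ +
      ((t - 1) * (q ^ τ.w ⟨i + 1, h⟩ * t ^ τ.c ⟨i + 1, h⟩) /
        (q ^ τ.w ⟨i, Nat.lt_of_succ_lt h⟩ * t ^ τ.c ⟨i, Nat.lt_of_succ_lt h⟩ -
          q ^ τ.w ⟨i + 1, h⟩ * t ^ τ.c ⟨i + 1, h⟩)) • F τ = F σ
  psi : ∀ (τ : PSYT n mu) (h : 0 < n), ∃ v : V n mu, gPi h • v = F τ ∧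
    F τ.psi = (q ^ τ.w ⟨0, h⟩) • gX (n - 1) (Nat.sub_lt h Nat.one_pos) • v

/-- The non-symmetric vector-valued Macdonald polynomials `F_τ`. -/
noncomputable def nonsymMac : PSYT n mu → V n mu := Classical.epsilon IsNonsymMac

/-- `P` is the Hecke invariant vector of the form
`F_{Top(T)} + ∑_{y ≠ Top(T)} κ_y F_y`, where `y` has exponents `T`. -/
def IsSymMac (T : RSSYT mu) (P : V n mu) : Prop :=
  P ∈ W n mu ∧ ∃ τ : PSYT n mu, PSYT.IsTop T.toFun τ ∧
    P - nonsymMac τ ∈ Submodule.span Kqt {x | ∃ y : PSYT n mu, y.wt = T.toFun ∧ y ≠ τ ∧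
      x = nonsymMac y}

/-- The symmetric vector-valued Macdonald polynomial `P_T`. -/
noncomputable def symMac (n : ℕ) {mu : YoungDiagram} (T : RSSYT mu) : V n mu :=
  Classical.epsilon (IsSymMac T)

end Modules

/-! ### The explicit finite-rank Pieri coefficients -/

section Explicit

variable {mu : YoungDiagram}

/-- `q^(T(b)) t^(c(b))`. -/
noncomputable def boxWeight (T : Box mu → ℕ) (b : Box mu) : Kqt := q ^ T b * t ^ content b

open Classical in
/-- The factor `K_T(q,t) = [μ(T)]_t! / [n]_t! · ∏ (wt(a) - t wt(b)) / (wt(a) - wt(b))`, the product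
being over the inversions `(a, b)` of `Min(T)`. -/
noncomputable def kFactor (n : ℕ) (T : Box mu → ℕ) : Kqt :=
  if h : ∃ τ : PSYT n mu, PSYT.IsMin T τ then
    h.choose.blockFact / tFact n *
      ∏ p ∈ h.choose.inv, (boxWeight T p.1 - t * boxWeight T p.2) /
        (boxWeight T p.1 - boxWeight T p.2)
  else 0

/-- The explicit formula for the coefficient `d^{(r)}_{S,T}`, the sum being over the
periodic standard tableaux `τ` with exponents `T` for which `Ψ^r(τ)` has exponents `S`. -/
noncomputable def pieriFormula (n r : ℕ) (S T : RSSYT mu) : Kqt :=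
  (∑ A ∈ (Finset.univ : Finset (Fin n)).powersetCard r, ∏ i ∈ A, t ^ (i : ℕ)) *
    kFactor n S.toFun *
    ∑ᶠ (τ : PSYT n mu) (_ : τ.wt = T.toFun ∧ (PSYT.psi^[r] τ).wt = S.toFun),
      (∏ i : Fin n, if (i : ℕ) < r then t ^ τ.c i else 1) *
      (∏ p ∈ τ.inv, (t * boxWeight T.toFun p.1 - boxWeight T.toFun p.2) /
        (boxWeight T.toFun p.1 - boxWeight T.toFun p.2)) *
      (∏ p ∈ (PSYT.psi^[r] τ).inv, (boxWeight S.toFun p.1 - boxWeight S.toFun p.2) /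
        (boxWeight S.toFun p.1 - t * boxWeight S.toFun p.2))

end Explicit

/-! ### The stable limit -/

/-- `n_λ = |λ| + λ_1`. -/
def nMin (lam : YoungDiagram) : ℕ := lam.card + lam.rowLen 0

/-- `λ^{(n)} = (n - |λ|, λ_1, λ_2, …)` for `n ≥ n_λ`. -/
def padded (lam : YoungDiagram) (n : ℕ) (h : nMin lam ≤ n) : YoungDiagram where
  cells := (Finset.range (n - lam.card)).image (fun j => (0, j)) ∪
    lam.cells.image (fun b => (b.1 + 1, b.2))
  isLowerSet := by
    rintro ⟨a1, a2⟩ ⟨b1, b2⟩ ⟨h1, h2⟩ ha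
    simp only [Finset.coe_union, Finset.coe_image, Set.mem_union, Set.mem_image,
      Finset.mem_coe, Finset.mem_range, Prod.mk.injEq, YoungDiagram.mem_cells, Prod.exists] at *
    unfold nMin at h
    rcases ha with ⟨j, hj, rfl, rfl⟩ | ⟨x, y, hxy, rfl, rfl⟩
    · left; exact ⟨b2, by omega, by omega, rfl⟩
    · obtain _ | b1 := b1
      · left
        have h3 : (0, b2) ∈ lam := lam.up_left_mem (Nat.zero_le _) h2 hxy
        rw [YoungDiagram.mem_iff_lt_rowLen] at h3
        exact ⟨b2, by omega, rfl, rfl⟩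
      · right
        exact ⟨b1, b2, lam.up_left_mem (by omega) h2 hxy, rfl, rfl⟩

theorem mem_padded {lam : YoungDiagram} {n : ℕ} {h : nMin lam ≤ n} {b : ℕ × ℕ} :
    b ∈ padded lam n h ↔
      (b.1 = 0 ∧ b.2 < n - lam.card) ∨ ∃ i, b.1 = i + 1 ∧ (i, b.2) ∈ lam := by
  obtain ⟨b1, b2⟩ := b
  rw [← YoungDiagram.mem_cells]
  simp only [padded, Finset.mem_union, Finset.mem_image, Finset.mem_range, Prod.mk.injEq,
    YoungDiagram.mem_cells, Prod.exists]
  constructor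
  · rintro (⟨j, hj, rfl, rfl⟩ | ⟨x, y, hxy, rfl, rfl⟩)
    · exact Or.inl ⟨rfl, hj⟩
    · exact Or.inr ⟨x, rfl, hxy⟩
  · rintro (⟨rfl, hj⟩ | ⟨i, rfl, hi⟩)
    · exact Or.inl ⟨b2, hj, rfl, rfl⟩
    · exact Or.inr ⟨i, b2, hi, rfl, rfl⟩

/-- The infinite diagram `λ^{(∞)} = ⋃ λ^{(n)}`. -/
def infDiagram (lam : YoungDiagram) : Set (ℕ × ℕ) :=
  {b | ∃ (n : ℕ) (h : nMin lam ≤ n), b ∈ padded lam n h}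

/-- `Ω(λ)`: finitely supported labellings of `λ^{(∞)}` that decrease weakly along rows and strictly
down columns. -/
@[ext]
structure Omega (lam : YoungDiagram) where
  toFun : infDiagram lam → ℕ
  finite_support : {b | toFun b ≠ 0}.Finite
  row_weak : ∀ a b : infDiagram lam, a.1.1 = b.1.1 → a.1.2 < b.1.2 → toFun b ≤ toFun a
  col_strict : ∀ a b : infDiagram lam, a.1.2 = b.1.2 → a.1.1 < b.1.1 → toFun b < toFun a

/-- The restriction `T|_{λ^{(n)}}`. -/
def Omega.restrict {lam : YoungDiagram} (T : Omega lam) (n : ℕ) (h : nMin lam ≤ n) :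
    RSSYT (padded lam n h) where
  toFun b := T.toFun ⟨b.1, n, h, b.2⟩
  row_weak a b h1 h2 := T.row_weak ⟨a.1, n, h, a.2⟩ ⟨b.1, n, h, b.2⟩ h1 h2
  col_strict a b h1 h2 := T.col_strict ⟨a.1, n, h, a.2⟩ ⟨b.1, n, h, b.2⟩ h1 h2

/-- The rank `rk(T)`: the least `n ≥ n_λ` such that `T` vanishes outside `λ^{(n)}`. -/
noncomputable def Omega.rk {lam : YoungDiagram} (T : Omega lam) : ℕ :=
  sInf {n | ∃ h : nMin lam ≤ n, ∀ b : infDiagram lam, b.1 ∉ padded lam n h → T.toFun b = 0}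

/-- The added box `λ^{(n+1)} / λ^{(n)}`. -/
def newBox (lam : YoungDiagram) (n : ℕ) (h : nMin lam ≤ n) :
    Box (padded lam (n + 1) (Nat.le_succ_of_le h)) :=
  ⟨(0, n - lam.card), mem_padded.2 (Or.inl ⟨rfl, by
    have : lam.card ≤ n := le_trans (Nat.le_add_right _ _) h
    change n - lam.card < n + 1 - lam.card
    omega⟩)⟩

/-- `σ = τ|_{λ^{(n)}}` for standard tableaux. -/
def IsRestriction {lam : YoungDiagram} {n : ℕ} {h : nMin lam ≤ n}
    (τ : SYT (n + 1) (padded lam (n + 1) (Nat.le_succ_of_le h)))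
    (σ : SYT n (padded lam n h)) : Prop :=
  ∀ (a : Box (padded lam (n + 1) (Nat.le_succ_of_le h))) (b : Box (padded lam n h)),
    a.1 = b.1 → (τ.1.idx a : ℕ) = (σ.1.idx b : ℕ)

/-- `Φ(X^α ⊗ τ) = 1(α_{n+1} = 0) X_1^{α_1} ⋯ X_n^{α_n} ⊗ 𝔮(τ)`, where `𝔮(τ)` is the restriction of
`τ` to `λ^{(n)}` if the added box has the label `n + 1`, and `0` otherwise. -/
structure IsConnecting {lam : YoungDiagram} {n : ℕ} {h : nMin lam ≤ n}
    (Φ : V (n + 1) (padded lam (n + 1) (Nat.le_succ_of_le h)) →ₗ[Kqt] V n (padded lam n h)) :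
    Prop where
  restrict : ∀ α τ σ, (τ.1.idx (newBox lam n h) : ℕ) = n → IsRestriction τ σ →
    Φ (vMon α τ) = if α (Fin.last n) = 0 then vMon (fun i => α i.castSucc) σ else 0
  vanish : ∀ α τ, (τ.1.idx (newBox lam n h) : ℕ) ≠ n → Φ (vMon α τ) = 0

/-- The connecting map `Φ_λ^{(n)} : V_{λ^{(n+1)}} → V_{λ^{(n)}}`. -/
noncomputable def connecting (lam : YoungDiagram) (n : ℕ) (h : nMin lam ≤ n) :
    V (n + 1) (padded lam (n + 1) (Nat.le_succ_of_le h)) →ₗ[Kqt] V n (padded lam n h) :=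
  Classical.epsilon IsConnecting

/-- Families of vectors in the modules `V_{λ^{(n)}}`, `n ≥ n_λ`. -/
abbrev Families (lam : YoungDiagram) : Type :=
  ∀ n : {n : ℕ // nMin lam ≤ n}, V n.1 (padded lam n.1 n.2)

/-- `W̃_λ`: the families of bounded `X`-degree in the inverse limit of the spaces `W_{λ^{(n)}}`
along the connecting maps. -/
def stableW (lam : YoungDiagram) : Set (Families lam) :=
  {w | (∀ n, w n ∈ W n.1 (padded lam n.1 n.2)) ∧
    (∀ (n : ℕ) (h : nMin lam ≤ n),
      connecting lam n h (w ⟨n + 1, Nat.le_succ_of_le h⟩) = w ⟨n, h⟩) ∧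
    ∃ d : ℕ, ∀ n, w n ∈ degLE n.1 (padded lam n.1 n.2) d}

/-- The generalized symmetric Macdonald function `lim_n P_{T|λ^{(n)}}`: the element of `W̃_λ` whose
component is `P_{T|λ^{(n)}}` for all large `n`. -/
noncomputable def genMac {lam : YoungDiagram} (T : Omega lam) : Families lam :=
  Classical.epsilon fun w => w ∈ stableW lam ∧
    ∃ N : ℕ, ∀ (n : ℕ) (h : nMin lam ≤ n), N ≤ n → w ⟨n, h⟩ = symMac n (T.restrict n h)

/-- The multiplication operator `e_r[X]^•`, acting on the component `n` as `e_r(X_1, …, X_n)`. -/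
noncomputable def elemMul {lam : YoungDiagram} (r : ℕ) (w : Families lam) : Families lam :=
  fun n => gElem n.1 r • w n

end VVMac

open VVMac

namespace VVMac

/-! ### Monomials in `q` and `t` -/

/-! The periodic tableaux form a basis of an explicit module, in which the whole statement becomes a
matter of coefficients. On `Mod`, with basis vectors `eb τ`, the θ_i act diagonally by the weights
q^w t^c, the T_i act in seminormal form (a diagonal term plus a multiple of s_i(τ)), and a raising
operator A sends τ to a multiple of Ψ(τ). These operators satisfy the relations of `HeckeData`, and
any such data extend to the double affine Hecke algebra by X_n = A π_n and X_i = t⁻¹ T_i X_{i+1} T_i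
(`HeckeData.hom`). The universal property of V_μ then yields `toMod`. It is onto, because Ψ and
upward exchanges produce every tableau from a standard one (`PSYT.induction`). It is injective,
because the monomials span V_μ (`span_monFamily`) and a count in bounded degree shows that their
images are independent. Under the resulting isomorphism `modEquiv` the F_τ are the basis vectors
(`nonsymMac_eq`).

In these coordinates a vector is Hecke invariant iff its coefficients obey a recursion along
exchanges. It is therefore determined by its coefficients at the tableaux Top(S), and P_S becomes
`symVec`, whose coefficients are the products `kap` over inversions (`symMac_eq`).

The coefficient of P_S in an invariant vector is read off by a functional L_S = `coeffFun` on the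
whole module, supported on the tableaux with exponents S and satisfying L_S ∘ T_i = L_S. Its values
are K_S times the products `eta`. The normalization L_S(P_S) = 1 is the identity ∑_w ∏_{i<j}
(x_{w(i)} - t x_{w(j)}) / (x_{w(i)} - x_{w(j)}) = [n]_t! (`sum_perm_prod`), in which the numberings
that are not tableaux contribute zero; the block factorials in K_S complete its inversion product to
one over all pairs of boxes (`kFactor_eq`).

Since e_r commutes with the T_i, the vector e_r P_T is invariant. Invariance of both P_T and L_S
reduces every squarefree monomial of degree r to X_{n-r+1} ⋯ X_n up to a power of t, which produces
e_r(1, t, …, t^{n-1}). Moreover X_{n-r+1} ⋯ X_n = A^r π^r, and on an invariant vector π^r is a power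
of t times θ_1 ⋯ θ_r. On F_τ the powers of q cancel and A^r θ_1 ⋯ θ_r gives t^{c_τ(1)+⋯+c_τ(r)}
F_{Ψ^r(τ)}; this is the formula (`coeffFun_gElem`).

For the limit, the connecting map is dual to placing the last label with exponent zero in the new
box (`AddBox.phi`). It kills multiples of X_{n+1} and commutes with the remaining X_i, hence with
e_r, and it sends P_S to P of the restriction, or to 0 if S is nonzero on the new box. So the
expansions for n and n + 1 agree on labellings of rank at most n (`expansion_succ`). No labelling of
rank n + 1 enters once n ≥ rk(T) + r: the label of the new box then exceeds r, so Ψ^r leaves its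
exponent zero (`pieriFormula_eq_zero`). The coefficients at n = rk(T) + r therefore determine all
the others. -/

theorem q_ne_zero : q ≠ 0 := by
  unfold q
  rw [Ne, map_eq_zero_iff _ (IsFractionRing.injective (MvPolynomial (Fin 2) ℚ) Kqt)]
  exact MvPolynomial.X_ne_zero _

theorem t_ne_zero : t ≠ 0 := by
  unfold t
  rw [Ne, map_eq_zero_iff _ (IsFractionRing.injective (MvPolynomial (Fin 2) ℚ) Kqt)]
  exact MvPolynomial.X_ne_zero _

theorem monomial_inj {a b a' b' : ℕ} (h : q ^ a * t ^ b = q ^ a' * t ^ b') :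
    a = a' ∧ b = b' := by
  unfold q t at h
  simp only [← map_pow, ← map_mul] at h
  have h1 := IsFractionRing.injective (MvPolynomial (Fin 2) ℚ) Kqt h
  simp only [MvPolynomial.X_pow_eq_monomial, MvPolynomial.monomial_mul, mul_one] at h1
  have h2 := MvPolynomial.monomial_left_injective (R := ℚ) one_ne_zero h1
  have e0 := DFunLike.congr_fun h2 0
  have e1 := DFunLike.congr_fun h2 1
  simpa using And.intro e0 e1

/-- Contents may be negative, so both sides are first multiplied by powers of t that turn them into
honest monomials. -/
theorem weight_inj {a a' : ℕ} {b b' : ℤ} (h : q ^ a * t ^ b = q ^ a' * t ^ b') :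
    a = a' ∧ b = b' := by
  obtain ⟨m, k, hm⟩ : ∃ m k : ℕ, b = m - k := ⟨b.toNat, (-b).toNat, by omega⟩
  obtain ⟨m', k', hm'⟩ : ∃ m k : ℕ, b' = m - k := ⟨b'.toNat, (-b').toNat, by omega⟩
  have ht := t_ne_zero
  have h1 : q ^ a * t ^ (m + k') = q ^ a' * t ^ (m' + k) := by
    have := congrArg (fun z => z * t ^ (k : ℤ) * t ^ (k' : ℤ)) h
    simp only [mul_assoc, ← zpow_add₀ ht] at this
    rwa [show b + (k : ℤ) + k' = ((m + k' : ℕ) : ℤ) by push_cast; omega,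
      show b' + (k : ℤ) + k' = ((m' + k : ℕ) : ℤ) by push_cast; omega,
      zpow_natCast, zpow_natCast] at this
  obtain ⟨h2, h3⟩ := monomial_inj h1
  exact ⟨h2, by omega⟩

theorem t_pow_ne_one {m : ℕ} (hm : 0 < m) : t ^ m ≠ 1 := fun h => by
  have := monomial_inj (a := 0) (a' := 0) (b := m) (b' := 0) (by simpa using h)
  omega

theorem t_sub_one_ne_zero : t - 1 ≠ 0 := by
  have := t_pow_ne_one one_pos
  rw [pow_one] at this
  exact sub_ne_zero.2 this

theorem one_sub_t_ne_zero : 1 - t ≠ 0 := by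
  have := t_sub_one_ne_zero
  rwa [← neg_sub, neg_ne_zero]

theorem t_add_one_ne_zero : t + 1 ≠ 0 := fun h => by
  apply t_pow_ne_one two_pos
  linear_combination (t - 1) * h

theorem tInt_ne_zero {m : ℕ} (hm : 0 < m) : tInt m ≠ 0 :=
  div_ne_zero (sub_ne_zero.2 (t_pow_ne_one hm).symm) one_sub_t_ne_zero

theorem tFact_ne_zero (m : ℕ) : tFact m ≠ 0 :=
  Finset.prod_ne_zero_iff.2 fun _ _ => tInt_ne_zero (Nat.succ_pos _)

section BoxWeight

variable {mu : YoungDiagram} {T : Box mu → ℕ} {a b : Box mu}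

theorem boxWeight_ne_zero (T : Box mu → ℕ) (a : Box mu) : boxWeight T a ≠ 0 :=
  mul_ne_zero (pow_ne_zero _ q_ne_zero) (zpow_ne_zero _ t_ne_zero)

theorem boxWeight_inj (h : boxWeight T a = boxWeight T b) : T a = T b ∧ content a = content b :=
  weight_inj h

theorem boxWeight_eq_t_mul (h : boxWeight T a = t * boxWeight T b) :
    T a = T b ∧ content a = content b + 1 := by
  apply weight_inj
  rw [zpow_add_one₀ t_ne_zero]
  unfold boxWeight at h
  rw [h]; ring

theorem boxWeight_of_content_eq (hT : T a = T b) (hc : content a = content b + 1) :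
    boxWeight T a = t * boxWeight T b := by
  unfold boxWeight
  rw [hT, hc, zpow_add_one₀ t_ne_zero]; ring

end BoxWeight

/-! ### Comparing labels of a periodic tableau -/

namespace PSYT

variable {n : ℕ} {mu : YoungDiagram}

theorem box_ext {a b : Box mu} (h1 : a.1.1 = b.1.1) (h2 : a.1.2 = b.1.2) : a = b :=
  Subtype.ext (Prod.ext h1 h2)

theorem labelLT_trans {x y z : ℕ × ℕ} (h1 : labelLT x y) (h2 : labelLT y z) : labelLT x z := by
  unfold labelLT at *; omega

/-- Labels increase to the south-east. -/
theorem labelLT_of_le (τ : PSYT n mu) {a b : Box mu} (h1 : a.1.1 ≤ b.1.1) (h2 : a.1.2 ≤ b.1.2)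
    (hne : a ≠ b) : labelLT ((τ.idx a : ℕ), τ.wt a) ((τ.idx b : ℕ), τ.wt b) := by
  rcases h1.eq_or_lt with h1' | h1'
  · rcases h2.eq_or_lt with h2' | h2'
    · exact absurd (box_ext h1' h2') hne
    · exact τ.row_lt a b h1' h2'
  · rcases h2.eq_or_lt with h2' | h2'
    · exact τ.col_lt a b h2' h1'
    · let m : Box mu := ⟨(a.1.1, b.1.2), mu.up_left_mem h1 le_rfl b.2⟩
      exact labelLT_trans (τ.row_lt a m rfl h2') (τ.col_lt m b rfl h1')

theorem ext_idx {τ σ : PSYT n mu} (hw : τ.wt = σ.wt) (h : ∀ b, (τ.idx b : ℕ) = σ.idx b) :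
    τ = σ := by
  ext b
  · exact h b
  · rw [hw]

/-- Two boxes with equal exponents in one row or one column. -/
def Rigid (T : Box mu → ℕ) (a b : Box mu) : Prop :=
  T a = T b ∧ (a.1.1 = b.1.1 ∨ a.1.2 = b.1.2)

/-- The condition on the boxes of the labels `i`, `i + 1` under which exchanging the labels is a
step upwards. -/
def Up (T : Box mu → ℕ) (a b : Box mu) : Prop :=
  T a < T b ∨ (T a = T b ∧ 1 < content a - content b)

theorem Rigid.symm {T : Box mu → ℕ} {a b : Box mu} (h : Rigid T a b) : Rigid T b a :=
  ⟨h.1.symm, h.2.imp Eq.symm Eq.symm⟩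

/-! ### Relative position of boxes with consecutive labels. -/

section Consecutive

variable (τ : PSYT n mu) {a b : Box mu}

/-- Boxes with consecutive labels and equal exponents, comparable in the south-east order, are
neighbours. -/
theorem adjacent_of_le (hi : (τ.idx b : ℕ) = τ.idx a + 1) (hw : τ.wt a = τ.wt b)
    (h1 : a.1.1 ≤ b.1.1) (h2 : a.1.2 ≤ b.1.2) :
    (a.1.1 = b.1.1 ∧ b.1.2 = a.1.2 + 1) ∨ (a.1.2 = b.1.2 ∧ b.1.1 = a.1.1 + 1) := by
  have hne : a ≠ b := by rintro rfl; omega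
  -- A third box between `a` and `b` would carry the same exponent and a label index strictly
  -- between two consecutive integers.
  have key : ∀ m : Box mu, a.1.1 ≤ m.1.1 → a.1.2 ≤ m.1.2 → m.1.1 ≤ b.1.1 → m.1.2 ≤ b.1.2 →
      m = a ∨ m = b := by
    intro m ha1 ha2 hb1 hb2
    by_contra! hm
    have l1 := τ.labelLT_of_le ha1 ha2 hm.1.symm
    have l2 := τ.labelLT_of_le hb1 hb2 hm.2
    simp only [labelLT] at l1 l2
    omega
  by_cases hr : a.1.1 = b.1.1
  · left
    refine ⟨hr, ?_⟩
    have hlt : a.1.2 < b.1.2 := lt_of_le_of_ne h2 fun h => hne (box_ext hr h)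
    rcases key ⟨(a.1.1, a.1.2 + 1), mu.up_left_mem h1 hlt b.2⟩ le_rfl (Nat.le_succ _) h1 hlt
      with h | h
    · have := congrArg (fun m : Box mu => m.1.2) h
      simp at this
    · exact (congrArg (fun m : Box mu => m.1.2) h).symm
  · have hlt : a.1.1 < b.1.1 := lt_of_le_of_ne h1 hr
    rcases key ⟨(a.1.1 + 1, a.1.2), mu.up_left_mem hlt h2 b.2⟩ (Nat.le_succ _) le_rfl hlt h2
      with h | h
    · have := congrArg (fun m : Box mu => m.1.1) h
      simp at this
    · have e1 := congrArg (fun m : Box mu => m.1.1) h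
      have e2 := congrArg (fun m : Box mu => m.1.2) h
      exact Or.inr ⟨e2, e1.symm⟩

/-- Labels increase to the south-east, so of two boxes in one row or column the smaller label comes
first; consecutive labels then force the boxes to be neighbours. -/
theorem Rigid.content_eq (hi : (τ.idx b : ℕ) = τ.idx a + 1) (h : Rigid τ.wt a b) :
    (a.1.1 = b.1.1 ∧ content b = content a + 1) ∨
      (a.1.2 = b.1.2 ∧ content a = content b + 1) := by
  have hne : b ≠ a := by rintro rfl; omega
  have hle : a.1.1 ≤ b.1.1 ∧ a.1.2 ≤ b.1.2 := by
    have hw := h.1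
    by_contra hcon
    have l := τ.labelLT_of_le (a := b) (b := a) (by rcases h.2 with h | h <;> omega)
      (by rcases h.2 with h | h <;> omega) hne
    simp only [labelLT] at l
    omega
  rcases τ.adjacent_of_le hi h.1 hle.1 hle.2 with h | h
  · exact Or.inl ⟨h.1, by unfold content; omega⟩
  · exact Or.inr ⟨h.1, by unfold content; omega⟩

/-- Boxes comparable in the south-east order would be neighbours, hence rigid. So one box lies
strictly north-east of the other, which separates the contents by at least two. -/
theorem content_of_not_rigid (hi : (τ.idx b : ℕ) = τ.idx a + 1) (h : ¬ Rigid τ.wt a b)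
    (hw : τ.wt a = τ.wt b) : 1 < content a - content b ∨ 1 < content b - content a := by
  have hne : b ≠ a := by rintro rfl; omega
  have h2 : a.1.1 ≠ b.1.1 ∧ a.1.2 ≠ b.1.2 := not_or.1 fun h' => h ⟨hw, h'⟩
  have n1 : ¬ (a.1.1 ≤ b.1.1 ∧ a.1.2 ≤ b.1.2) := fun hle => by
    have := τ.adjacent_of_le hi hw hle.1 hle.2
    omega
  have n2 : ¬ (b.1.1 ≤ a.1.1 ∧ b.1.2 ≤ a.1.2) := fun hle => by
    have l := τ.labelLT_of_le hle.1 hle.2 hne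
    simp only [labelLT] at l
    omega
  unfold content
  omega

theorem up_or_up (hi : (τ.idx b : ℕ) = τ.idx a + 1) (h : ¬ Rigid τ.wt a b) :
    Up τ.wt a b ∨ Up τ.wt b a := by
  rcases lt_trichotomy (τ.wt a) (τ.wt b) with hw | hw | hw
  · exact Or.inl (Or.inl hw)
  · exact (τ.content_of_not_rigid hi h hw).imp (fun h => Or.inr ⟨hw, h⟩)
      fun h => Or.inr ⟨hw.symm, h⟩
  · exact Or.inr (Or.inl hw)

/-- Keeps the denominators in the seminormal form of T_i nonzero. -/
theorem boxWeight_ne (hi : (τ.idx b : ℕ) = τ.idx a + 1) :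
    boxWeight τ.wt a ≠ boxWeight τ.wt b := by
  intro h
  obtain ⟨h1, h2⟩ := boxWeight_inj h
  by_cases hr : Rigid τ.wt a b
  · have := hr.content_eq τ hi
    omega
  · have := τ.content_of_not_rigid hi hr h1
    omega

/-- Keeps the squared intertwiner `cC` nonzero away from rigid pairs; at rigid pairs it vanishes. -/
theorem boxWeight_ne_t_mul (hi : (τ.idx b : ℕ) = τ.idx a + 1) (hr : ¬ Rigid τ.wt a b) :
    boxWeight τ.wt a ≠ t * boxWeight τ.wt b ∧ boxWeight τ.wt b ≠ t * boxWeight τ.wt a := by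
  constructor <;> intro h <;> obtain ⟨h1, h2⟩ := boxWeight_eq_t_mul h
  · have := τ.content_of_not_rigid hi hr h1
    omega
  · have := τ.content_of_not_rigid hi hr h1.symm
    omega

/-- Boxes whose labels differ by two have different weights. -/
theorem boxWeight_ne_of_add_two (hi : (τ.idx b : ℕ) = τ.idx a + 2) :
    boxWeight τ.wt a ≠ boxWeight τ.wt b := by
  intro h
  obtain ⟨hw, hc⟩ := boxWeight_inj h
  have hne : b ≠ a := by rintro rfl; omega
  have hle : a.1.1 < b.1.1 ∧ a.1.2 < b.1.2 := by
    unfold content at hc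
    by_contra hcon
    have l := τ.labelLT_of_le (a := b) (b := a) (by omega) (by omega) hne
    simp only [labelLT] at l
    omega
  let m : Box mu := ⟨(a.1.1, b.1.2), mu.up_left_mem hle.1.le le_rfl b.2⟩
  let k : Box mu := ⟨(b.1.1, a.1.2), mu.up_left_mem le_rfl hle.2.le b.2⟩
  have l1 := τ.row_lt a m rfl hle.2
  have l2 := τ.col_lt m b rfl hle.1
  have l3 := τ.col_lt a k rfl hle.1
  have l4 := τ.row_lt k b rfl hle.2
  simp only [labelLT] at l1 l2 l3 l4
  -- The two remaining corners of the rectangle spanned by `a` and `b` would both have to carry the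
  -- single label in between.
  have hmk : τ.idx m = τ.idx k := Fin.ext (by omega)
  have := congrArg (fun z : Box mu => z.1.1) (τ.idx.injective hmk)
  simp only [m, k] at this
  omega

end Consecutive

theorem not_up_symm {T : Box mu → ℕ} {a b : Box mu} (h : Up T a b) : ¬ Up T b a := by
  unfold Up at *; omega

theorem swap_val {i j : Fin n} (k : Fin n) :
    ((Equiv.swap i j k : Fin n) : ℕ) =
      if (k : ℕ) = i then (j : ℕ) else if (k : ℕ) = j then (i : ℕ) else k := by
  rw [Equiv.swap_apply_def]
  simp only [Fin.ext_iff]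
  split_ifs <;> rfl

/-- The box of the label `i`. -/
def lo (τ : PSYT n mu) (i : ℕ) (h : i + 1 < n) : Box mu := τ.idx.symm ⟨i, Nat.lt_of_succ_lt h⟩

/-- The box of the label `i + 1`. -/
def hi (τ : PSYT n mu) (i : ℕ) (h : i + 1 < n) : Box mu := τ.idx.symm ⟨i + 1, h⟩

/-! ### The exchange s_i as a total involution on tableaux. -/

section Swap

variable (τ : PSYT n mu) (i : ℕ) (h : i + 1 < n)

theorem idx_lo : (τ.idx (τ.lo i h) : ℕ) = i := by simp [lo]

theorem idx_hi : (τ.idx (τ.hi i h) : ℕ) = i + 1 := by simp [hi]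

theorem idx_hi_lo : (τ.idx (τ.hi i h) : ℕ) = τ.idx (τ.lo i h) + 1 := by
  rw [idx_lo, idx_hi]

variable {i h} in
theorem eq_lo {b : Box mu} (hb : (τ.idx b : ℕ) = i) : b = τ.lo i h := by
  rw [lo, Equiv.eq_symm_apply]; exact Fin.ext hb

variable {i h} in
theorem eq_hi {b : Box mu} (hb : (τ.idx b : ℕ) = i + 1) : b = τ.hi i h := by
  rw [hi, Equiv.eq_symm_apply]; exact Fin.ext hb

/-- The tableau `s_i(τ)`. -/
def swapped (hr : ¬ Rigid τ.wt (τ.lo i h) (τ.hi i h)) : PSYT n mu where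
  idx := τ.idx.trans (Equiv.swap ⟨i, Nat.lt_of_succ_lt h⟩ ⟨i + 1, h⟩)
  wt := τ.wt
  row_lt a b h1 h2 := by
    have l := τ.row_lt a b h1 h2
    simp only [labelLT, Equiv.trans_apply, swap_val] at l ⊢
    have : ¬ ((τ.idx a : ℕ) = i ∧ (τ.idx b : ℕ) = i + 1 ∧ τ.wt a = τ.wt b) := by
      rintro ⟨ha, hb, hw⟩
      rw [τ.eq_lo (h := h) ha, τ.eq_hi (h := h) hb] at hw h1
      exact hr ⟨hw, Or.inl h1⟩
    split_ifs <;> omega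
  col_lt a b h1 h2 := by
    have l := τ.col_lt a b h1 h2
    simp only [labelLT, Equiv.trans_apply, swap_val] at l ⊢
    have : ¬ ((τ.idx a : ℕ) = i ∧ (τ.idx b : ℕ) = i + 1 ∧ τ.wt a = τ.wt b) := by
      rintro ⟨ha, hb, hw⟩
      rw [τ.eq_lo (h := h) ha, τ.eq_hi (h := h) hb] at hw h1
      exact hr ⟨hw, Or.inr h1⟩
    split_ifs <;> omega

open Classical in
/-- The tableau `s_i(τ)` where it exists, and `τ` otherwise. -/
noncomputable def sw : PSYT n mu :=
  if hr : Rigid τ.wt (τ.lo i h) (τ.hi i h) then τ else τ.swapped i h hr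

theorem sw_wt : (τ.sw i h).wt = τ.wt := by
  unfold sw; split_ifs <;> rfl

variable {i h}

theorem sw_of_rigid (hr : Rigid τ.wt (τ.lo i h) (τ.hi i h)) : τ.sw i h = τ := dif_pos hr

theorem sw_idx (hr : ¬ Rigid τ.wt (τ.lo i h) (τ.hi i h)) : (τ.sw i h).idx =
    τ.idx.trans (Equiv.swap ⟨i, Nat.lt_of_succ_lt h⟩ ⟨i + 1, h⟩) := by
  rw [sw, dif_neg hr]; rfl

theorem sw_idx_symm (hr : ¬ Rigid τ.wt (τ.lo i h) (τ.hi i h)) (j : Fin n) : (τ.sw i h).idx.symm j =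
    τ.idx.symm (Equiv.swap ⟨i, Nat.lt_of_succ_lt h⟩ ⟨i + 1, h⟩ j) := by
  rw [sw_idx τ hr]; rfl

theorem sw_lo (hr : ¬ Rigid τ.wt (τ.lo i h) (τ.hi i h)) : (τ.sw i h).lo i h = τ.hi i h := by
  rw [lo, sw_idx_symm τ hr, Equiv.swap_apply_left]; rfl

theorem sw_hi (hr : ¬ Rigid τ.wt (τ.lo i h) (τ.hi i h)) : (τ.sw i h).hi i h = τ.lo i h := by
  rw [hi, sw_idx_symm τ hr, Equiv.swap_apply_right]; rfl

theorem sw_idx_symm_of_ne (hr : ¬ Rigid τ.wt (τ.lo i h) (τ.hi i h))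
    (j : Fin n) (h1 : (j : ℕ) ≠ i) (h2 : (j : ℕ) ≠ i + 1) :
    (τ.sw i h).idx.symm j = τ.idx.symm j := by
  rw [sw_idx_symm τ hr, Equiv.swap_apply_of_ne_of_ne] <;> exact fun hh => by simp_all

theorem sw_not_rigid (hr : ¬ Rigid τ.wt (τ.lo i h) (τ.hi i h))
    : ¬ Rigid (τ.sw i h).wt ((τ.sw i h).lo i h) ((τ.sw i h).hi i h) := by
  rw [sw_lo τ hr, sw_hi τ hr, sw_wt]
  exact fun h' => hr h'.symm

theorem sw_sw : (τ.sw i h).sw i h = τ := by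
  by_cases hr : Rigid τ.wt (τ.lo i h) (τ.hi i h)
  · rw [sw_of_rigid τ hr, sw_of_rigid τ hr]
  · apply ext_idx (by rw [sw_wt, sw_wt])
    intro b
    rw [sw_idx _ (sw_not_rigid τ hr), sw_idx τ hr]
    simp

/-- An upward step never starts at a rigid pair, since there the exponents agree and the contents
differ by exactly one. The relation is thus the graph of `sw` on the upward pairs. -/
theorem swapUp_iff (σ : PSYT n mu) : SwapUp i h τ σ ↔
    σ = τ.sw i h ∧ Up τ.wt (τ.lo i h) (τ.hi i h) := by
  constructor
  · rintro ⟨h1, h2, h3⟩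
    have hu : Up τ.wt (τ.lo i h) (τ.hi i h) := h3
    have hr : ¬ Rigid τ.wt (τ.lo i h) (τ.hi i h) := by
      intro hr
      have := hr.content_eq τ (τ.idx_hi_lo i h)
      have := hr.1
      unfold Up at hu
      omega
    refine ⟨ext_idx (by rw [h1, sw_wt]) fun b => ?_, hu⟩
    rw [h2, sw_idx τ hr]
  · rintro ⟨rfl, hu⟩
    have hr : ¬ Rigid τ.wt (τ.lo i h) (τ.hi i h) := by
      intro hr
      have := hr.content_eq τ (τ.idx_hi_lo i h)
      have := hr.1
      unfold Up at hu
      omega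
    exact ⟨sw_wt τ i h, sw_idx τ hr, hu⟩

theorem not_rigid_of_up (hu : Up τ.wt (τ.lo i h) (τ.hi i h)) :
    ¬ Rigid τ.wt (τ.lo i h) (τ.hi i h) := by
  intro hr
  have := hr.content_eq τ (τ.idx_hi_lo i h)
  have := hr.1
  unfold Up at hu
  omega

end Swap

/-! ### The effect of `Ψ` on labels -/

theorem psi_idx (τ : PSYT n mu) (b : Box mu) : ((τ.psi.idx b : Fin n) : ℕ) =
    if (τ.idx b : ℕ) = 0 then n - 1 else (τ.idx b : ℕ) - 1 :=
  rotate_symm_val (τ.idx b)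

theorem psi_idx_symm_of_lt (τ : PSYT n mu) (j : ℕ) (hj : j + 1 < n) :
    τ.psi.idx.symm ⟨j, Nat.lt_of_succ_lt hj⟩ = τ.idx.symm ⟨j + 1, hj⟩ := by
  rw [Equiv.symm_apply_eq]
  apply Fin.ext
  rw [psi_idx]
  simp

theorem psi_idx_symm_last (τ : PSYT n mu) (hn : 0 < n) :
    τ.psi.idx.symm ⟨n - 1, Nat.sub_lt hn Nat.one_pos⟩ = τ.idx.symm ⟨0, hn⟩ := by
  rw [Equiv.symm_apply_eq]
  apply Fin.ext
  rw [psi_idx]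
  simp

theorem psi_wt (τ : PSYT n mu) (b : Box mu) :
    τ.psi.wt b = if (τ.idx b : ℕ) = 0 then τ.wt b + 1 else τ.wt b := rfl

theorem psi_lo (τ : PSYT n mu) (i : ℕ) (h : i + 1 < n) (h' : i + 1 + 1 < n) :
    τ.psi.lo i h = τ.lo (i + 1) h' := psi_idx_symm_of_lt τ i h

theorem psi_hi (τ : PSYT n mu) (i : ℕ) (h : i + 1 < n) (h' : i + 1 + 1 < n) :
    τ.psi.hi i h = τ.hi (i + 1) h' := psi_idx_symm_of_lt τ (i + 1) h'

end PSYT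

end VVMac

namespace VVMac

/-! ### Representations of `D_n` from the raising operator -/

/-- Elements `T_i`, `θ_i` and `A` of an algebra, where `A` satisfies the relations that hold for
`X_n π_n⁻¹` in the double affine Hecke algebra. The elements `Ti i` are the inverses of `T i`. -/
structure HeckeData (n : ℕ) (R : Type*) [Ring R] [Algebra Kqt R] where
  T : ℕ → R
  Ti : ℕ → R
  th : ℕ → R
  A : R
  T_Ti : ∀ i, T i * Ti i = 1
  Ti_T : ∀ i, Ti i * T i = 1
  Ti_eq : ∀ i, i + 1 < n → Ti i = t⁻¹ • (T i + algebraMap Kqt R (t - 1))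
  braid : ∀ i, i + 1 + 1 < n → T i * T (i + 1) * T i = T (i + 1) * T i * T (i + 1)
  far : ∀ i j, i + 1 < j → j + 1 < n → Commute (T i) (T j)
  th_comm : ∀ i j, i < n → j < n → Commute (th i) (th j)
  th_succ : ∀ i, i + 1 < n → th (i + 1) = t • (Ti i * th i * Ti i)
  T_th : ∀ i j, i + 1 < n → j < n → j ≠ i → j ≠ i + 1 → Commute (T i) (th j)
  A_T : ∀ i, i + 1 + 1 < n → A * T (i + 1) = T i * A
  A_A_T : ∀ k, n = k + 2 → A * A * T 0 = T k * A * A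
  A_th : ∀ i, i + 1 < n → A * th (i + 1) = th i * A
  A_th_zero : 0 < n → th (n - 1) * A = q • (A * th 0)

namespace HeckeData

variable {n : ℕ} {R : Type*} [Ring R] [Algebra Kqt R] (D : HeckeData n R)

theorem commute_Ti {a : R} {i : ℕ} (h : Commute a (D.T i)) : Commute a (D.Ti i) := by
  unfold Commute SemiconjBy at *
  calc a * D.Ti i = D.Ti i * D.T i * a * D.Ti i := by rw [D.Ti_T, one_mul]
    _ = D.Ti i * (a * D.T i) * D.Ti i := by rw [h]; simp only [mul_assoc]
    _ = D.Ti i * a := by rw [mul_assoc, mul_assoc, D.T_Ti, mul_one]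

/-- The product `T_0 ⋯ T_(m-1)`. -/
def P : ℕ → R
  | 0 => 1
  | m + 1 => P m * D.T m

/-- The product `T_1 ⋯ T_m`. -/
def P' : ℕ → R
  | 0 => 1
  | m + 1 => P' m * D.T (m + 1)

/-- The product `T_0⁻¹ ⋯ T_(m-1)⁻¹`. -/
def Q : ℕ → R
  | 0 => 1
  | m + 1 => Q m * D.Ti m

/-- The element `π_n`. -/
noncomputable def pi : R := t ^ (n - 1) • (D.th 0 * D.Q (n - 1))

/-- The elements `X_(n-1), X_(n-2), …`. -/
noncomputable def Xd : ℕ → R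
  | 0 => D.A * D.pi
  | k + 1 => t⁻¹ • (D.T (n - 2 - k) * Xd k * D.T (n - 2 - k))

/-- The elements `X_i`. -/
noncomputable def X (i : ℕ) : R := D.Xd (n - 1 - i)

theorem X_last : D.X (n - 1) = D.A * D.pi := by
  rw [X, Nat.sub_self, Xd]

theorem X_eq {i : ℕ} (h : i + 1 < n) : D.X i = t⁻¹ • (D.T i * D.X (i + 1) * D.T i) := by
  rw [X, X, show n - 1 - i = n - 1 - (i + 1) + 1 by omega, Xd,
    show n - 2 - (n - 1 - (i + 1)) = i by omega]

theorem T_mul_P' (m : ℕ) : D.T 0 * D.P' m = D.P (m + 1) := by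
  induction m with
  | zero => simp [P, P']
  | succ m ih => rw [P', ← mul_assoc, ih]; rfl

theorem commute_P {a : R} {m : ℕ} (h : ∀ i < m, Commute a (D.T i)) : Commute a (D.P m) := by
  induction m with
  | zero => exact Commute.one_right a
  | succ m ih => exact (ih fun i hi => h i (by omega)).mul_right (h m (by omega))

theorem commute_Q {a : R} {m : ℕ} (h : ∀ i < m, Commute a (D.T i)) : Commute a (D.Q m) := by
  induction m with
  | zero => exact Commute.one_right a
  | succ m ih => exact (ih fun i hi => h i (by omega)).mul_right (D.commute_Ti (h m (by omega)))

theorem braid_inv {i : ℕ} (h : i + 1 + 1 < n) :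
    D.Ti i * D.Ti (i + 1) * D.T i = D.T (i + 1) * D.Ti i * D.Ti (i + 1) := by
  have hb := D.braid i h
  calc D.Ti i * D.Ti (i + 1) * D.T i
      = D.Ti i * D.Ti (i + 1) * (D.T i * D.T (i + 1) * D.T i) * D.Ti i * D.Ti (i + 1) := by
        simp only [mul_assoc, D.T_Ti, mul_one]
    _ = D.Ti i * (D.Ti (i + 1) * D.T (i + 1)) * D.T i * D.T (i + 1) * D.Ti i * D.Ti (i + 1) := by
        rw [hb]; simp only [mul_assoc]
    _ = _ := by rw [D.Ti_T, mul_one, D.Ti_T, one_mul]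

/-- Every factor of the product commutes with the generator passing it, except the pair T_i⁻¹
T_{i+1}⁻¹, which turns T_i into T_{i+1} by `braid_inv`. -/
theorem Q_mul_T {i m : ℕ} (hi : i + 1 < m) (hm : m < n) :
    D.Q m * D.T i = D.T (i + 1) * D.Q m := by
  induction m with
  | zero => omega
  | succ m ih =>
    by_cases him : i + 1 < m
    · rw [Q, mul_assoc, ← (D.commute_Ti (D.far i m him hm)).eq, ← mul_assoc,
        ih him (by omega), mul_assoc]
    · obtain rfl : m = i + 1 := by omega
      have hc : Commute (D.T (i + 1)) (D.Q i) :=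
        D.commute_Q fun j hj => (D.far j (i + 1) (by omega) hm).symm
      calc D.Q i * D.Ti i * D.Ti (i + 1) * D.T i
          = D.Q i * (D.Ti i * D.Ti (i + 1) * D.T i) := by simp only [mul_assoc]
        _ = D.Q i * D.T (i + 1) * D.Ti i * D.Ti (i + 1) := by
          rw [D.braid_inv hm]; simp only [mul_assoc]
        _ = D.T (i + 1) * (D.Q i * D.Ti i * D.Ti (i + 1)) := by
          rw [← hc.eq]; simp only [mul_assoc]

theorem pi_mul_T {i : ℕ} (h : i + 1 + 1 < n) : D.pi * D.T i = D.T (i + 1) * D.pi := by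
  have hc := D.T_th (i + 1) 0 h (by omega) (by omega) (by omega)
  rw [pi, smul_mul_assoc, mul_smul_comm, mul_assoc, D.Q_mul_T (by omega) (by omega),
    ← mul_assoc, ← hc.eq, mul_assoc]

theorem th_mul_Ti {i : ℕ} (h : i + 1 < n) :
    t • (D.th i * D.Ti i) = D.T i * D.th (i + 1) := by
  rw [D.th_succ i h, mul_smul_comm, ← mul_assoc, ← mul_assoc, D.T_Ti, one_mul]

theorem Ti_mul_th {i : ℕ} (h : i + 1 < n) :
    t • (D.Ti i * D.th i) = D.th (i + 1) * D.T i := by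
  rw [D.th_succ i h, smul_mul_assoc, mul_assoc _ _ (D.T i), D.Ti_T, mul_one]

/-- Each step moves θ past one inverse by t θ_i T_i⁻¹ = T_i θ_{i+1}. In particular π also equals T_0
⋯ T_{n-2} θ_{n-1}, with no inverses. -/
theorem th_mul_Q {m : ℕ} (hm : m < n) : t ^ m • (D.th 0 * D.Q m) = D.P m * D.th m := by
  induction m with
  | zero => simp [P, Q]
  | succ m ih =>
    rw [Q, P, ← mul_assoc, pow_succ', mul_smul, ← smul_mul_assoc, ih (by omega), mul_assoc,
      mul_assoc, ← mul_smul_comm, D.th_mul_Ti hm]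

theorem pi_eq (hn : 0 < n) : D.pi = D.P (n - 1) * D.th (n - 1) :=
  D.th_mul_Q (Nat.sub_lt hn Nat.one_pos)

theorem pi_mul_P {m : ℕ} (hm : m + 1 < n) : D.pi * D.P m = D.P' m * D.pi := by
  induction m with
  | zero => simp [P, P']
  | succ m ih =>
    rw [P, P', ← mul_assoc, ih (by omega), mul_assoc, D.pi_mul_T hm, mul_assoc]

theorem P_mul_A {m : ℕ} (hm : m + 1 < n) : D.P m * D.A = D.A * D.P' m := by
  induction m with
  | zero => simp [P, P']
  | succ m ih =>
    rw [P, P', mul_assoc, ← D.A_T m hm, ← mul_assoc, ih (by omega), mul_assoc]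

/-! ### Commutation of the last two X's. -/

section TwoOrMore

variable {k : ℕ} (D : HeckeData (k + 2) R)

theorem pi_mul_T_last : D.pi * D.T k = t • (D.P k * D.th k) := by
  rw [← D.th_mul_Q (by omega), pi, show k + 2 - 1 = k + 1 by omega, Q, smul_mul_assoc,
    ← mul_assoc, mul_assoc _ _ (D.T k), D.Ti_T, mul_one, ← mul_smul, pow_succ']

theorem pi_eq' : D.pi = D.T 0 * (D.P' k * D.th (k + 1)) := by
  rw [D.pi_eq (by omega), ← mul_assoc, D.T_mul_P']; rfl

/-- One factor π is written as T_0 P'_k θ_{k+1} and π T_k as t P_k θ_k. Now θ_{k+1} commutes with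
P_k and θ_k, so it can be moved to the far right, where it reassembles π after P'_k π = π P_k. -/
theorem pi_pi_T : D.pi * D.pi * D.T k = D.T 0 * (D.pi * D.pi) := by
  have hc : Commute (D.th (k + 1)) (D.P k) := D.commute_P fun i hi =>
    (D.T_th i (k + 1) (by omega) (by omega) (by omega) (by omega)).symm
  have hth : Commute (D.th (k + 1)) (D.th k) := D.th_comm _ _ (by omega) (by omega)
  calc D.pi * D.pi * D.T k
      = D.T 0 * (D.P' k * D.th (k + 1)) * (t • (D.P k * D.th k)) := by
        rw [mul_assoc, D.pi_mul_T_last]; congr 1; exact D.pi_eq'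
    _ = D.T 0 * D.P' k * (t • (D.P k * D.th k)) * D.th (k + 1) := by
        simp only [mul_smul_comm, smul_mul_assoc, mul_assoc]
        rw [← mul_assoc (D.th (k + 1)), hc.eq, mul_assoc, hth.eq]
    _ = D.T 0 * (D.P' k * D.pi * D.T k * D.th (k + 1)) := by
        rw [← D.pi_mul_T_last]; simp only [mul_assoc]
    _ = D.T 0 * (D.pi * D.pi) := by
        have e : D.pi * D.pi = D.pi * (D.P k * D.T k * D.th (k + 1)) :=
          congrArg (D.pi * ·) (D.pi_eq (by omega))
        rw [← D.pi_mul_P (by omega), e]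
        simp only [mul_assoc]

theorem pi_mul_X_last_pred : D.pi * D.X k = D.X (k + 1) * D.pi := by
  have h1 := D.X_last
  simp only [show k + 2 - 1 = k + 1 by omega] at h1
  rw [D.X_eq (by omega), h1]
  have h2 : D.pi * D.T k * D.A = t • (D.A * (D.P' k * D.th (k + 1))) := by
    rw [D.pi_mul_T_last, smul_mul_assoc, mul_assoc, ← D.A_th k (by omega), ← mul_assoc,
      D.P_mul_A (by omega), mul_assoc]
  have h3 : D.P' k * D.th (k + 1) = D.Ti 0 * D.pi := by
    rw [D.pi_eq', ← mul_assoc (D.Ti 0), D.Ti_T, one_mul]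
  calc D.pi * (t⁻¹ • (D.T k * (D.A * D.pi) * D.T k))
      = t⁻¹ • (D.pi * D.T k * D.A * (D.pi * D.T k)) := by
        simp only [mul_smul_comm, mul_assoc]
    _ = t⁻¹ • t • (D.A * D.Ti 0 * (D.pi * D.pi * D.T k)) := by
        rw [h2, h3, smul_mul_assoc]; simp only [mul_assoc]
    _ = D.A * D.pi * D.pi := by
        rw [inv_smul_smul₀ t_ne_zero, D.pi_pi_T, mul_assoc, ← mul_assoc (D.Ti 0), D.Ti_T, one_mul,
          mul_assoc]

theorem X_mul_X_pred : D.X (k + 1) * D.X k = D.A * D.A * (D.pi * D.pi) := by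
  have h1 := D.X_last
  simp only [show k + 2 - 1 = k + 1 by omega] at h1
  rw [h1, mul_assoc, D.pi_mul_X_last_pred, h1]
  simp only [mul_assoc]

/-- The product X_{k+1} X_k = A² π² commutes with T_k, because A² and π² intertwine T_k and T_0 in
opposite directions. The product in the other order is its conjugate by T_k. -/
theorem commute_X_pred : Commute (D.X (k + 1)) (D.X k) := by
  have hP : Commute (D.T k) (D.X (k + 1) * D.X k) := by
    rw [X_mul_X_pred, Commute, SemiconjBy, mul_assoc (D.A * D.A), D.pi_pi_T]
    simp only [← mul_assoc]
    rw [D.A_A_T k rfl]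
  have hx := D.X_eq (i := k) (by omega)
  have h2 : D.X (k + 1) * D.X k * D.Ti k = t⁻¹ • (D.X (k + 1) * D.T k * D.X (k + 1)) := by
    rw [hx]
    simp only [mul_smul_comm, smul_mul_assoc, mul_assoc, D.T_Ti, mul_one]
  have h3 : D.X k * D.X (k + 1) = D.T k * (D.X (k + 1) * D.X k * D.Ti k) := by
    rw [h2, hx]
    simp only [mul_smul_comm, smul_mul_assoc, mul_assoc]
  unfold Commute SemiconjBy
  rw [h3, ← mul_assoc, hP.eq, mul_assoc, D.T_Ti, mul_one]

end TwoOrMore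

theorem commute_T_X_last {i : ℕ} (h : i + 1 + 1 < n) : Commute (D.T i) (D.X (n - 1)) := by
  rw [X_last, Commute, SemiconjBy, ← mul_assoc, ← D.A_T i h, mul_assoc, ← D.pi_mul_T h, mul_assoc]

theorem X_succ {i : ℕ} (h : i + 1 < n) : D.X (i + 1) = t • (D.Ti i * D.X i * D.Ti i) := by
  rw [D.X_eq h]
  simp only [mul_smul_comm, smul_mul_assoc, mul_assoc, D.T_Ti, mul_one]
  rw [smul_inv_smul₀ t_ne_zero, ← mul_assoc, D.Ti_T, one_mul]

/-- Downward induction on `j` from the last variable, since each X_j is built from X_{j+1} and T_j.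
-/
theorem commute_T_X_of_lt {i j : ℕ} (hij : i + 1 < j) (hj : j < n) :
    Commute (D.T i) (D.X j) := by
  obtain ⟨m, hm⟩ : ∃ m, j + m = n - 1 := ⟨n - 1 - j, by omega⟩
  induction m generalizing j with
  | zero =>
    obtain rfl : j = n - 1 := by omega
    exact D.commute_T_X_last (by omega)
  | succ m ih =>
    rw [D.X_eq (by omega)]
    have h1 := D.far i j hij (by omega)
    exact (((h1.mul_right (ih (by omega) (by omega) (by omega))).mul_right h1).smul_right _)

/-- The essential case is i = j + 1. There X_j is expressed through X_{j+2}, which commutes with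
T_j, and the braid relation is applied once on each side of X_{j+2}. -/
theorem commute_T_X_of_gt {i j : ℕ} (hij : j < i) (hi : i + 1 < n) :
    Commute (D.T i) (D.X j) := by
  obtain ⟨m, hm⟩ : ∃ m, j + 1 + m = i := ⟨i - (j + 1), by omega⟩
  induction m generalizing j with
  | zero =>
    obtain rfl : i = j + 1 := by omega
    have hb := D.braid j hi
    have hc := D.commute_T_X_of_lt (i := j) (j := j + 2) (by omega) (by omega)
    rw [D.X_eq (i := j) (by omega), D.X_eq (i := j + 1) hi]
    simp only [mul_smul_comm, smul_mul_assoc]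
    refine Commute.smul_right (Commute.smul_right ?_ _) _
    unfold Commute SemiconjBy
    calc D.T (j + 1) * (D.T j * (D.T (j + 1) * D.X (j + 1 + 1) * D.T (j + 1)) * D.T j)
        = (D.T (j + 1) * D.T j * D.T (j + 1)) * D.X (j + 2) * D.T (j + 1) * D.T j := by
          simp only [mul_assoc]
      _ = D.T j * D.T (j + 1) * (D.T j * D.X (j + 2)) * D.T (j + 1) * D.T j := by
          rw [← hb]; simp only [mul_assoc]
      _ = D.T j * D.T (j + 1) * D.X (j + 2) * (D.T j * D.T (j + 1) * D.T j) := by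
          rw [hc.eq]; simp only [mul_assoc]
      _ = _ := by rw [hb]; simp only [mul_assoc]
  | succ m ih =>
    rw [D.X_eq (by omega)]
    have h1 := (D.far j i (by omega) hi).symm
    exact (((h1.mul_right (ih (by omega) (by omega))).mul_right h1).smul_right _)

theorem commute_X_last {j : ℕ} (hj : j < n) : Commute (D.X j) (D.X (n - 1)) := by
  obtain ⟨m, hm⟩ : ∃ m, j + m = n - 1 := ⟨n - 1 - j, by omega⟩
  induction m generalizing j with
  | zero =>
    obtain rfl : j = n - 1 := by omega
    exact Commute.refl _
  | succ m ih =>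
    cases m with
    | zero =>
      obtain rfl : n = j + 2 := by omega
      exact D.commute_X_pred.symm
    | succ m =>
      rw [D.X_eq (by omega)]
      have h1 := D.commute_T_X_last (i := j) (by omega)
      exact (((h1.mul_left (ih (by omega) (by omega))).mul_left h1).smul_left _)

theorem commute_X {i j : ℕ} (hi : i < n) (hj : j < n) : Commute (D.X i) (D.X j) := by
  wlog hij : i ≤ j generalizing i j
  · exact (this hj hi (by omega)).symm
  obtain ⟨m, hm⟩ : ∃ m, j + m = n - 1 := ⟨n - 1 - j, by omega⟩
  induction m generalizing j with
  | zero =>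
    obtain rfl : j = n - 1 := by omega
    exact D.commute_X_last hi
  | succ m ih =>
    rcases hij.eq_or_lt with rfl | hij
    · exact Commute.refl _
    rw [D.X_eq (i := j) (by omega)]
    have h1 := (D.commute_T_X_of_gt hij (by omega)).symm
    exact (((h1.mul_right (ih (by omega) (by omega) (by omega))).mul_right h1).smul_right _)

/-- Downward induction from the pair of the two last variables; π shifts each T_i to T_{i+1} along
the way. -/
theorem pi_mul_X {i : ℕ} (h : i + 1 < n) : D.pi * D.X i = D.X (i + 1) * D.pi := by
  obtain ⟨m, hm⟩ : ∃ m, i + 2 + m = n := ⟨n - (i + 2), by omega⟩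
  induction m generalizing i with
  | zero =>
    subst hm
    exact D.pi_mul_X_last_pred
  | succ m ih =>
    have e := D.X_eq (i := i + 1) (by omega)
    rw [D.X_eq h, mul_smul_comm, ← mul_assoc, ← mul_assoc, D.pi_mul_T (by omega),
      mul_assoc _ D.pi, ih (by omega) (by omega), mul_assoc _ _ (D.T i), mul_assoc _ _ (D.T i),
      D.pi_mul_T (by omega), e, smul_mul_assoc]
    simp only [mul_assoc]

theorem X_mul_Ti {i : ℕ} (h : i + 1 < n) : D.X i * D.Ti i = t⁻¹ • (D.T i * D.X (i + 1)) := by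
  rw [D.X_eq h, smul_mul_assoc, mul_assoc _ (D.T i), D.T_Ti, mul_one]

theorem X_zero_mul_Q {m : ℕ} (hm : m < n) : t ^ m • (D.X 0 * D.Q m) = D.P m * D.X m := by
  induction m with
  | zero => simp [P, Q]
  | succ m ih =>
    rw [Q, P, ← mul_assoc, pow_succ', mul_smul, ← smul_mul_assoc, ih (by omega), mul_assoc,
      D.X_mul_Ti hm, mul_smul_comm, smul_inv_smul₀ t_ne_zero, mul_assoc]

theorem X_th_swap (hn : 0 < n) : D.pi * D.A = q • (D.P (n - 1) * (D.A * D.th 0)) := by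
  rw [D.pi_eq hn, mul_assoc, D.A_th_zero hn, mul_smul_comm]

/-- The product `T_(m-1) ⋯ T_0`. -/
def Pr : ℕ → R
  | 0 => 1
  | m + 1 => D.T m * Pr m

theorem Q_mul_Pr (m : ℕ) : D.Q m * D.Pr m = 1 := by
  induction m with
  | zero => simp [Q, Pr]
  | succ m ih => rw [Q, Pr, mul_assoc, ← mul_assoc (D.Ti m), D.Ti_T, one_mul, ih]

/-- The factor q comes from θ_{n-1} A = q A θ_0, through the expression of π ending in θ_{n-1}. The
other side uses X_0 as the twofold T-translate of X_{n-1}, whose right-hand product of T's cancels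
the inverses in π. -/
theorem pi_mul_X_last (hn : 0 < n) : D.pi * D.X (n - 1) = q • (D.X 0 * D.pi) := by
  have h1 : D.X 0 = (t ^ (n - 1))⁻¹ • (D.P (n - 1) * D.X (n - 1) * D.Pr (n - 1)) := by
    rw [← D.X_zero_mul_Q (Nat.sub_lt hn Nat.one_pos), smul_mul_assoc,
      inv_smul_smul₀ (pow_ne_zero _ t_ne_zero), mul_assoc, D.Q_mul_Pr, mul_one]
  have h2 : D.pi * D.Pr (n - 1) = t ^ (n - 1) • D.th 0 := by
    rw [pi, smul_mul_assoc, mul_assoc, D.Q_mul_Pr, mul_one]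
  rw [h1, X_last, ← mul_assoc, D.X_th_swap hn, smul_mul_assoc, smul_mul_assoc]
  simp only [mul_assoc]
  rw [← mul_assoc D.pi (D.Pr _), h2]
  simp only [mul_smul_comm, smul_mul_assoc]
  rw [inv_smul_smul₀ (pow_ne_zero _ t_ne_zero)]

/-- The images of the generators. -/
noncomputable def gen : DGen n → R
  | DGen.T i _ => D.T i
  | DGen.theta i _ => D.th i
  | DGen.X i _ => D.X i

@[simp] theorem lift_fT (i : ℕ) (h : i + 1 < n) : FreeAlgebra.lift Kqt D.gen (fT i h) = D.T i :=
  FreeAlgebra.lift_ι_apply _ _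

@[simp] theorem lift_fTheta (i : ℕ) (h : i < n) :
    FreeAlgebra.lift Kqt D.gen (fTheta i h) = D.th i :=
  FreeAlgebra.lift_ι_apply _ _

@[simp] theorem lift_fX (i : ℕ) (h : i < n) : FreeAlgebra.lift Kqt D.gen (fX i h) = D.X i :=
  FreeAlgebra.lift_ι_apply _ _

@[simp] theorem lift_fTinv (i : ℕ) (h : i + 1 < n) :
    FreeAlgebra.lift Kqt D.gen (fTinv i h) = D.Ti i := by
  rw [fTinv, map_smul, map_add, lift_fT, AlgHom.commutes, D.Ti_eq i h]

theorem prod_ofFn_Ti (m : ℕ) : (List.ofFn fun i : Fin m => D.Ti i).prod = D.Q m := by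
  induction m with
  | zero => simp [Q]
  | succ m ih =>
    rw [List.ofFn_succ', List.concat_eq_append, List.prod_append, List.prod_singleton]
    simp only [Fin.val_castSucc, Fin.val_last, ih, Q]

@[simp] theorem lift_fPi (h : 0 < n) : FreeAlgebra.lift Kqt D.gen (fPi h) = D.pi := by
  rw [fPi, map_smul, map_mul, lift_fTheta, map_list_prod, List.map_ofFn, pi, ← D.prod_ofFn_Ti]
  congr 4
  funext i
  exact D.lift_fTinv _ _

theorem lift_rel {x y : FreeAlgebra Kqt (DGen n)} (h : DRel n x y) :
    FreeAlgebra.lift Kqt D.gen x = FreeAlgebra.lift Kqt D.gen y := by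
  induction h with
  | quad i h =>
    have h1 := D.T_Ti i
    rw [D.Ti_eq i h, mul_smul_comm] at h1
    have h2 : D.T i * (D.T i + algebraMap Kqt R (t - 1)) = algebraMap Kqt R t := by
      rw [← smul_inv_smul₀ t_ne_zero (D.T i * (D.T i + algebraMap Kqt R (t - 1))), h1,
        Algebra.algebraMap_eq_smul_one]
    simp only [map_mul, map_sub, map_add, map_one, lift_fT, AlgHom.commutes, map_zero] at h2 ⊢
    rw [← sub_eq_zero] at h2
    rw [← h2]
    noncomm_ring
  | braid i h => simp only [map_mul, lift_fT, D.braid i h]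
  | far i j hi hj hij => simp only [map_mul, lift_fT, (D.far i j hij hj).eq]
  | theta_comm i j hi hj => simp only [map_mul, lift_fTheta, (D.th_comm i j hi hj).eq]
  | theta_succ i h =>
    simp only [map_smul, map_mul, lift_fTheta, lift_fTinv]
    exact D.th_succ i h
  | T_theta i j hi hj h1 h2 =>
    simp only [map_mul, lift_fT, lift_fTheta, (D.T_th i j hi hj h1 h2).eq]
  | X_comm i j hi hj => simp only [map_mul, lift_fX, (D.commute_X hi hj).eq]
  | X_succ i h =>
    simp only [map_smul, map_mul, lift_fX, lift_fTinv]
    exact D.X_succ h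
  | T_X i j hi hj h1 h2 =>
    simp only [map_mul, lift_fT, lift_fX]
    rcases lt_or_gt_of_ne h1 with h | h
    · exact (D.commute_T_X_of_gt h hi).eq
    · exact (D.commute_T_X_of_lt (by omega) hj).eq
  | pi_X i h => simp only [map_mul, lift_fX, lift_fPi, D.pi_mul_X h]
  | pi_X_last h => simp only [map_mul, map_smul, lift_fX, lift_fPi, D.pi_mul_X_last h]

/-- The algebra homomorphism from the double affine Hecke algebra. -/
noncomputable def hom : Daha n →ₐ[Kqt] R :=
  RingQuot.liftAlgHom Kqt ⟨FreeAlgebra.lift Kqt D.gen, fun _ _ h => D.lift_rel h⟩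

theorem hom_dMk (x : FreeAlgebra Kqt (DGen n)) :
    D.hom (dMk n x) = FreeAlgebra.lift Kqt D.gen x :=
  RingQuot.liftAlgHom_mkAlgHom_apply Kqt _ _ x

@[simp] theorem hom_gT (i : ℕ) (h : i + 1 < n) : D.hom (gT i h) = D.T i := by
  rw [gT, hom_dMk, lift_fT]

@[simp] theorem hom_gTinv (i : ℕ) (h : i + 1 < n) : D.hom (gTinv i h) = D.Ti i := by
  rw [gTinv, hom_dMk, lift_fTinv]

@[simp] theorem hom_gTheta (i : ℕ) (h : i < n) : D.hom (gTheta i h) = D.th i := by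
  rw [gTheta, hom_dMk, lift_fTheta]

@[simp] theorem hom_gX (i : ℕ) (h : i < n) : D.hom (gX i h) = D.X i := by
  rw [gX, hom_dMk, lift_fX]

@[simp] theorem hom_gPi (h : 0 < n) : D.hom (gPi h) = D.pi := by
  rw [gPi, hom_dMk, lift_fPi]

end HeckeData

end VVMac

namespace VVMac

open PSYT

/-! ### The module with basis the periodic tableaux -/

/-- The space with basis the periodic standard Young tableaux. -/
abbrev Mod (n : ℕ) (mu : YoungDiagram) : Type := PSYT n mu →₀ Kqt

/-- The squared intertwiner acts by this function of the two weights. -/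
noncomputable def cC (x y : Kqt) : Kqt := (t * x - y) * (x - t * y) / (x - y) ^ 2

/-- The diagonal coefficient of `T_i`. -/
noncomputable def gC (x y : Kqt) : Kqt := (t - 1) * x / (y - x)

open Classical in
/-- The coefficient of `s_i(τ)` in `T_i τ`, where `a`, `b` are the boxes of the labels `i`, `i+1`. -/
noncomputable def bC {mu : YoungDiagram} (T : Box mu → ℕ) (a b : Box mu) : Kqt :=
  if Rigid T a b then 0 else if Up T a b then 1 else cC (boxWeight T a) (boxWeight T b)

theorem bC_of_rigid {mu : YoungDiagram} {T : Box mu → ℕ} {a b : Box mu} (h : Rigid T a b) :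
    bC T a b = 0 := if_pos h

theorem bC_of_up {mu : YoungDiagram} {T : Box mu → ℕ} {a b : Box mu} (h : ¬ Rigid T a b)
    (hu : Up T a b) : bC T a b = 1 := by
  rw [bC, if_neg h, if_pos hu]

theorem bC_of_down {mu : YoungDiagram} {T : Box mu → ℕ} {a b : Box mu} (h : ¬ Rigid T a b)
    (hu : Up T b a) : bC T a b = cC (boxWeight T a) (boxWeight T b) := by
  rw [bC, if_neg h, if_neg (not_up_symm hu)]

theorem cC_symm (x y : Kqt) : cC x y = cC y x := by
  unfold cC
  rw [show (x - y) ^ 2 = (y - x) ^ 2 by ring]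
  congr 1; ring

theorem cC_mul {s : Kqt} (hs : s ≠ 0) (x y : Kqt) : cC (s * x) (s * y) = cC x y := by
  unfold cC
  rw [show (s * x - s * y) ^ 2 = s ^ 2 * (x - y) ^ 2 by ring,
    show (t * (s * x) - s * y) * (s * x - t * (s * y)) =
      s ^ 2 * ((t * x - y) * (x - t * y)) by ring, mul_div_mul_left _ _ (pow_ne_zero 2 hs)]

theorem gC_mul {s : Kqt} (hs : s ≠ 0) (x y : Kqt) : gC (s * x) (s * y) = gC x y := by
  unfold gC
  rw [← mul_sub, mul_left_comm, mul_div_mul_left _ _ hs]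

open Classical in
theorem bC_add {mu : YoungDiagram} {T T' : Box mu → ℕ} {a b : Box mu} (d : ℕ)
    (ha : T' a = T a + d) (hb : T' b = T b + d) : bC T' a b = bC T a b := by
  have h1 : Rigid T' a b ↔ Rigid T a b := by unfold Rigid; rw [ha, hb]; omega
  have h2 : Up T' a b ↔ Up T a b := by unfold Up; rw [ha, hb]; omega
  have h3 : ∀ x : Box mu, T' x = T x + d → boxWeight T' x = q ^ d * boxWeight T x := by
    intro x hx; unfold boxWeight; rw [hx, pow_add]; ring
  unfold bC
  rw [h3 a ha, h3 b hb, cC_mul (pow_ne_zero d q_ne_zero), if_congr h1 rfl (if_congr h2 rfl rfl)]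

/-! ### Scalar identities behind the quadratic, θ and braid relations. -/

section Coefficients

variable {F M : Type*} [Field F] [AddCommGroup M] [Module F M] {t x y z : F}

theorem quadratic_coeff (hxy : x - y ≠ 0) (hyx : y - x ≠ 0) (E R : M) :
    ((t - 1) * x / (y - x)) • (((t - 1) * x / (y - x)) • E + R) +
      (((t - 1) * y / (x - y)) • R + ((t * x - y) * (x - t * y) / (x - y) ^ 2) • E) =
    (1 - t) • (((t - 1) * x / (y - x)) • E + R) + t • E := by
  match_scalars
  · field_simp; ring
  · field_simp; ring

theorem theta_coeff (hxy : x - y ≠ 0) (hyx : y - x ≠ 0) (E R : M) :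
    ((t - 1) * x / (y - x)) • y • (((t - 1) * x / (y - x)) • E + R) +
      x • (((t - 1) * y / (x - y)) • R + ((t * x - y) * (x - t * y) / (x - y) ^ 2) • E) =
    t • x • E := by
  match_scalars
  · field_simp; ring
  · field_simp; ring

/-- The braid relation follows from the braid relation of the intertwiners `R1`, `R2`. -/
theorem braid_of_intertwiners {T1 T2 R1 R2 : M →ₗ[F] M} {E : M} {g c : F → F → F}
    (hg : ∀ x y, g x y = (t - 1) * x / (y - x))
    (hc : ∀ x y, c x y = (t * x - y) * (x - t * y) / (x - y) ^ 2)
    (hxy : x - y ≠ 0) (hyz : y - z ≠ 0) (hxz : x - z ≠ 0)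
    (e1 : T1 E = g x y • E + R1 E) (e2 : T2 E = g y z • E + R2 E)
    (s1 : T1 (R1 E) = g y x • R1 E + c x y • E) (s2 : T2 (R2 E) = g z y • R2 E + c y z • E)
    (a1 : T2 (R1 E) = g x z • R1 E + R2 (R1 E)) (a2 : T1 (R2 E) = g x z • R2 E + R1 (R2 E))
    (a3 : T1 (R2 (R1 E)) = g y z • R2 (R1 E) + R1 (R2 (R1 E)))
    (a4 : T2 (R1 (R2 E)) = g x y • R1 (R2 E) + R2 (R1 (R2 E)))
    (hR : R1 (R2 (R1 E)) = R2 (R1 (R2 E))) : T1 (T2 (T1 E)) = T2 (T1 (T2 E)) := by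
  have hyx : y - x ≠ 0 := by rwa [← neg_sub, neg_ne_zero]
  have hzy : z - y ≠ 0 := by rwa [← neg_sub, neg_ne_zero]
  have hzx : z - x ≠ 0 := by rwa [← neg_sub, neg_ne_zero]
  simp only [e1, e2, map_add, map_smul, a1, a2, s1, s2, a3, a4, hR, hg, hc]
  match_scalars
  · field_simp; ring
  · field_simp; ring
  · field_simp; ring
  · ring
  · ring
  · ring

end Coefficients

/-! ### The operators on periodic tableaux and their relations. -/

section Operators

variable {n : ℕ} {mu : YoungDiagram}

/-- The basis vector of a tableau. -/
noncomputable def eb (τ : PSYT n mu) : Mod n mu := Finsupp.single τ 1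

theorem end_ext {f g : Module.End Kqt (Mod n mu)} (h : ∀ τ, f (eb τ) = g (eb τ)) : f = g :=
  Finsupp.lhom_ext' fun τ => LinearMap.ext_ring (h τ)

/-- The weights of a tableau. -/
noncomputable def xw (τ : PSYT n mu) (j : ℕ) : Kqt :=
  if h : j < n then boxWeight τ.wt (τ.idx.symm ⟨j, h⟩) else 0

theorem xw_lo (τ : PSYT n mu) (i : ℕ) (h : i + 1 < n) : xw τ i = boxWeight τ.wt (τ.lo i h) :=
  dif_pos _

theorem xw_hi (τ : PSYT n mu) (i : ℕ) (h : i + 1 < n) :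
    xw τ (i + 1) = boxWeight τ.wt (τ.hi i h) :=
  dif_pos _

theorem xw_ne_zero (τ : PSYT n mu) {i : ℕ} (h : i < n) : xw τ i ≠ 0 := by
  rw [xw, dif_pos h]; exact boxWeight_ne_zero _ _

theorem xw_ne_succ (τ : PSYT n mu) {i : ℕ} (h : i + 1 < n) : xw τ i ≠ xw τ (i + 1) := by
  rw [xw_lo τ i h, xw_hi τ i h]; exact τ.boxWeight_ne (τ.idx_hi_lo i h)

theorem xw_ne_add_two (τ : PSYT n mu) {i : ℕ} (h : i + 1 + 1 < n) :
    xw τ i ≠ xw τ (i + 1 + 1) := by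
  rw [xw_lo τ i (by omega), xw_hi τ (i + 1) h]
  exact τ.boxWeight_ne_of_add_two (by rw [idx_hi, idx_lo])

theorem xw_sw (τ : PSYT n mu) {i : ℕ} {h : i + 1 < n}
    (hr : ¬ Rigid τ.wt (τ.lo i h) (τ.hi i h)) (j : ℕ) :
    xw (τ.sw i h) j = xw τ (Equiv.swap i (i + 1) j) := by
  unfold xw
  by_cases hj : j < n
  · have hj' : Equiv.swap i (i + 1) j < n := by
      rw [Equiv.swap_apply_def]; split_ifs <;> omega
    rw [dif_pos hj, dif_pos hj', sw_wt, sw_idx_symm τ hr]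
    congr 2
    apply Fin.ext
    rw [swap_val]
    exact (Equiv.swap_apply_def i (i + 1) j).symm
  · have hj' : ¬ Equiv.swap i (i + 1) j < n := by
      rw [Equiv.swap_apply_of_ne_of_ne] <;> omega
    rw [dif_neg hj, dif_neg hj']

/-- The operator multiplying each tableau by a function of its weights. -/
noncomputable def diag (f : (ℕ → Kqt) → Kqt) : Module.End Kqt (Mod n mu) :=
  Finsupp.linearCombination Kqt fun τ => f (xw τ) • eb τ

@[simp] theorem diag_eb (f : (ℕ → Kqt) → Kqt) (τ : PSYT n mu) :
    diag f (eb τ) = f (xw τ) • eb τ := by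
  simp [diag, eb]

/-- The intertwiners. -/
noncomputable def opR (i : ℕ) : Module.End Kqt (Mod n mu) :=
  if h : i + 1 < n then
    Finsupp.linearCombination Kqt fun τ => bC τ.wt (τ.lo i h) (τ.hi i h) • eb (τ.sw i h)
  else 0

theorem opR_eb (i : ℕ) (h : i + 1 < n) (τ : PSYT n mu) :
    opR i (eb τ) = bC τ.wt (τ.lo i h) (τ.hi i h) • eb (τ.sw i h) := by
  simp [opR, eb, h]

theorem opR_eb_of_rigid {i : ℕ} {h : i + 1 < n} {τ : PSYT n mu}
    (hr : Rigid τ.wt (τ.lo i h) (τ.hi i h)) : opR i (eb τ) = 0 := by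
  rw [opR_eb i h, bC_of_rigid hr, zero_smul]

/-- Exchanging two labels exchanges their weights; for a rigid pair both sides vanish. -/
theorem diag_opR (f : (ℕ → Kqt) → Kqt) {i : ℕ} (h : i + 1 < n) (v : Mod n mu) :
    diag f (opR i v) = opR i (diag (fun x => f fun j => x (Equiv.swap i (i + 1) j)) v) := by
  rw [← Module.End.mul_apply, ← Module.End.mul_apply]
  congr 1
  apply end_ext
  intro τ
  rw [Module.End.mul_apply, Module.End.mul_apply, diag_eb, map_smul]
  by_cases hr : Rigid τ.wt (τ.lo i h) (τ.hi i h)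
  · rw [opR_eb_of_rigid hr, map_zero, smul_zero]
  · rw [opR_eb i h, map_smul, diag_eb, smul_comm]
    congr 2
    exact funext fun j => xw_sw τ hr j

/-- For a rigid pair the two weights differ by a factor t, so `cC` vanishes. Otherwise exactly one
of τ and s_i(τ) admits the step upwards, and the two coefficients are 1 and `cC`. -/
theorem opR_opR {i : ℕ} (h : i + 1 < n) (τ : PSYT n mu) :
    opR i (opR i (eb τ)) = cC (xw τ i) (xw τ (i + 1)) • eb τ := by
  rw [xw_lo τ i h, xw_hi τ i h]
  by_cases hr : Rigid τ.wt (τ.lo i h) (τ.hi i h)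
  · rw [opR_eb_of_rigid hr, map_zero]
    have h0 : cC (boxWeight τ.wt (τ.lo i h)) (boxWeight τ.wt (τ.hi i h)) = 0 := by
      rcases hr.content_eq τ (τ.idx_hi_lo i h) with hc | hc
      · rw [boxWeight_of_content_eq hr.1.symm hc.2, cC, sub_self, zero_mul, zero_div]
      · rw [boxWeight_of_content_eq hr.1 hc.2, cC, sub_self, mul_zero, zero_div]
    rw [h0, zero_smul]
  · rw [opR_eb i h, map_smul, opR_eb i h, sw_sw, sw_lo τ hr, sw_hi τ hr, sw_wt, ← mul_smul]
    congr 1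
    have hr' : ¬ Rigid τ.wt (τ.hi i h) (τ.lo i h) := fun h' => hr h'.symm
    rcases τ.up_or_up (τ.idx_hi_lo i h) hr with hu | hu
    · rw [bC_of_up hr hu, bC_of_down hr' hu, one_mul, cC_symm]
    · rw [bC_of_up hr' hu, bC_of_down hr hu, mul_one]

theorem sw_braid {i : ℕ} {h : i + 1 < n} {h' : i + 1 + 1 < n} (τ : PSYT n mu)
    (h1 : ¬ Rigid τ.wt (τ.lo i h) (τ.hi i h))
    (h2 : ¬ Rigid (τ.sw i h).wt ((τ.sw i h).lo (i + 1) h') ((τ.sw i h).hi (i + 1) h'))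
    (h3 : ¬ Rigid ((τ.sw i h).sw (i + 1) h').wt (((τ.sw i h).sw (i + 1) h').lo i h)
      (((τ.sw i h).sw (i + 1) h').hi i h))
    (k1 : ¬ Rigid τ.wt (τ.lo (i + 1) h') (τ.hi (i + 1) h'))
    (k2 : ¬ Rigid (τ.sw (i + 1) h').wt ((τ.sw (i + 1) h').lo i h) ((τ.sw (i + 1) h').hi i h))
    (k3 : ¬ Rigid ((τ.sw (i + 1) h').sw i h).wt (((τ.sw (i + 1) h').sw i h).lo (i + 1) h')
      (((τ.sw (i + 1) h').sw i h).hi (i + 1) h')) :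
    ((τ.sw i h).sw (i + 1) h').sw i h = ((τ.sw (i + 1) h').sw i h).sw (i + 1) h' := by
  apply ext_idx (by simp only [sw_wt])
  intro b
  rw [sw_idx _ h3, sw_idx _ h2, sw_idx _ h1, sw_idx _ k3, sw_idx _ k2, sw_idx _ k1]
  simp only [Equiv.trans_apply]
  generalize τ.idx b = j
  have o1 : i + 1 + 1 ≠ i := by omega
  have o2 : i ≠ i + 1 + 1 := by omega
  simp only [swap_val]
  by_cases j1 : (j : ℕ) = i
  · simp [j1, o1, o2]
  by_cases j2 : (j : ℕ) = i + 1
  · simp [j2, o1, o2]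
  by_cases j3 : (j : ℕ) = i + 1 + 1
  · simp [j3, o1, o2]
  simp [j1, j2, j3]

open Classical in
-- Each of the three pairs among the boxes `a`, `b`, `c` of the labels i, i+1, i+2 is exchanged
-- exactly once on either side. Both sides therefore carry the same product of three coefficients,
-- and both vanish as soon as one pair is rigid.
theorem opR_braid {i : ℕ} (h' : i + 1 + 1 < n) (τ : PSYT n mu) :
    opR i (opR (i + 1) (opR i (eb τ))) = opR (i + 1) (opR i (opR (i + 1) (eb τ))) := by
  have h : i + 1 < n := by omega
  set a := τ.lo i h with ha
  set b := τ.lo (i + 1) h' with hb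
  set c := τ.hi (i + 1) h' with hc
  have hab : τ.hi i h = b := rfl
  have e1 : ¬ Rigid τ.wt a b → (τ.sw i h).lo (i + 1) h' = a ∧ (τ.sw i h).hi (i + 1) h' = c :=
    fun hr => ⟨sw_hi τ hr, sw_idx_symm_of_ne τ hr _ (by simp; try omega) (by simp; try omega)⟩
  have e2 : ¬ Rigid τ.wt b c → (τ.sw (i + 1) h').lo i h = a ∧ (τ.sw (i + 1) h').hi i h = c :=
    fun hr => ⟨sw_idx_symm_of_ne τ hr _ (by simp; try omega) (by simp; try omega), sw_lo τ hr⟩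
  have f1 : ¬ Rigid τ.wt a b → ¬ Rigid τ.wt a c →
      ((τ.sw i h).sw (i + 1) h').lo i h = b ∧ ((τ.sw i h).sw (i + 1) h').hi i h = c := by
    intro hr hr'
    have hr2 : ¬ Rigid (τ.sw i h).wt ((τ.sw i h).lo (i + 1) h') ((τ.sw i h).hi (i + 1) h') := by
      rw [(e1 hr).1, (e1 hr).2, sw_wt]; exact hr'
    refine ⟨?_, ?_⟩
    · rw [lo, sw_idx_symm_of_ne _ hr2 _ (by simp; try omega) (by simp; try omega)]; exact sw_lo τ hr
    · exact (sw_lo _ hr2).trans (e1 hr).2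
  have f2 : ¬ Rigid τ.wt b c → ¬ Rigid τ.wt a c →
      ((τ.sw (i + 1) h').sw i h).lo (i + 1) h' = a ∧
        ((τ.sw (i + 1) h').sw i h).hi (i + 1) h' = b := by
    intro hr hr'
    have hr2 : ¬ Rigid (τ.sw (i + 1) h').wt ((τ.sw (i + 1) h').lo i h)
        ((τ.sw (i + 1) h').hi i h) := by
      rw [(e2 hr).1, (e2 hr).2, sw_wt]; exact hr'
    refine ⟨?_, ?_⟩
    · exact (sw_hi _ hr2).trans (e2 hr).1
    · rw [hi, sw_idx_symm_of_ne _ hr2 _ (by simp; try omega) (by simp; try omega)]; exact sw_hi τ hr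
  have L : opR i (opR (i + 1) (opR i (eb τ))) =
      if Rigid τ.wt a b ∨ Rigid τ.wt a c ∨ Rigid τ.wt b c then 0 else
        (bC τ.wt a b * bC τ.wt a c * bC τ.wt b c) • eb (((τ.sw i h).sw (i + 1) h').sw i h) := by
    rw [opR_eb i h, map_smul, opR_eb (i + 1) h', map_smul, map_smul, opR_eb i h, hab, ← ha]
    simp only [sw_wt]
    by_cases r1 : Rigid τ.wt a b
    · rw [bC_of_rigid r1, zero_smul, if_pos (Or.inl r1)]
    rw [(e1 r1).1, (e1 r1).2]
    by_cases r2 : Rigid τ.wt a c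
    · rw [bC_of_rigid r2, zero_smul, smul_zero, if_pos (Or.inr (Or.inl r2))]
    rw [(f1 r1 r2).1, (f1 r1 r2).2]
    by_cases r3 : Rigid τ.wt b c
    · rw [bC_of_rigid r3, zero_smul, smul_zero, smul_zero, if_pos (Or.inr (Or.inr r3))]
    rw [if_neg (by tauto), ← mul_smul, ← mul_smul, mul_assoc]
  have L' : opR (i + 1) (opR i (opR (i + 1) (eb τ))) =
      if Rigid τ.wt a b ∨ Rigid τ.wt a c ∨ Rigid τ.wt b c then 0 else
        (bC τ.wt a b * bC τ.wt a c * bC τ.wt b c) •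
          eb (((τ.sw (i + 1) h').sw i h).sw (i + 1) h') := by
    rw [opR_eb (i + 1) h', map_smul, opR_eb i h, map_smul, map_smul, opR_eb (i + 1) h', ← hb, ← hc]
    simp only [sw_wt]
    by_cases r3 : Rigid τ.wt b c
    · rw [bC_of_rigid r3, zero_smul, if_pos (Or.inr (Or.inr r3))]
    rw [(e2 r3).1, (e2 r3).2]
    by_cases r2 : Rigid τ.wt a c
    · rw [bC_of_rigid r2, zero_smul, smul_zero, if_pos (Or.inr (Or.inl r2))]
    rw [(f2 r3 r2).1, (f2 r3 r2).2]
    by_cases r1 : Rigid τ.wt a b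
    · rw [bC_of_rigid r1, zero_smul, smul_zero, smul_zero, if_pos (Or.inl r1)]
    rw [if_neg (by tauto), ← mul_smul, ← mul_smul]
    congr 1; ring
  rw [L, L']
  split_ifs with hr
  · rfl
  · simp only [not_or] at hr
    obtain ⟨r1, r2, r3⟩ := hr
    rw [sw_braid τ r1 (by rw [(e1 r1).1, (e1 r1).2, sw_wt]; exact r2)
      (by rw [(f1 r1 r2).1, (f1 r1 r2).2, sw_wt, sw_wt]; exact r3) r3
      (by rw [(e2 r3).1, (e2 r3).2, sw_wt]; exact r2)
      (by rw [(f2 r3 r2).1, (f2 r3 r2).2, sw_wt, sw_wt]; exact r1)]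

theorem opR_far {i j : ℕ} (hij : i + 1 < j) (hj : j + 1 < n) (τ : PSYT n mu) :
    opR i (opR j (eb τ)) = opR j (opR i (eb τ)) := by
  have hi : i + 1 < n := by omega
  have e1 : (τ.sw j hj).lo i hi = τ.lo i hi ∧ (τ.sw j hj).hi i hi = τ.hi i hi := by
    by_cases hr : Rigid τ.wt (τ.lo j hj) (τ.hi j hj)
    · rw [sw_of_rigid τ hr]; exact ⟨rfl, rfl⟩
    · exact ⟨sw_idx_symm_of_ne τ hr _ (by simp; omega) (by simp; omega),
        sw_idx_symm_of_ne τ hr _ (by simp; omega) (by simp; omega)⟩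
  have e2 : (τ.sw i hi).lo j hj = τ.lo j hj ∧ (τ.sw i hi).hi j hj = τ.hi j hj := by
    by_cases hr : Rigid τ.wt (τ.lo i hi) (τ.hi i hi)
    · rw [sw_of_rigid τ hr]; exact ⟨rfl, rfl⟩
    · exact ⟨sw_idx_symm_of_ne τ hr _ (by simp; omega) (by simp; omega),
        sw_idx_symm_of_ne τ hr _ (by simp; omega) (by simp; omega)⟩
  rw [opR_eb j hj, opR_eb i hi, map_smul, map_smul, opR_eb i hi, opR_eb j hj, e1.1, e1.2, e2.1,
    e2.2, sw_wt, sw_wt, smul_comm]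
  by_cases r1 : Rigid τ.wt (τ.lo i hi) (τ.hi i hi)
  · rw [bC_of_rigid r1, zero_smul, zero_smul]
  by_cases r2 : Rigid τ.wt (τ.lo j hj) (τ.hi j hj)
  · rw [bC_of_rigid r2, zero_smul, smul_zero, zero_smul, smul_zero]
  congr 3
  apply ext_idx (by simp only [sw_wt])
  intro b
  rw [sw_idx _ (by rw [e1.1, e1.2, sw_wt]; exact r1), sw_idx _ r2,
    sw_idx _ (by rw [e2.1, e2.2, sw_wt]; exact r2), sw_idx _ r1]
  simp only [Equiv.trans_apply, swap_val]
  split_ifs <;> omega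

/-- The operators `T_i`, extended by the identity. -/
noncomputable def opT (i : ℕ) : Module.End Kqt (Mod n mu) :=
  if i + 1 < n then diag (fun x => gC (x i) (x (i + 1))) + opR i else 1

/-- The inverses of the operators `T_i`. -/
noncomputable def opTi (i : ℕ) : Module.End Kqt (Mod n mu) :=
  if i + 1 < n then t⁻¹ • (opT i + algebraMap Kqt _ (t - 1)) else 1

/-- The operators `θ_i`. -/
noncomputable def opTh (i : ℕ) : Module.End Kqt (Mod n mu) := diag fun x => x i

/-- The raising operator `X_n π_n⁻¹`. -/
noncomputable def opA : Module.End Kqt (Mod n mu) :=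
  Finsupp.linearCombination Kqt fun τ =>
    (if h : 0 < n then (q ^ τ.w ⟨0, h⟩)⁻¹ else 1) • eb τ.psi

theorem opA_eb (h : 0 < n) (τ : PSYT n mu) : opA (eb τ) = (q ^ τ.w ⟨0, h⟩)⁻¹ • eb τ.psi := by
  simp [opA, eb, h]

@[simp] theorem opTh_eb (i : ℕ) (τ : PSYT n mu) : opTh i (eb τ) = xw τ i • eb τ := by
  rw [opTh, diag_eb]

theorem opT_apply {i : ℕ} (h : i + 1 < n) (v : Mod n mu) :
    opT i v = diag (fun x => gC (x i) (x (i + 1))) v + opR i v := by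
  rw [opT, if_pos h]; rfl

theorem opT_eb {i : ℕ} (h : i + 1 < n) (τ : PSYT n mu) :
    opT i (eb τ) = gC (xw τ i) (xw τ (i + 1)) • eb τ + opR i (eb τ) := by
  rw [opT_apply h, diag_eb]

theorem opT_opR_self {i : ℕ} (h : i + 1 < n) (τ : PSYT n mu) :
    opT i (opR i (eb τ)) = gC (xw τ (i + 1)) (xw τ i) • opR i (eb τ) +
      cC (xw τ i) (xw τ (i + 1)) • eb τ := by
  rw [opT_apply h, diag_opR _ h, diag_eb, map_smul, opR_opR h]
  simp

theorem opT_mul_self {i : ℕ} (h : i + 1 < n) (τ : PSYT n mu) :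
    opT i (opT i (eb τ)) = (1 - t) • opT i (eb τ) + t • eb τ := by
  have hxy := sub_ne_zero.2 (xw_ne_succ τ h)
  have hyx := sub_ne_zero.2 (xw_ne_succ τ h).symm
  rw [opT_eb h, map_add, map_smul, opT_eb h, opT_opR_self h]
  exact quadratic_coeff hxy hyx _ _

theorem opT_braid {i : ℕ} (h' : i + 1 + 1 < n) (τ : PSYT n mu) :
    opT i (opT (i + 1) (opT i (eb τ))) = opT (i + 1) (opT i (opT (i + 1) (eb τ))) := by
  have h : i + 1 < n := by omega
  have s1 : Equiv.swap i (i + 1) (i + 1 + 1) = i + 1 + 1 :=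
    Equiv.swap_apply_of_ne_of_ne (by omega) (by omega)
  have s2 : Equiv.swap (i + 1) (i + 1 + 1) i = i :=
    Equiv.swap_apply_of_ne_of_ne (by omega) (by omega)
  have a1 : opT (i + 1) (opR i (eb τ)) =
      gC (xw τ i) (xw τ (i + 1 + 1)) • opR i (eb τ) + opR (i + 1) (opR i (eb τ)) := by
    rw [opT_apply h', diag_opR _ h, diag_eb, map_smul]; simp [s1]
  have a2 : opT i (opR (i + 1) (eb τ)) =
      gC (xw τ i) (xw τ (i + 1 + 1)) • opR (i + 1) (eb τ) + opR i (opR (i + 1) (eb τ)) := by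
    rw [opT_apply h, diag_opR _ h', diag_eb, map_smul]; simp [s2]
  have a3 : opT i (opR (i + 1) (opR i (eb τ))) =
      gC (xw τ (i + 1)) (xw τ (i + 1 + 1)) • opR (i + 1) (opR i (eb τ)) +
        opR i (opR (i + 1) (opR i (eb τ))) := by
    rw [opT_apply h, diag_opR _ h', diag_opR _ h, diag_eb, map_smul, map_smul]; simp [s1, s2]
  have a4 : opT (i + 1) (opR i (opR (i + 1) (eb τ))) =
      gC (xw τ i) (xw τ (i + 1)) • opR i (opR (i + 1) (eb τ)) +
        opR (i + 1) (opR i (opR (i + 1) (eb τ))) := by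
    rw [opT_apply h', diag_opR _ h, diag_opR _ h', diag_eb, map_smul, map_smul]; simp [s1, s2]
  exact braid_of_intertwiners (fun _ _ => rfl) (fun _ _ => rfl) (sub_ne_zero.2 (xw_ne_succ τ h))
    (sub_ne_zero.2 (xw_ne_succ τ h')) (sub_ne_zero.2 (xw_ne_add_two τ h')) (opT_eb h τ)
    (opT_eb h' τ) (opT_opR_self h τ) (opT_opR_self h' τ) a1 a2 a3 a4 (opR_braid h' τ)

theorem opT_far {i j : ℕ} (hij : i + 1 < j) (hj : j + 1 < n) (τ : PSYT n mu) :
    opT i (opT j (eb τ)) = opT j (opT i (eb τ)) := by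
  have hi : i + 1 < n := by omega
  have s1 : Equiv.swap i (i + 1) j = j := Equiv.swap_apply_of_ne_of_ne (by omega) (by omega)
  have s2 : Equiv.swap i (i + 1) (j + 1) = j + 1 :=
    Equiv.swap_apply_of_ne_of_ne (by omega) (by omega)
  have s3 : Equiv.swap j (j + 1) i = i := Equiv.swap_apply_of_ne_of_ne (by omega) (by omega)
  have s4 : Equiv.swap j (j + 1) (i + 1) = i + 1 :=
    Equiv.swap_apply_of_ne_of_ne (by omega) (by omega)
  simp only [opT_eb hi, opT_eb hj, map_add, map_smul, opT_apply hi, opT_apply hj, diag_opR _ hi,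
    diag_opR _ hj, diag_eb, s1, s2, s3, s4, opR_far hij hj]
  rw [smul_comm]
  abel

theorem opTh_succ {i : ℕ} (h : i + 1 < n) (τ : PSYT n mu) :
    opT i (opTh (i + 1) (opT i (eb τ))) = t • opTh i (eb τ) := by
  have hxy := sub_ne_zero.2 (xw_ne_succ τ h)
  have hyx := sub_ne_zero.2 (xw_ne_succ τ h).symm
  have a1 : opTh (i + 1) (opR i (eb τ)) = xw τ i • opR i (eb τ) := by
    rw [opTh, diag_opR _ h, diag_eb, map_smul]; simp
  rw [opT_eb h, map_add, map_smul, opTh_eb, a1, map_add, map_smul, map_smul, map_smul, opT_eb h,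
    opT_opR_self h, opTh_eb]
  exact theta_coeff hxy hyx _ _

theorem opT_opTh {i j : ℕ} (h : i + 1 < n) (h1 : j ≠ i) (h2 : j ≠ i + 1) (τ : PSYT n mu) :
    opT i (opTh j (eb τ)) = opTh j (opT i (eb τ)) := by
  have e : opTh j (opR i (eb τ)) = xw τ j • opR i (eb τ) := by
    rw [opTh, diag_opR _ h, diag_eb, map_smul]
    beta_reduce
    rw [Equiv.swap_apply_of_ne_of_ne h1 h2]
  rw [opTh_eb, map_smul, opT_eb h, map_add, map_smul, opTh_eb, e, smul_add, smul_comm]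

theorem opTh_opTh (i j : ℕ) (τ : PSYT n mu) :
    opTh i (opTh j (eb τ)) = opTh j (opTh i (eb τ)) := by
  rw [opTh_eb, opTh_eb, map_smul, map_smul, opTh_eb, opTh_eb, smul_comm]

theorem xw_psi (τ : PSYT n mu) {j : ℕ} (h : j + 1 < n) : xw τ.psi j = xw τ (j + 1) := by
  rw [xw, dif_pos (by omega), xw, dif_pos h, psi_idx_symm_of_lt τ j h]
  unfold boxWeight
  rw [psi_wt, if_neg (by simp)]

theorem xw_psi_last (τ : PSYT n mu) (hn : 0 < n) : xw τ.psi (n - 1) = q * xw τ 0 := by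
  rw [xw, dif_pos (by omega), xw, dif_pos hn, psi_idx_symm_last τ hn]
  unfold boxWeight
  rw [psi_wt, if_pos (by simp), pow_succ]
  ring

/-- Labels other than the first are only shifted by Ψ, so Ψ carries s_{i+1} to s_i. -/
theorem psi_sw_succ (τ : PSYT n mu) {i : ℕ} (h : i + 1 + 1 < n)
    (hr : ¬ Rigid τ.wt (τ.lo (i + 1) h) (τ.hi (i + 1) h)) :
    (τ.sw (i + 1) h).psi = τ.psi.sw i (by omega) := by
  have hw : ∀ b, (τ.idx b : ℕ) ≠ 0 → τ.psi.wt b = τ.wt b := fun b hb => by rw [psi_wt, if_neg hb]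
  have hr' : ¬ Rigid τ.psi.wt (τ.psi.lo i (by omega)) (τ.psi.hi i (by omega)) := by
    rw [psi_lo τ i _ h, psi_hi τ i _ h, Rigid, hw _ (by rw [idx_lo]; omega),
      hw _ (by rw [idx_hi]; omega)]
    exact hr
  have hidx : ∀ b, ((τ.sw (i + 1) h).idx b : ℕ) = if (τ.idx b : ℕ) = i + 1 then i + 1 + 1 else
      if (τ.idx b : ℕ) = i + 1 + 1 then i + 1 else (τ.idx b : ℕ) := fun b => by
    rw [sw_idx _ hr, Equiv.trans_apply, swap_val]
  apply ext_idx
  · funext b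
    rw [sw_wt, psi_wt, psi_wt, sw_wt, hidx]
    grind
  · intro b
    rw [psi_idx, hidx, sw_idx _ hr', Equiv.trans_apply, swap_val, psi_idx]
    have := (τ.idx b).2
    grind

/-- The labels i+1, i+2 of τ and i, i+1 of Ψ(τ) sit in the same boxes with the same weights, so all
coefficients agree. -/
theorem opA_opT {i : ℕ} (h : i + 1 + 1 < n) (τ : PSYT n mu) :
    opA (opT (i + 1) (eb τ)) = opT i (opA (eb τ)) := by
  have hn : 0 < n := by omega
  have hi : i + 1 < n := by omega
  have hw : ∀ b, (τ.idx b : ℕ) ≠ 0 → τ.psi.wt b = τ.wt b + 0 := fun b hb => by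
    rw [psi_wt, if_neg hb]; rfl
  rw [opA_eb hn, map_smul, opT_eb h, opT_eb hi, map_add, map_smul, opA_eb hn, xw_psi τ hi,
    xw_psi τ h, smul_add, smul_comm]
  congr 1
  rw [opR_eb _ h, opR_eb _ hi, map_smul, opA_eb hn, psi_lo τ i _ h, psi_hi τ i _ h,
    bC_add 0 (hw _ (by rw [idx_lo]; omega)) (hw _ (by rw [idx_hi]; omega))]
  by_cases hr : Rigid τ.wt (τ.lo (i + 1) h) (τ.hi (i + 1) h)
  · rw [bC_of_rigid hr, zero_smul, zero_smul, smul_zero]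
  · rw [psi_sw_succ τ h hr, smul_comm]
    congr 3
    rw [w, w, sw_wt, sw_idx_symm_of_ne τ hr _ (by simp) (by simp)]

/-! ### Two applications of Ψ, which wrap both exchanged labels around. -/

section TwoLabels

variable {k : ℕ} (τ : PSYT (k + 2) mu)

theorem psi_psi_idx (b : Box mu) : (τ.psi.psi.idx b : ℕ) =
    if (τ.idx b : ℕ) = 0 then k else if (τ.idx b : ℕ) = 1 then k + 1 else τ.idx b - 2 := by
  rw [psi_idx, psi_idx]
  split_ifs <;> omega

theorem psi_psi_wt (b : Box mu) : τ.psi.psi.wt b =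
    if (τ.idx b : ℕ) = 0 then τ.wt b + 1 else if (τ.idx b : ℕ) = 1 then τ.wt b + 1
      else τ.wt b := by
  rw [psi_wt, psi_wt, psi_idx]
  split_ifs <;> omega

theorem psi_psi_lo : τ.psi.psi.lo k (by omega) = τ.lo 0 (by omega) := by
  symm
  apply eq_lo
  rw [psi_psi_idx, idx_lo]
  simp

theorem psi_psi_hi : τ.psi.psi.hi k (by omega) = τ.hi 0 (by omega) := by
  symm
  apply eq_hi
  rw [psi_psi_idx, idx_hi]
  simp

theorem psi_psi_sw (hr : ¬ Rigid τ.wt (τ.lo 0 (by omega)) (τ.hi 0 (by omega))) :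
    (τ.sw 0 (by omega)).psi.psi = τ.psi.psi.sw k (by omega) := by
  have hr' : ¬ Rigid τ.psi.psi.wt (τ.psi.psi.lo k (by omega)) (τ.psi.psi.hi k (by omega)) := by
    rw [psi_psi_lo, psi_psi_hi, Rigid, psi_psi_wt, psi_psi_wt, idx_lo, idx_hi]
    simpa [Rigid] using hr
  have hidx : ∀ b, ((τ.sw 0 (by omega)).idx b : ℕ) = if (τ.idx b : ℕ) = 0 then (1 : ℕ)
      else if (τ.idx b : ℕ) = 1 then (0 : ℕ) else (τ.idx b : ℕ) := fun b => by
    rw [sw_idx _ hr, Equiv.trans_apply, swap_val]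
  apply ext_idx
  · funext b
    rw [sw_wt, psi_psi_wt, psi_psi_wt, sw_wt, hidx]
    grind
  · intro b
    rw [psi_psi_idx, hidx, sw_idx _ hr', Equiv.trans_apply, swap_val, psi_psi_idx]
    have := (τ.idx b).2
    grind

theorem opA_opA : opA (opA (eb τ)) =
    (q ^ (τ.wt (τ.lo 0 (by omega)) + τ.wt (τ.hi 0 (by omega))))⁻¹ • eb τ.psi.psi := by
  rw [opA_eb (by omega), map_smul, opA_eb (by omega), ← mul_smul, ← mul_inv, ← pow_add]
  congr 4
  rw [w, psi_idx_symm_of_lt τ 0 (by omega), psi_wt, if_neg (by simp)]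
  rfl

/-- After Ψ² both weights are multiplied by q, and the coefficients of T_i depend only on the ratio
of the two weights and on the difference of the exponents. The scalar in A² is symmetric in the
first two labels, hence unaffected by the exchange. -/
theorem opA_opA_opT : opA (opA (opT 0 (eb τ))) = opT k (opA (opA (eb τ))) := by
  have h0 : 0 + 1 < k + 2 := by omega
  have hk : k + 1 < k + 2 := by omega
  have e0 : xw τ.psi.psi k = q * xw τ 0 := by
    rw [xw_psi _ hk]; exact xw_psi_last τ (by omega)
  have e1 : xw τ.psi.psi (k + 1) = q * xw τ 1 := by
    rw [← xw_psi τ h0]; exact xw_psi_last τ.psi (by omega)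
  have hb : bC τ.psi.psi.wt (τ.lo 0 h0) (τ.hi 0 h0) = bC τ.wt (τ.lo 0 h0) (τ.hi 0 h0) :=
    bC_add 1 (by rw [psi_psi_wt, idx_lo]; simp) (by rw [psi_psi_wt, idx_hi]; simp)
  rw [opA_opA, map_smul, opT_eb h0, opT_eb hk, map_add, map_add, map_smul, map_smul, opA_opA, e0,
    e1, gC_mul q_ne_zero, smul_add, smul_comm]
  congr 1
  rw [opR_eb _ h0, opR_eb _ hk, map_smul, map_smul, opA_opA, psi_psi_lo, psi_psi_hi,
    hb]
  by_cases hr : Rigid τ.wt (τ.lo 0 h0) (τ.hi 0 h0)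
  · rw [bC_of_rigid hr, zero_smul, zero_smul, smul_zero]
  · rw [psi_psi_sw τ hr, smul_comm, sw_lo τ hr, sw_hi τ hr, sw_wt,
      add_comm (τ.wt _)]

end TwoLabels

theorem opT_mul_opTi (i : ℕ) : opT i * opTi i = (1 : Module.End Kqt (Mod n mu)) := by
  by_cases h : i + 1 < n
  · apply end_ext
    intro τ
    rw [opTi, if_pos h, mul_smul_comm, mul_add, LinearMap.smul_apply, LinearMap.add_apply,
      Module.End.mul_apply, Module.End.mul_apply, Module.algebraMap_end_apply, map_smul,
      opT_mul_self h, Module.End.one_apply, inv_smul_eq_iff₀ t_ne_zero, add_right_comm, ← add_smul]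
    simp
  · rw [opTi, opT, if_neg h, if_neg h, one_mul]

theorem opTi_mul_opT (i : ℕ) : opTi i * opT i = (1 : Module.End Kqt (Mod n mu)) := by
  rw [← opT_mul_opTi i, opTi]
  split_ifs
  · rw [mul_smul_comm, smul_mul_assoc, mul_add, add_mul, Algebra.commutes]
  · rw [mul_one, one_mul]

/-- The periodic tableaux span a representation of the double affine Hecke algebra. -/
noncomputable def psytData (n : ℕ) (mu : YoungDiagram) :
    HeckeData n (Module.End Kqt (Mod n mu)) where
  T := opT
  Ti := opTi
  th := opTh
  A := opA
  T_Ti := opT_mul_opTi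
  Ti_T := opTi_mul_opT
  Ti_eq i h := by rw [opTi, if_pos h]
  braid i h := end_ext fun τ => opT_braid h τ
  far i j h h' := end_ext fun τ => opT_far h h' τ
  th_comm i j _ _ := end_ext fun τ => opTh_opTh i j τ
  th_succ i h := by
    have h1 : opT i * opTh (i + 1) * opT i = t • (opTh i : Module.End Kqt (Mod n mu)) :=
      end_ext fun τ => opTh_succ h τ
    rw [← smul_mul_assoc, ← mul_smul_comm, ← h1]
    simp only [mul_assoc, opT_mul_opTi, mul_one]
    rw [← mul_assoc, opTi_mul_opT, one_mul]
  T_th i j h _ h1 h2 := end_ext fun τ => opT_opTh h h1 h2 τ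
  A_T i h := end_ext fun τ => opA_opT h τ
  A_A_T k h := by subst h; exact end_ext fun τ => opA_opA_opT τ
  A_th i h := end_ext fun τ => by
    have hn : 0 < n := by omega
    rw [Module.End.mul_apply, Module.End.mul_apply, opTh_eb, map_smul, opA_eb hn, map_smul,
      opTh_eb, xw_psi τ h, smul_comm]
  A_th_zero hn := end_ext fun τ => by
    rw [Module.End.mul_apply, LinearMap.smul_apply, Module.End.mul_apply, opTh_eb, map_smul,
      opA_eb hn, map_smul, opTh_eb, xw_psi_last τ hn, mul_smul, smul_comm,
      smul_comm (xw τ 0)]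

end Operators

end VVMac

namespace VVMac

open PSYT

/-! ### Relations in the double affine Hecke algebra -/

section Relations

variable {n : ℕ}

theorem dMk_rel {x y : FreeAlgebra Kqt (DGen n)} (h : DRel n x y) : dMk n x = dMk n y :=
  RingQuot.mkAlgHom_rel Kqt h

theorem gTinv_eq (i : ℕ) (h : i + 1 < n) :
    gTinv i h = t⁻¹ • (gT i h + algebraMap Kqt (Daha n) (t - 1)) := by
  rw [gTinv, fTinv, map_smul, map_add, AlgHom.commutes]; rfl

theorem gT_mul_gT (i : ℕ) (h : i + 1 < n) :
    gT i h * gT i h = (1 - t) • gT i h + t • (1 : Daha n) := by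
  have h1 := dMk_rel (DRel.quad i h)
  simp only [map_mul, map_sub, map_add, map_one, map_zero, AlgHom.commutes] at h1
  change (gT i h - 1) * (gT i h + algebraMap Kqt (Daha n) t) = 0 at h1
  rw [Algebra.smul_def, Algebra.smul_def, map_sub, map_one, ← sub_eq_zero, ← h1, mul_add,
    ← Algebra.commutes t (gT i h - 1)]
  noncomm_ring

theorem gT_mul_gTinv (i : ℕ) (h : i + 1 < n) : gT i h * gTinv i h = 1 := by
  rw [gTinv_eq, mul_smul_comm, mul_add, gT_mul_gT, ← Algebra.commutes, ← Algebra.smul_def,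
    inv_smul_eq_iff₀ t_ne_zero, add_right_comm, ← add_smul]
  simp

theorem gTinv_mul_gT (i : ℕ) (h : i + 1 < n) : gTinv i h * gT i h = 1 := by
  rw [← gT_mul_gTinv i h, gTinv_eq, mul_smul_comm, smul_mul_assoc, mul_add, add_mul,
    Algebra.commutes]

theorem gX_comm (i j : ℕ) (hi : i < n) (hj : j < n) : gX i hi * gX j hj = gX j hj * gX i hi := by
  have := dMk_rel (DRel.X_comm i j hi hj)
  rwa [map_mul, map_mul] at this

theorem gT_mul_gX (i j : ℕ) (hi : i + 1 < n) (hj : j < n) (h1 : j ≠ i) (h2 : j ≠ i + 1) :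
    gT i hi * gX j hj = gX j hj * gT i hi := by
  have := dMk_rel (DRel.T_X i j hi hj h1 h2)
  rwa [map_mul, map_mul] at this

theorem gX_succ (i : ℕ) (h : i + 1 < n) :
    gX (i + 1) h = t • (gTinv i h * gX i (Nat.lt_of_succ_lt h) * gTinv i h) := by
  have := dMk_rel (DRel.X_succ i h)
  rwa [map_smul, map_mul, map_mul] at this

theorem gTheta_succ (i : ℕ) (h : i + 1 < n) :
    gTheta (i + 1) h = t • (gTinv i h * gTheta i (Nat.lt_of_succ_lt h) * gTinv i h) := by
  have := dMk_rel (DRel.theta_succ i h)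
  rwa [map_smul, map_mul, map_mul] at this

theorem gT_mul_gX_succ (i : ℕ) (h : i + 1 < n) : gT i h * gX (i + 1) h =
    gX i (Nat.lt_of_succ_lt h) * gT i h + (t - 1) • gX i (Nat.lt_of_succ_lt h) := by
  rw [gX_succ, mul_smul_comm, ← mul_assoc, ← mul_assoc, gT_mul_gTinv, one_mul, gTinv_eq,
    mul_smul_comm, smul_inv_smul₀ t_ne_zero, mul_add, ← Algebra.commutes, ← Algebra.smul_def]

theorem gT_mul_gX_self (i : ℕ) (h : i + 1 < n) : gT i h * gX i (Nat.lt_of_succ_lt h) =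
    gX (i + 1) h * gT i h + (1 - t) • gX i (Nat.lt_of_succ_lt h) := by
  rw [gX_succ, smul_mul_assoc, mul_assoc _ (gTinv i h), gTinv_mul_gT, mul_one, gTinv_eq,
    smul_mul_assoc, smul_inv_smul₀ t_ne_zero, add_mul, ← Algebra.smul_def, add_assoc, ← add_smul]
  simp

theorem gPi_mul_gX (i : ℕ) (h : i + 1 < n) (hn : 0 < n) :
    gPi hn * gX i (Nat.lt_of_succ_lt h) = gX (i + 1) h * gPi hn := by
  have := dMk_rel (DRel.pi_X i h)
  rwa [map_mul, map_mul] at this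

theorem gPi_mul_gX_last (hn : 0 < n) :
    gPi hn * gX (n - 1) (Nat.sub_lt hn Nat.one_pos) = q • (gX 0 hn * gPi hn) := by
  have := dMk_rel (DRel.pi_X_last hn)
  rwa [map_smul, map_mul, map_mul] at this

theorem gPi_eq (hn : 0 < n) : gPi hn = t ^ (n - 1) • (gTheta 0 hn *
    (List.ofFn fun i : Fin (n - 1) => gTinv (n := n) i.1 (by omega)).prod) := by
  rw [gPi, fPi, map_smul, map_mul, map_list_prod, List.map_ofFn]; rfl

/-- With both θ's on the right, φ_i acts on a joint weight vector through T_i alone. -/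
theorem gPhi_eq (i : ℕ) (h : i + 1 < n) : gPhi i h =
    (gT i h + algebraMap Kqt (Daha n) (t - 1)) * gTheta i (Nat.lt_of_succ_lt h) -
      gT i h * gTheta (i + 1) h := by
  rw [gPhi, gTheta_succ, gTinv_eq, smul_inv_smul₀ t_ne_zero, ← gTinv_eq, ← mul_smul_comm,
    ← mul_assoc, ← mul_assoc, gT_mul_gTinv, one_mul]
  congr 2
  rw [gTinv_eq, smul_inv_smul₀ t_ne_zero]

end Relations

/-! ### Monomials -/

theorem mul_prod_ofFn_pow {M : Type*} [Monoid M] {n : ℕ} (f : Fin n → M)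
    (hf : ∀ i j, Commute (f i) (f j)) (α : Fin n → ℕ) (k : Fin n) :
    f k * (List.ofFn fun i => f i ^ α i).prod =
      (List.ofFn fun i => f i ^ (Function.update α k (α k + 1) i)).prod := by
  induction n with
  | zero => exact k.elim0
  | succ n ih =>
    rw [List.ofFn_succ, List.ofFn_succ, List.prod_cons, List.prod_cons]
    refine Fin.cases ?_ (fun k => ?_) k
    · rw [← mul_assoc, ← pow_succ', Function.update_self]
      congr 3
    · rw [← mul_assoc, ((hf k.succ 0).pow_right (α 0)).eq, mul_assoc,
        ih (fun i => f i.succ) (fun _ _ => hf _ _) (fun i => α i.succ) k,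
        Function.update_of_ne (Fin.succ_ne_zero k).symm]
      congr 3
      funext i
      by_cases h : i = k
      · subst h; simp
      · rw [Function.update_of_ne h, Function.update_of_ne (by simpa using h)]

theorem gX_mul_gMon {n : ℕ} (α : Fin n → ℕ) (k : Fin n) :
    gX k.1 k.2 * gMon α = gMon (Function.update α k (α k + 1)) :=
  mul_prod_ofFn_pow (fun i : Fin n => gX i.1 i.2) (fun _ _ => gX_comm _ _ _ _) α k

theorem gMon_zero {n : ℕ} : gMon (0 : Fin n → ℕ) = 1 := by
  simp [gMon]

theorem sum_update_succ {n : ℕ} (α : Fin n → ℕ) (k : Fin n) :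
    ∑ i, Function.update α k (α k + 1) i = ∑ i, α i + 1 := by
  rw [Finset.sum_update_of_mem (Finset.mem_univ k), ← Finset.add_sum_erase _ α (Finset.mem_univ k),
    Finset.sdiff_singleton_eq_erase]
  omega

theorem exists_update_of_sum {n d : ℕ} {α : Fin n → ℕ} (h : ∑ i, α i = d + 1) :
    ∃ (k : Fin n) (β : Fin n → ℕ), ∑ i, β i = d ∧ α = Function.update β k (β k + 1) := by
  obtain ⟨k, -, hk⟩ : ∃ k ∈ Finset.univ, α k ≠ 0 := Finset.exists_ne_zero_of_sum_ne_zero (by omega)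
  have e : α = Function.update (Function.update α k (α k - 1)) k
      (Function.update α k (α k - 1) k + 1) := by
    rw [Function.update_self, Function.update_idem, Nat.sub_add_cancel (Nat.pos_of_ne_zero hk),
      Function.update_eq_self]
  refine ⟨k, Function.update α k (α k - 1), ?_, e⟩
  have := sum_update_succ (Function.update α k (α k - 1)) k
  rw [← e] at this
  omega

/-! ### The monomials span the induced module -/

section Span

variable {n : ℕ} {mu : YoungDiagram}

theorem vrel_zero {x : SYT n mu →₀ Daha n} (h : VRel n mu x) :
    Submodule.Quotient.mk (p := Submodule.span (Daha n) {x | VRel n mu x}) x = 0 :=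
  (Submodule.Quotient.mk_eq_zero _).2 (Submodule.subset_span h)

theorem mk_smul_freeGen (k : Kqt) (τ : SYT n mu) :
    (Submodule.Quotient.mk (p := Submodule.span (Daha n) {x | VRel n mu x})
      (k • freeGen τ) : V n mu) = k • vSYT τ := by
  rw [← algebraMap_smul (Daha n) k (freeGen τ)]; rfl

theorem gTheta_smul_vSYT (τ : SYT n mu) (i : Fin n) :
    gTheta i.1 i.2 • vSYT τ = t ^ τ.1.c i • vSYT τ := by
  have h := vrel_zero (VRel.weight τ i)
  rw [Submodule.Quotient.mk_sub, sub_eq_zero] at h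
  rw [← mk_smul_freeGen, ← h]; rfl

theorem gPhi_smul_vSYT {τ σ : SYT n mu} {i : ℕ} {h : i + 1 < n} (hs : SwapUp i h τ.1 σ.1) :
    gPhi i h • vSYT τ =
      (t ^ τ.1.c ⟨i, Nat.lt_of_succ_lt h⟩ - t ^ τ.1.c ⟨i + 1, h⟩) • vSYT σ := by
  have h := vrel_zero (VRel.swap τ σ i h hs)
  rw [Submodule.Quotient.mk_sub, sub_eq_zero] at h
  rw [← mk_smul_freeGen, ← h]; rfl

theorem gT_smul_vSYT_row {τ : SYT n mu} {i : ℕ} {h : i + 1 < n}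
    (hr : (τ.1.lo i h).1.1 = (τ.1.hi i h).1.1) : gT i h • vSYT τ = vSYT τ := by
  have h := vrel_zero (VRel.row τ i h hr)
  rw [Submodule.Quotient.mk_sub, sub_eq_zero] at h
  exact h

theorem gT_smul_vSYT_col {τ : SYT n mu} {i : ℕ} {h : i + 1 < n}
    (hr : (τ.1.lo i h).1.2 = (τ.1.hi i h).1.2) : gT i h • vSYT τ = (-t) • vSYT τ := by
  have h := vrel_zero (VRel.col τ i h hr)
  rw [Submodule.Quotient.mk_add] at h
  rw [neg_smul, ← add_eq_zero_iff_eq_neg, ← mk_smul_freeGen]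
  exact h

/-- The elements of `X`-degree `d`. -/
noncomputable def degEq (n : ℕ) (mu : YoungDiagram) (d : ℕ) : Submodule Kqt (V n mu) :=
  Submodule.span Kqt {x | ∃ (α : Fin n → ℕ) (τ : SYT n mu), ∑ i, α i = d ∧ x = vMon α τ}

theorem mul_smul_V (a b : Daha n) (v : V n mu) : (a * b) • v = a • b • v :=
  Module.toDistribMulAction.toMulAction.mul_smul a b v

theorem smul_smul_V (k : Kqt) (a : Daha n) (v : V n mu) : a • k • v = k • a • v := by
  rw [← algebraMap_smul (Daha n) k v, ← algebraMap_smul (Daha n) k (a • v), ← mul_smul,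
    ← mul_smul, Algebra.commutes]

/-- The action of an element of the double affine Hecke algebra as a linear map. -/
noncomputable def act (a : Daha n) : V n mu →ₗ[Kqt] V n mu where
  toFun v := a • v
  map_add' := smul_add a
  map_smul' k v := smul_smul_V k a v

@[simp] theorem act_apply (a : Daha n) (v : V n mu) : act a v = a • v := rfl

theorem vSYT_mem (τ : SYT n mu) : vSYT τ ∈ degEq n mu 0 :=
  Submodule.subset_span ⟨0, τ, by simp, by rw [vMon, gMon_zero, one_smul]⟩

theorem gX_smul_mem {d : ℕ} {v : V n mu} (hv : v ∈ degEq n mu d) (k : Fin n) :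
    gX k.1 k.2 • v ∈ degEq n mu (d + 1) := by
  suffices h : degEq n mu d ≤ (degEq n mu (d + 1)).comap (act (gX k.1 k.2)) from h hv
  refine Submodule.span_le.2 ?_
  rintro _ ⟨α, τ, hα, rfl⟩
  exact Submodule.subset_span ⟨_, τ, by rw [sum_update_succ α k, hα], by
    rw [act_apply, vMon, vMon, ← mul_smul, gX_mul_gMon]⟩

/-- A property of homogeneous elements follows from the case of degree zero and its stability under
the multiplications by the `X_k`. -/
theorem degEq_le {p : ℕ → Submodule Kqt (V n mu)} (hzero : ∀ τ, vSYT τ ∈ p 0)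
    (hX : ∀ d v (k : Fin n), v ∈ degEq n mu d → v ∈ p d → gX k.1 k.2 • v ∈ p (d + 1)) (d : ℕ) :
    degEq n mu d ≤ p d := by
  induction d with
  | zero =>
    refine Submodule.span_le.2 ?_
    rintro _ ⟨α, τ, hα, rfl⟩
    obtain rfl : α = 0 := funext fun i => (Finset.sum_eq_zero_iff.1 hα) i (Finset.mem_univ i)
    rw [vMon, gMon_zero, one_smul]
    exact hzero τ
  | succ d ih =>
    refine Submodule.span_le.2 ?_
    rintro _ ⟨α, τ, hα, rfl⟩
    obtain ⟨k, β, hβ, rfl⟩ := exists_update_of_sum hα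
    have hm : vMon β τ ∈ degEq n mu d := Submodule.subset_span ⟨β, τ, hβ, rfl⟩
    rw [vMon, ← gX_mul_gMon, mul_smul_V]
    exact hX d _ k hm (ih hm)

theorem degEq_zero_le {p : Submodule Kqt (V n mu)} (hzero : ∀ τ, vSYT τ ∈ p) :
    degEq n mu 0 ≤ p :=
  -- Taking the whole space in positive degrees makes the multiplication step vacuous.
  degEq_le (p := fun d => if d = 0 then p else ⊤) (by simpa using hzero)
    (fun d v k _ _ => by simp) 0

/-- The homogeneous components are stable under `a`. -/
def Stable (mu : YoungDiagram) (a : Daha n) : Prop :=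
  ∀ d, ∀ v ∈ degEq n mu d, a • v ∈ degEq n mu d

theorem Stable.mul {a b : Daha n} (ha : Stable mu a) (hb : Stable mu b) : Stable mu (a * b) :=
  fun d v hv => by rw [mul_smul_V]; exact ha d _ (hb d v hv)

theorem Stable.smul {a : Daha n} (k : Kqt) (ha : Stable mu a) : Stable mu (k • a) :=
  fun d v hv => by rw [smul_assoc]; exact Submodule.smul_mem _ _ (ha d v hv)

theorem Stable.add {a b : Daha n} (ha : Stable mu a) (hb : Stable mu b) : Stable mu (a + b) :=
  fun d v hv => by rw [add_smul]; exact Submodule.add_mem _ (ha d v hv) (hb d v hv)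

theorem stable_algebraMap (k : Kqt) : Stable mu (algebraMap Kqt (Daha n) k) :=
  fun d v hv => by rw [algebraMap_smul]; exact Submodule.smul_mem _ _ hv

theorem stable_one : Stable mu (1 : Daha n) := fun d v hv => by rwa [one_smul]

theorem Stable.list_prod {l : List (Daha n)} (h : ∀ a ∈ l, Stable mu a) : Stable mu l.prod := by
  induction l with
  | nil => exact stable_one
  | cons a l ih =>
    rw [List.prod_cons]
    exact (h a (by simp)).mul (ih fun b hb => h b (by simp [hb]))

/-- The relation for φ_i is solved for T_i; this needs the difference of the two weights to be
nonzero. -/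
theorem gT_smul_vSYT_up {τ σ : SYT n mu} {i : ℕ} {h : i + 1 < n} (hs : SwapUp i h τ.1 σ.1) :
    gT i h • vSYT τ = vSYT σ + gC (t ^ τ.1.c ⟨i, Nat.lt_of_succ_lt h⟩) (t ^ τ.1.c ⟨i + 1, h⟩) •
      vSYT τ := by
  have hne : t ^ τ.1.c ⟨i, Nat.lt_of_succ_lt h⟩ - t ^ τ.1.c ⟨i + 1, h⟩ ≠ 0 := by
    have := τ.1.boxWeight_ne (τ.1.idx_hi_lo i h)
    unfold boxWeight at this
    rw [τ.2, τ.2, pow_zero, one_mul, one_mul] at this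
    exact sub_ne_zero.2 this
  have h1 := gPhi_smul_vSYT hs
  have e1 := gTheta_smul_vSYT τ ⟨i, Nat.lt_of_succ_lt h⟩
  have e2 := gTheta_smul_vSYT τ ⟨i + 1, h⟩
  simp only at e1 e2
  rw [gPhi_eq, sub_smul, mul_smul_V, mul_smul_V, e1, e2, smul_smul_V, smul_smul_V, add_smul,
    algebraMap_smul] at h1
  generalize t ^ τ.1.c ⟨i, Nat.lt_of_succ_lt h⟩ = x at *
  generalize t ^ τ.1.c ⟨i + 1, h⟩ = y at *
  have h2 : (x - y) • gT i h • vSYT τ =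
      (x - y) • (vSYT σ + gC x y • vSYT τ) := by
    have e3 : (x - y) * gC x y = -(x * (t - 1)) := by
      have : y - x ≠ 0 := by rwa [← neg_sub, neg_ne_zero]
      unfold gC
      field_simp
      ring
    rw [smul_add, ← h1, smul_add, ← mul_smul, ← mul_smul, e3, sub_smul, neg_smul]
    abel
  exact smul_right_injective _ hne h2

theorem stable_gT (i : ℕ) (h : i + 1 < n) : Stable mu (gT i h) := by
  refine degEq_le (p := fun d => (degEq n mu d).comap (act (gT i h))) (fun τ => ?_) ?_
  · rw [Submodule.mem_comap, act_apply]
    by_cases hr : Rigid τ.1.wt (τ.1.lo i h) (τ.1.hi i h)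
    · rcases hr.2 with hr | hr
      · rw [gT_smul_vSYT_row hr]; exact vSYT_mem τ
      · rw [gT_smul_vSYT_col hr]; exact Submodule.smul_mem _ _ (vSYT_mem τ)
    · let σ : SYT n mu := ⟨τ.1.sw i h, fun b => by rw [sw_wt]; exact τ.2 b⟩
      rcases τ.1.up_or_up (τ.1.idx_hi_lo i h) hr with hu | hu
      · have hs : SwapUp i h τ.1 σ.1 := (swapUp_iff _ _).2 ⟨rfl, hu⟩
        rw [gT_smul_vSYT_up hs]
        exact Submodule.add_mem _ (vSYT_mem σ) (Submodule.smul_mem _ _ (vSYT_mem τ))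
      -- The defining relations describe only upward exchanges. Here τ itself is the upper tableau,
      -- so it is expressed through T_i on σ, and the quadratic relation evaluates the second
      -- application of T_i.
      · have hs : SwapUp i h σ.1 τ.1 := by
          refine (swapUp_iff _ _).2 ⟨(sw_sw τ.1).symm, ?_⟩
          change Up (τ.1.sw i h).wt ((τ.1.sw i h).lo i h) ((τ.1.sw i h).hi i h)
          rw [sw_wt, sw_lo _ hr, sw_hi _ hr]
          exact hu
        have h1 := gT_smul_vSYT_up hs
        have h2 : vSYT τ = gT i h • vSYT σ - gC (t ^ σ.1.c ⟨i, Nat.lt_of_succ_lt h⟩)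
            (t ^ σ.1.c ⟨i + 1, h⟩) • vSYT σ := by rw [h1, add_sub_cancel_right]
        have h3 : gT i h • vSYT σ ∈ degEq n mu 0 := by
          rw [h1]
          exact Submodule.add_mem _ (vSYT_mem τ) (Submodule.smul_mem _ _ (vSYT_mem σ))
        rw [h2, smul_sub, ← mul_smul, gT_mul_gT, add_smul, smul_assoc, smul_assoc, one_smul,
          smul_smul_V]
        exact Submodule.sub_mem _ (Submodule.add_mem _ (Submodule.smul_mem _ _ h3)
          (Submodule.smul_mem _ _ (vSYT_mem σ))) (Submodule.smul_mem _ _ h3)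
  · intro d v k hv hTv
    rw [Submodule.mem_comap, act_apply] at hTv ⊢
    obtain ⟨k, hk⟩ := k
    rw [← mul_smul]
    by_cases h1 : k = i
    · subst h1
      rw [gT_mul_gX_self, add_smul, smul_assoc, mul_smul_V]
      exact Submodule.add_mem _ (gX_smul_mem hTv ⟨k + 1, h⟩)
        (Submodule.smul_mem _ _ (gX_smul_mem hv ⟨k, hk⟩))
    by_cases h2 : k = i + 1
    · subst h2
      rw [gT_mul_gX_succ, add_smul, smul_assoc, mul_smul_V]
      exact Submodule.add_mem _ (gX_smul_mem hTv ⟨i, by omega⟩)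
        (Submodule.smul_mem _ _ (gX_smul_mem hv ⟨i, by omega⟩))
    rw [gT_mul_gX i k h hk h1 h2, mul_smul_V]
    exact gX_smul_mem hTv ⟨k, hk⟩

theorem stable_gTinv (i : ℕ) (h : i + 1 < n) : Stable mu (gTinv i h) := by
  rw [gTinv_eq]
  exact ((stable_gT i h).add (stable_algebraMap _)).smul _

theorem stable_gPi (hn : 0 < n) : Stable mu (gPi hn) := by
  have hQ : Stable mu (List.ofFn fun i : Fin (n - 1) => gTinv (n := n) i.1 (by omega)).prod := by
    apply Stable.list_prod
    intro a ha
    obtain ⟨i, rfl⟩ := (List.mem_ofFn' _ _).1 ha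
    exact stable_gTinv _ _
  refine degEq_le (p := fun d => (degEq n mu d).comap (act (gPi hn))) (fun τ => ?_) ?_
  · rw [Submodule.mem_comap, act_apply, gPi_eq, smul_assoc, mul_smul_V]
    refine Submodule.smul_mem _ _ ?_
    have h1 := hQ 0 _ (vSYT_mem τ)
    refine degEq_zero_le (p := (degEq n mu 0).comap (act (gTheta 0 hn))) (fun σ => ?_) h1
    rw [Submodule.mem_comap, act_apply, gTheta_smul_vSYT σ ⟨0, hn⟩]
    exact Submodule.smul_mem _ _ (vSYT_mem σ)
  · intro d v k hv hTv
    rw [Submodule.mem_comap, act_apply] at hTv ⊢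
    obtain ⟨k, hk⟩ := k
    rw [← mul_smul]
    by_cases h1 : k + 1 < n
    · rw [gPi_mul_gX k h1 hn, mul_smul_V]
      exact gX_smul_mem hTv ⟨k + 1, h1⟩
    · obtain rfl : k = n - 1 := by omega
      rw [gPi_mul_gX_last hn, smul_assoc, mul_smul_V]
      exact Submodule.smul_mem _ _ (gX_smul_mem hTv ⟨0, hn⟩)

/-- The defining relations let π, but not θ, pass the X's. So θ_1 is recovered from π by multiplying
with the inverse of the product of the T_i⁻¹, and the other θ's follow by conjugation. -/
theorem stable_gTheta (i : ℕ) (h : i < n) : Stable mu (gTheta i h) := by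
  induction i with
  | zero =>
    have hinv : ∃ b : Daha n, Stable mu b ∧
        (List.ofFn fun i : Fin (n - 1) => gTinv (n := n) i.1 (by omega)).prod * b = 1 := by
      have : ∀ l : List (Daha n), (∀ a ∈ l, ∃ b, Stable mu b ∧ a * b = 1) →
          ∃ b : Daha n, Stable mu b ∧ l.prod * b = 1 := by
        intro l
        induction l with
        | nil => exact fun _ => ⟨1, stable_one, by simp⟩
        | cons a l ih =>
          intro hl
          obtain ⟨b, hb, hab⟩ := hl a (by simp)
          obtain ⟨c, hc, hlc⟩ := ih fun x hx => hl x (by simp [hx])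
          exact ⟨c * b, hc.mul hb, by
            rw [List.prod_cons, mul_assoc, ← mul_assoc l.prod, hlc, one_mul, hab]⟩
      apply this
      intro a ha
      obtain ⟨i, rfl⟩ := (List.mem_ofFn' _ _).1 ha
      exact ⟨_, stable_gT _ _, gTinv_mul_gT _ _⟩
    obtain ⟨b, hb, h1⟩ := hinv
    have h2 : gTheta 0 h = (t ^ (n - 1))⁻¹ • (gPi h * b) := by
      rw [gPi_eq, smul_mul_assoc, inv_smul_smul₀ (pow_ne_zero _ t_ne_zero), mul_assoc, h1, mul_one]
    rw [h2]
    exact ((stable_gPi h).mul hb).smul _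
  | succ i ih =>
    rw [gTheta_succ]
    exact (((stable_gTinv i h).mul (ih (by omega))).mul (stable_gTinv i h)).smul _

/-- The family of all monomials `X^α ⊗ τ`. -/
noncomputable def monFamily (n : ℕ) (mu : YoungDiagram) (p : (Fin n → ℕ) × SYT n mu) : V n mu :=
  vMon p.1 p.2

theorem degEq_le_span (d : ℕ) : degEq n mu d ≤ Submodule.span Kqt (Set.range (monFamily n mu)) :=
  Submodule.span_mono fun _ ⟨α, τ, _, h⟩ => ⟨(α, τ), h.symm⟩

theorem dMk_surjective : Function.Surjective (dMk n) := RingQuot.mkAlgHom_surjective Kqt (DRel n)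

/-- Each algebra generator maps homogeneous components to homogeneous components, so the span of all
monomials is a submodule. -/
theorem smul_mem_span (a : Daha n) {v : V n mu}
    (hv : v ∈ Submodule.span Kqt (Set.range (monFamily n mu))) :
    a • v ∈ Submodule.span Kqt (Set.range (monFamily n mu)) := by
  have hg : ∀ (a : Daha n), (∀ d, ∀ v ∈ degEq n mu d, ∃ e, a • v ∈ degEq n mu e) →
      ∀ v ∈ Submodule.span Kqt (Set.range (monFamily n mu)),
        a • v ∈ Submodule.span Kqt (Set.range (monFamily n mu)) := by
    intro a ha v hv
    suffices h : Submodule.span Kqt (Set.range (monFamily n mu)) ≤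
      (Submodule.span Kqt (Set.range (monFamily n mu))).comap (act a) from h hv
    refine Submodule.span_le.2 ?_
    rintro _ ⟨⟨α, τ⟩, rfl⟩
    obtain ⟨e, he⟩ := ha _ (vMon α τ) (Submodule.subset_span ⟨α, τ, rfl, rfl⟩)
    exact degEq_le_span e he
  obtain ⟨x, rfl⟩ := dMk_surjective a
  induction x using FreeAlgebra.induction generalizing v with
  | grade0 k => rw [AlgHom.commutes, algebraMap_smul]; exact Submodule.smul_mem _ _ hv
  | grade1 x =>
    refine hg _ (fun d v hv => ?_) v hv
    cases x with
    | T i h => exact ⟨d, stable_gT i h d v hv⟩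
    | theta i h => exact ⟨d, stable_gTheta i h d v hv⟩
    | X i h => exact ⟨d + 1, gX_smul_mem hv ⟨i, h⟩⟩
  | mul a b ha hb => rw [map_mul, mul_smul_V]; exact ha (hb hv)
  | add a b ha hb => rw [map_add, add_smul]; exact Submodule.add_mem _ (ha hv) (hb hv)

theorem span_monFamily : Submodule.span Kqt (Set.range (monFamily n mu)) = ⊤ := by
  refine eq_top_iff.2 fun v _ => ?_
  obtain ⟨f, rfl⟩ := Submodule.Quotient.mk_surjective _ v
  induction f using Finsupp.induction_linear with
  | zero => exact Submodule.zero_mem _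
  | add f g hf hg => exact Submodule.add_mem _ (hf trivial) (hg trivial)
  | single τ a =>
    have e : (Finsupp.single τ a : SYT n mu →₀ Daha n) = a • freeGen τ := by simp [freeGen]
    rw [e]
    exact smul_mem_span a (degEq_le_span 0 (vSYT_mem τ))

end Span

end VVMac

namespace VVMac

open PSYT

/-! ### The map from the induced module to the module of periodic tableaux -/

section Map

variable {n : ℕ} {mu : YoungDiagram}

/-- The second weight is t times the first, for which the diagonal coefficient is 1; the exchange
term vanishes at a rigid pair. -/
theorem opT_eb_row {τ : PSYT n mu} {i : ℕ} {h : i + 1 < n}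
    (hw : τ.wt (τ.lo i h) = τ.wt (τ.hi i h)) (hr : (τ.lo i h).1.1 = (τ.hi i h).1.1) :
    opT i (eb τ) = eb τ := by
  have hR : Rigid τ.wt (τ.lo i h) (τ.hi i h) := ⟨hw, Or.inl hr⟩
  rw [opT_eb h, opR_eb_of_rigid hR, add_zero, xw_lo τ i h, xw_hi τ i h]
  have hc : content (τ.hi i h) = content (τ.lo i h) + 1 := by
    rcases hR.content_eq τ (τ.idx_hi_lo i h) with hc | hc
    · exact hc.2
    · have h1 := τ.idx_hi_lo i h
      rw [box_ext hr hc.1] at h1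
      omega
  have h0 := boxWeight_ne_zero τ.wt (τ.lo i h)
  have h1 := t_sub_one_ne_zero
  rw [boxWeight_of_content_eq hw.symm hc, gC, show t * boxWeight τ.wt (τ.lo i h) -
    boxWeight τ.wt (τ.lo i h) = (t - 1) * boxWeight τ.wt (τ.lo i h) by ring,
    div_self (mul_ne_zero h1 h0), one_smul]

theorem opT_eb_col {τ : PSYT n mu} {i : ℕ} {h : i + 1 < n}
    (hw : τ.wt (τ.lo i h) = τ.wt (τ.hi i h)) (hr : (τ.lo i h).1.2 = (τ.hi i h).1.2) :
    opT i (eb τ) = (-t) • eb τ := by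
  have hR : Rigid τ.wt (τ.lo i h) (τ.hi i h) := ⟨hw, Or.inr hr⟩
  rw [opT_eb h, opR_eb_of_rigid hR, add_zero, xw_lo τ i h, xw_hi τ i h]
  have hc : content (τ.lo i h) = content (τ.hi i h) + 1 := by
    rcases hR.content_eq τ (τ.idx_hi_lo i h) with hc | hc
    · have h1 := τ.idx_hi_lo i h
      rw [box_ext hc.1 hr] at h1
      omega
    · exact hc.2
  have h0 := boxWeight_ne_zero τ.wt (τ.hi i h)
  have h1 := one_sub_t_ne_zero
  rw [boxWeight_of_content_eq hw hc, gC, show boxWeight τ.wt (τ.hi i h) -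
    t * boxWeight τ.wt (τ.hi i h) = (1 - t) * boxWeight τ.wt (τ.hi i h) by ring]
  congr 1
  rw [div_eq_iff (mul_ne_zero h1 h0)]
  ring

theorem opT_eb_up {τ : PSYT n mu} {i : ℕ} {h : i + 1 < n} (hu : Up τ.wt (τ.lo i h) (τ.hi i h)) :
    opT i (eb τ) = gC (xw τ i) (xw τ (i + 1)) • eb τ + eb (τ.sw i h) := by
  rw [opT_eb h, opR_eb i h, bC_of_up (not_rigid_of_up τ hu) hu, one_smul]

/-- The representation on the periodic tableaux. -/
noncomputable def rho (n : ℕ) (mu : YoungDiagram) : Daha n →ₐ[Kqt] Module.End Kqt (Mod n mu) :=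
  (psytData n mu).hom

@[simp] theorem rho_gT (i : ℕ) (h : i + 1 < n) : rho n mu (gT i h) = opT i :=
  HeckeData.hom_gT _ i h

@[simp] theorem rho_gTinv (i : ℕ) (h : i + 1 < n) : rho n mu (gTinv i h) = opTi i :=
  HeckeData.hom_gTinv _ i h

@[simp] theorem rho_gTheta (i : ℕ) (h : i < n) : rho n mu (gTheta i h) = opTh i :=
  HeckeData.hom_gTheta _ i h

@[simp] theorem rho_gX (i : ℕ) (h : i < n) : rho n mu (gX i h) = (psytData n mu).X i :=
  HeckeData.hom_gX _ i h

@[simp] theorem rho_gPi (h : 0 < n) : rho n mu (gPi h) = (psytData n mu).pi :=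
  HeckeData.hom_gPi _ h

theorem xw_eq (τ : PSYT n mu) (i : Fin n) : xw τ i = q ^ τ.w i * t ^ τ.c i := dif_pos i.2

theorem xw_syt (τ : SYT n mu) (i : Fin n) : xw τ.1 i = t ^ τ.1.c i := by
  rw [xw_eq, w, τ.2, pow_zero, one_mul]

/-- The diagonal coefficient of T_i is chosen so that multiplication by x - y cancels all multiples
of τ itself. -/
theorem rho_gPhi {τ σ : PSYT n mu} {i : ℕ} {h : i + 1 < n} (hs : SwapUp i h τ σ) :
    rho n mu (gPhi i h) (eb τ) = (xw τ i - xw τ (i + 1)) • eb σ := by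
  obtain ⟨rfl, hu⟩ := (swapUp_iff _ _).1 hs
  have hxy := sub_ne_zero.2 (xw_ne_succ τ h)
  rw [gPhi_eq, map_sub, map_mul, map_mul, map_add, AlgHom.commutes, rho_gT, rho_gTheta, rho_gTheta,
    LinearMap.sub_apply, Module.End.mul_apply, Module.End.mul_apply, opTh_eb, opTh_eb, map_smul,
    map_smul, LinearMap.add_apply, Module.algebraMap_end_apply, opT_eb_up hu]
  generalize xw τ i = x at *
  generalize xw τ (i + 1) = y at *
  have e3 : (x - y) * gC x y = -(x * (t - 1)) := by
    have : y - x ≠ 0 := by rwa [← neg_sub, neg_ne_zero]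
    unfold gC
    field_simp
    ring
  have e4 : x • (gC x y • eb τ + eb (τ.sw i h) + (t - 1) • eb τ) -
      y • (gC x y • eb τ + eb (τ.sw i h)) =
      ((x - y) * gC x y + x * (t - 1)) • eb τ + (x - y) • eb (τ.sw i h) := by
    simp only [smul_add, add_smul, sub_smul, sub_mul, mul_smul]
    abel
  rw [e4, e3, neg_add_cancel, zero_smul, zero_add]

/-- The space of periodic tableaux as a module over the double affine Hecke algebra. -/
def DMod (n : ℕ) (mu : YoungDiagram) : Type := Mod n mu

noncomputable instance : AddCommGroup (DMod n mu) := inferInstanceAs (AddCommGroup (Mod n mu))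

noncomputable instance : Module (Daha n) (DMod n mu) :=
  Module.compHom (Mod n mu) (rho n mu).toRingHom

theorem dmod_smul (a : Daha n) (v : DMod n mu) : a • v = (rho n mu a (v : Mod n mu) : Mod n mu) :=
  rfl

/-- The basis vector of a tableau as an element of `DMod`. -/
noncomputable def ebD (τ : PSYT n mu) : DMod n mu := eb τ

/-- The map from the free module on the standard tableaux. -/
noncomputable def freeMap (n : ℕ) (mu : YoungDiagram) : (SYT n mu →₀ Daha n) →ₗ[Daha n] DMod n mu :=
  Finsupp.linearCombination (Daha n) fun τ => ebD τ.1

theorem freeMap_smul_freeGen (a : Daha n) (τ : SYT n mu) :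
    freeMap n mu (a • freeGen τ) = (rho n mu a (eb τ.1) : Mod n mu) := by
  rw [map_smul, freeMap, freeGen, Finsupp.linearCombination_single, one_smul]; rfl

theorem freeMap_smul_freeGen' (k : Kqt) (τ : SYT n mu) :
    freeMap n mu (k • freeGen τ) = (k • eb τ.1 : Mod n mu) := by
  rw [← algebraMap_smul (Daha n) k (freeGen τ), freeMap_smul_freeGen, AlgHom.commutes]; rfl

theorem freeMap_freeGen (τ : SYT n mu) : freeMap n mu (freeGen τ) = (eb τ.1 : Mod n mu) := by
  rw [← one_smul (Daha n) (freeGen τ), freeMap_smul_freeGen, map_one]; rfl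

theorem freeMap_rel {x : SYT n mu →₀ Daha n} (h : VRel n mu x) : freeMap n mu x = 0 := by
  cases h with
  | weight τ i =>
    rw [map_sub, sub_eq_zero, freeMap_smul_freeGen, freeMap_smul_freeGen', rho_gTheta, opTh_eb,
      xw_syt]
  | swap τ σ i h hs =>
    rw [map_sub, sub_eq_zero, freeMap_smul_freeGen, freeMap_smul_freeGen', rho_gPhi hs,
      ← xw_syt, ← xw_syt]
  | row τ i h hr =>
    rw [map_sub, sub_eq_zero, freeMap_smul_freeGen, freeMap_freeGen, rho_gT,
      opT_eb_row (by rw [τ.2, τ.2]) hr]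
  | col τ i h hc =>
    rw [map_add, freeMap_smul_freeGen, freeMap_smul_freeGen', rho_gT,
      opT_eb_col (by rw [τ.2, τ.2]) hc, neg_smul]
    exact neg_add_cancel (t • eb τ.1 : Mod n mu)

/-- The module homomorphism `V_μ → DMod`. -/
noncomputable def toD (n : ℕ) (mu : YoungDiagram) : V n mu →ₗ[Daha n] DMod n mu :=
  (Submodule.span (Daha n) {x | VRel n mu x}).liftQ (freeMap n mu)
    (Submodule.span_le.2 fun _ h => freeMap_rel h)

/-- The map from the induced module to the space of periodic tableaux. -/
noncomputable def toMod (n : ℕ) (mu : YoungDiagram) : V n mu →ₗ[Kqt] Mod n mu where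
  toFun v := toD n mu v
  map_add' := map_add (toD n mu)
  map_smul' k v := by
    rw [← algebraMap_smul (Daha n) k v, map_smul, dmod_smul, AlgHom.commutes]; rfl

theorem toMod_smul (a : Daha n) (v : V n mu) :
    toMod n mu (a • v) = rho n mu a (toMod n mu v) :=
  map_smul (toD n mu) a v

theorem toMod_vSYT (τ : SYT n mu) : toMod n mu (vSYT τ) = eb τ.1 := freeMap_freeGen τ

end Map

/-! ### Degrees -/

section Degree

variable {n : ℕ} {mu : YoungDiagram}

/-- The sum of the exponents. -/
def PSYT.deg (τ : PSYT n mu) : ℕ := ∑ b, τ.wt b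

theorem PSYT.deg_sw (τ : PSYT n mu) (i : ℕ) (h : i + 1 < n) : (τ.sw i h).deg = τ.deg := by
  rw [deg, sw_wt]; rfl

theorem PSYT.deg_psi (τ : PSYT n mu) (hn : 0 < n) : τ.psi.deg = τ.deg + 1 := by
  have h : ∀ b, τ.psi.wt b = τ.wt b + if b = τ.idx.symm ⟨0, hn⟩ then 1 else 0 := by
    intro b
    have e : (b = τ.idx.symm ⟨0, hn⟩) ↔ (τ.idx b : ℕ) = 0 := by
      rw [Equiv.eq_symm_apply, Fin.ext_iff]
    rw [psi_wt]
    simp only [e]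
    split_ifs <;> rfl
  simp only [deg, h, Finset.sum_add_distrib, Finset.sum_ite_eq', Finset.mem_univ, if_true]

/-- The span of the tableaux of degree `d`. -/
noncomputable def modDeg (n : ℕ) (mu : YoungDiagram) (d : ℕ) : Submodule Kqt (Mod n mu) :=
  Submodule.span Kqt {x | ∃ τ : PSYT n mu, τ.deg = d ∧ x = eb τ}

theorem eb_mem (τ : PSYT n mu) : eb τ ∈ modDeg n mu τ.deg := Submodule.subset_span ⟨τ, rfl, rfl⟩

theorem modDeg_mapsTo {f : Module.End Kqt (Mod n mu)} {d e : ℕ}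
    (h : ∀ τ : PSYT n mu, τ.deg = d → f (eb τ) ∈ modDeg n mu e) {v : Mod n mu}
    (hv : v ∈ modDeg n mu d) : f v ∈ modDeg n mu e := by
  suffices h' : modDeg n mu d ≤ (modDeg n mu e).comap f from h' hv
  refine Submodule.span_le.2 ?_
  rintro _ ⟨τ, hτ, rfl⟩
  exact h τ hτ

theorem opT_mem {i d : ℕ} {v : Mod n mu} (hv : v ∈ modDeg n mu d) :
    opT i v ∈ modDeg n mu d := by
  by_cases h : i + 1 < n
  · refine modDeg_mapsTo (fun τ hτ => ?_) hv
    rw [opT_eb h, opR_eb i h]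
    refine Submodule.add_mem _ (Submodule.smul_mem _ _ (hτ ▸ eb_mem τ)) (Submodule.smul_mem _ _ ?_)
    have := eb_mem (τ.sw i h)
    rwa [deg_sw, hτ] at this
  · rwa [opT, if_neg h]

theorem opTi_mem {i d : ℕ} {v : Mod n mu} (hv : v ∈ modDeg n mu d) :
    opTi i v ∈ modDeg n mu d := by
  rw [opTi]
  split_ifs
  · rw [LinearMap.smul_apply, LinearMap.add_apply, Module.algebraMap_end_apply]
    exact Submodule.smul_mem _ _ (Submodule.add_mem _ (opT_mem hv) (Submodule.smul_mem _ _ hv))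
  · exact hv

theorem opTh_mem {i d : ℕ} {v : Mod n mu} (hv : v ∈ modDeg n mu d) :
    opTh i v ∈ modDeg n mu d := by
  refine modDeg_mapsTo (fun τ hτ => ?_) hv
  rw [opTh_eb]
  exact Submodule.smul_mem _ _ (hτ ▸ eb_mem τ)

theorem Q_mem {m d : ℕ} {v : Mod n mu} (hv : v ∈ modDeg n mu d) :
    (psytData n mu).Q m v ∈ modDeg n mu d := by
  induction m generalizing v with
  | zero => exact hv
  | succ m ih => exact ih (opTi_mem hv)

theorem pi_mem {d : ℕ} {v : Mod n mu} (hv : v ∈ modDeg n mu d) :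
    (psytData n mu).pi v ∈ modDeg n mu d :=
  Submodule.smul_mem _ _ (opTh_mem (Q_mem hv))

theorem opA_mem (hn : 0 < n) {d : ℕ} {v : Mod n mu} (hv : v ∈ modDeg n mu d) :
    opA v ∈ modDeg n mu (d + 1) := by
  refine modDeg_mapsTo (fun τ hτ => ?_) hv
  rw [opA_eb hn, ← hτ, ← deg_psi τ hn]
  exact Submodule.smul_mem _ _ (eb_mem _)

theorem X_mem (hn : 0 < n) (k : ℕ) {d : ℕ} {v : Mod n mu} (hv : v ∈ modDeg n mu d) :
    (psytData n mu).X k v ∈ modDeg n mu (d + 1) := by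
  unfold HeckeData.X
  generalize n - 1 - k = j
  induction j generalizing v with
  | zero => exact opA_mem hn (pi_mem hv)
  | succ j ih => exact Submodule.smul_mem _ _ (opT_mem (ih (opT_mem hv)))

theorem toMod_mem {d : ℕ} {v : V n mu} (hv : v ∈ degEq n mu d) : toMod n mu v ∈ modDeg n mu d := by
  refine degEq_le (p := fun d => (modDeg n mu d).comap (toMod n mu)) (fun τ => ?_)
    (fun d v k _ h => ?_) d hv
  · rw [Submodule.mem_comap, toMod_vSYT]
    have := eb_mem τ.1
    rwa [deg, Finset.sum_eq_zero fun b _ => τ.2 b] at this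
  · rw [Submodule.mem_comap, toMod_smul, rho_gX]
    exact X_mem (Nat.zero_lt_of_lt k.2) _ h

end Degree

/-! ### Building tableaux by `Ψ` and upward exchanges -/

section Induction

variable {n : ℕ} {mu : YoungDiagram}

theorem rotate_val (i : Fin n) :
    ((finRotate n i : Fin n) : ℕ) = if (i : ℕ) = n - 1 then 0 else (i : ℕ) + 1 := by
  have h1 := rotate_symm_val (finRotate n i)
  have h2 := (finRotate n i).2
  have h3 := i.2
  rw [Equiv.symm_apply_apply] at h1
  generalize ((finRotate n i : Fin n) : ℕ) = j at *
  split_ifs at * <;> omega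

/-- The preimage under `Ψ` of a tableau whose last label has a positive exponent. -/
def PSYT.unpsi (τ : PSYT n mu) (h0 : ∀ b, (τ.idx b : ℕ) = n - 1 → 0 < τ.wt b) : PSYT n mu where
  idx := τ.idx.trans (finRotate n)
  wt b := if (τ.idx b : ℕ) = n - 1 then τ.wt b - 1 else τ.wt b
  row_lt a b h1 h2 := by
    have h := τ.row_lt a b h1 h2
    have ha := (τ.idx a).2
    have hb := (τ.idx b).2
    have p1 := h0 a
    have p2 := h0 b
    simp only [labelLT, Equiv.trans_apply, rotate_val] at h ⊢
    split_ifs <;> omega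
  col_lt a b h1 h2 := by
    have h := τ.col_lt a b h1 h2
    have ha := (τ.idx a).2
    have hb := (τ.idx b).2
    have p1 := h0 a
    have p2 := h0 b
    simp only [labelLT, Equiv.trans_apply, rotate_val] at h ⊢
    split_ifs <;> omega

theorem PSYT.psi_unpsi (τ : PSYT n mu) (h0 : ∀ b, (τ.idx b : ℕ) = n - 1 → 0 < τ.wt b) :
    (τ.unpsi h0).psi = τ := by
  have e1 : ∀ b, ((τ.unpsi h0).idx b : ℕ) =
      if (τ.idx b : ℕ) = n - 1 then 0 else (τ.idx b : ℕ) + 1 := fun b => rotate_val (τ.idx b)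
  have e2 : ∀ b, (τ.unpsi h0).wt b =
      if (τ.idx b : ℕ) = n - 1 then τ.wt b - 1 else τ.wt b := fun b => rfl
  apply ext_idx
  · funext b
    have := h0 b
    rw [psi_wt, e1, e2]
    grind
  · intro b
    rw [psi_idx, e1]
    have := (τ.idx b).2
    grind

/-- Every periodic tableau is obtained from a standard one by applying `Ψ` and making upward
exchanges. -/
theorem PSYT.induction {p : PSYT n mu → Prop} (hstd : ∀ τ : SYT n mu, p τ.1)
    (hpsi : ∀ τ, 0 < n → p τ → p τ.psi)
    (hup : ∀ τ i (h : i + 1 < n), Up τ.wt (τ.lo i h) (τ.hi i h) → p τ → p (τ.sw i h))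
    (σ : PSYT n mu) : p σ := by
  induction hd : σ.deg using Nat.strong_induction_on generalizing σ with
  | _ d ihd =>
    by_cases hz : ∀ b, σ.wt b = 0
    · exact hstd ⟨σ, hz⟩
    push Not at hz
    obtain ⟨b, hb⟩ := hz
    -- A positive exponent at the label `i` is moved to the last label, from where Ψ can be undone,
    -- lowering the degree. If the next exponent is zero, the tableau comes from its exchange by an
    -- upward step and the exchange has the positive exponent one label further; otherwise the next
    -- label serves directly. The distance to the last label is `m`.
    have key : ∀ m (σ : PSYT n mu) (i : Fin n), σ.deg = d → σ.w i ≠ 0 → (i : ℕ) + m = n - 1 →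
        p σ := by
      intro m
      induction m with
      | zero =>
        intro σ i hd hw hi
        have hn : 0 < n := Nat.zero_lt_of_lt i.2
        have h0 : ∀ b, (σ.idx b : ℕ) = n - 1 → 0 < σ.wt b := by
          intro b hb
          have : b = σ.idx.symm i := by
            rw [Equiv.eq_symm_apply]; exact Fin.ext (by omega)
          rw [this]
          exact Nat.pos_of_ne_zero hw
        have hdeg := deg_psi (σ.unpsi h0) hn
        rw [psi_unpsi] at hdeg
        rw [← psi_unpsi σ h0]
        exact hpsi _ hn (ihd _ (by omega) _ rfl)
      | succ m ih =>
        intro σ i hd hw hi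
        have h : (i : ℕ) + 1 < n := by omega
        by_cases hw' : σ.w ⟨i + 1, h⟩ = 0
        · have hr : ¬ Rigid σ.wt (σ.lo i h) (σ.hi i h) := fun hr => by
            have : σ.w i = σ.w ⟨i + 1, h⟩ := hr.1
            omega
          have h1 : p (σ.sw i h) := by
            refine ih _ ⟨i + 1, h⟩ (by rw [deg_sw, hd]) ?_ (by simp only; omega)
            have : (σ.sw i h).w ⟨i + 1, h⟩ = σ.w i := by
              change (σ.sw i h).wt ((σ.sw i h).hi i h) = _
              rw [sw_hi σ hr, sw_wt]; rfl
            omega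
          have h2 := hup (σ.sw i h) i h (by
            rw [sw_wt, sw_lo σ hr, sw_hi σ hr]
            left
            change σ.w ⟨i + 1, h⟩ < σ.w i
            omega) h1
          rwa [sw_sw] at h2
        · exact ih σ ⟨i + 1, h⟩ hd hw' (by simp only; omega)
    refine key (n - 1 - σ.idx b) σ (σ.idx b) hd ?_ ?_
    · rw [w, Equiv.symm_apply_apply]; exact hb
    · have := (σ.idx b).2
      omega

theorem Pr_smul_mem {d m : ℕ} {v : V n mu} (hm : m < n) (hv : v ∈ degEq n mu d) :
    ∃ u ∈ degEq n mu d, toMod n mu u = (psytData n mu).Pr m (toMod n mu v) := by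
  induction m generalizing v with
  | zero => exact ⟨v, hv, rfl⟩
  | succ m ih =>
    obtain ⟨u, hu, e⟩ := ih (by omega) hv
    refine ⟨gT m (by omega) • u, stable_gT _ _ _ _ hu, ?_⟩
    rw [toMod_smul, rho_gT, e]; rfl

theorem exists_toMod_eq (σ : PSYT n mu) : ∃ v ∈ degEq n mu σ.deg, toMod n mu v = eb σ := by
  induction σ using PSYT.induction with
  | hstd τ =>
    refine ⟨vSYT τ, ?_, toMod_vSYT τ⟩
    rw [deg, Finset.sum_eq_zero fun b _ => τ.2 b]
    exact vSYT_mem τ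
  | hpsi τ hn ih =>
    obtain ⟨v, hv, e⟩ := ih
    obtain ⟨u, hu, e'⟩ := Pr_smul_mem (m := n - 1) (by omega) hv
    have h1 := gX_smul_mem hu ⟨n - 1, by omega⟩
    -- The product of the T's cancels the inverses in π. Hence the last variable after that product
    -- is A θ up to a power of t, and on a weight vector this is a nonzero multiple of Ψ(τ).
    have h2 : (psytData n mu).A * (psytData n mu).pi * (psytData n mu).Pr (n - 1) =
        t ^ (n - 1) • (opA * opTh 0) := by
      rw [HeckeData.pi, mul_smul_comm, smul_mul_assoc, mul_assoc, mul_assoc, HeckeData.Q_mul_Pr,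
        mul_one]
      rfl
    have h3 := LinearMap.congr_fun h2 (eb τ)
    rw [LinearMap.smul_apply, Module.End.mul_apply opA, opTh_eb, map_smul,
      opA_eb hn, smul_smul, smul_smul] at h3
    have hc : t ^ (n - 1) * xw τ 0 * (q ^ τ.w ⟨0, hn⟩)⁻¹ ≠ 0 :=
      mul_ne_zero (mul_ne_zero (pow_ne_zero _ t_ne_zero) (xw_ne_zero τ hn))
        (inv_ne_zero (pow_ne_zero _ q_ne_zero))
    refine ⟨(t ^ (n - 1) * xw τ 0 * (q ^ τ.w ⟨0, hn⟩)⁻¹)⁻¹ •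
      gX (n := n) (n - 1) (Nat.sub_lt hn Nat.one_pos) • u, ?_, ?_⟩
    · rw [deg_psi τ hn]; exact Submodule.smul_mem _ _ h1
    · rw [map_smul, toMod_smul, rho_gX, HeckeData.X_last, e', e, ← Module.End.mul_apply, h3,
        inv_smul_smul₀ hc]
  | hup τ i h hu ih =>
    obtain ⟨v, hv, e⟩ := ih
    refine ⟨gT i h • v - gC (xw τ i) (xw τ (i + 1)) • v, ?_, ?_⟩
    · rw [deg_sw]
      exact Submodule.sub_mem _ (stable_gT _ _ _ _ hv) (Submodule.smul_mem _ _ hv)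
    · rw [map_sub, toMod_smul, map_smul, rho_gT, e, opT_eb_up hu, add_sub_cancel_left]

end Induction

end VVMac

namespace VVMac

open PSYT

/-! ### The induced module is the module of periodic tableaux -/

section Iso

variable {n : ℕ} {mu : YoungDiagram}

/-- The permutation that lists the labels `j q^(α_j)` in increasing order. -/
noncomputable def labelSort (α : Fin n → ℕ) : Equiv.Perm (Fin n) :=
  -- Since j < n, this key compares exponents first, a larger exponent giving a smaller key, and
  -- breaks ties by j.
  Tuple.sort fun j : Fin n => (j : ℤ) - n * α j

theorem labelSort_lt (α : Fin n → ℕ) {i j : Fin n} (h : i < j) :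
    labelLT ((labelSort α i : ℕ), α (labelSort α i)) ((labelSort α j : ℕ), α (labelSort α j)) := by
  have h1 := Tuple.monotone_sort (fun j : Fin n => (j : ℤ) - n * α j) h.le
  have h2 : labelSort α i ≠ labelSort α j := fun e => h.ne ((labelSort α).injective e)
  change ((labelSort α i : ℕ) : ℤ) - n * α (labelSort α i) ≤
    ((labelSort α j : ℕ) : ℤ) - n * α (labelSort α j) at h1
  have b1 := (labelSort α i).2
  have b2 := (labelSort α j).2
  generalize labelSort α i = x at *
  generalize labelSort α j = y at *
  have h3 : (x : ℕ) ≠ y := fun e => h2 (Fin.ext e)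
  unfold labelLT
  simp only
  by_contra hcon
  rcases lt_trichotomy (α x) (α y) with h | h | h
  · have h4 : (α x : ℤ) + 1 ≤ α y := by exact_mod_cast h
    have : (n : ℤ) * (α x + 1) ≤ n * α y := mul_le_mul_of_nonneg_left h4 (by positivity)
    rw [mul_add, mul_one] at this
    omega
  · rw [h] at h1
    omega
  · omega

/-- The periodic tableau with exponents `α` and standardization `ρ`. -/
noncomputable def ofStandard (p : (Fin n → ℕ) × SYT n mu) : PSYT n mu where
  idx := p.2.1.idx.trans (labelSort p.1)
  wt b := p.1 (labelSort p.1 (p.2.1.idx b))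
  row_lt a b h1 h2 := by
    have := p.2.1.row_lt a b h1 h2
    rw [labelLT, p.2.2, p.2.2] at this
    exact labelSort_lt p.1 (Fin.lt_def.2 (by omega))
  col_lt a b h1 h2 := by
    have := p.2.1.col_lt a b h1 h2
    rw [labelLT, p.2.2, p.2.2] at this
    exact labelSort_lt p.1 (Fin.lt_def.2 (by omega))

theorem ofStandard_w (p : (Fin n → ℕ) × SYT n mu) (i : Fin n) : (ofStandard p).w i = p.1 i := by
  simp [w, ofStandard]

theorem ofStandard_injective : Function.Injective (ofStandard (n := n) (mu := mu)) := by
  rintro ⟨α, ρ⟩ ⟨β, σ⟩ h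
  obtain rfl : α = β := funext fun i => by
    have h1 := ofStandard_w (α, ρ) i
    rw [h, ofStandard_w] at h1
    exact h1.symm
  have h1 : ∀ b, ρ.1.idx b = σ.1.idx b := fun b => by
    have := congrArg (fun τ : PSYT n mu => τ.idx b) h
    exact (labelSort α).injective this
  have h2 : ρ = σ := Subtype.ext (ext_idx (funext fun b => by rw [ρ.2, σ.2])
    fun b => by rw [h1])
  rw [h2]

theorem ofStandard_deg (p : (Fin n → ℕ) × SYT n mu) : (ofStandard p).deg = ∑ i, p.1 i := by
  rw [deg]
  exact Fintype.sum_equiv (ofStandard p).idx _ _ fun b => by simp [ofStandard]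

theorem finite_deg_le (d : ℕ) : {τ : PSYT n mu | τ.deg ≤ d}.Finite := by
  let f : PSYT n mu → (Box mu ≃ Fin n) × (Box mu → ℕ) := fun τ => (τ.idx, τ.wt)
  have hf : Function.Injective f := fun τ σ h => by
    simp only [f, Prod.mk.injEq] at h
    exact ext_idx h.2 fun b => by rw [h.1]
  refine Set.Finite.of_finite_image (f := f) ?_ hf.injOn
  refine ((Set.finite_univ (α := Box mu ≃ Fin n)).prod
    (Set.Finite.pi' (t := fun _ : Box mu => Set.Iic d) fun _ => Set.finite_Iic d)).subset ?_
  rintro _ ⟨τ, hτ, rfl⟩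
  refine ⟨trivial, fun b => ?_⟩
  exact (Finset.single_le_sum (fun _ _ => Nat.zero_le _) (Finset.mem_univ b)).trans hτ

theorem modDeg_le_supported {d e : ℕ} (h : d ≤ e) :
    modDeg n mu d ≤ Finsupp.supported Kqt Kqt {τ : PSYT n mu | τ.deg ≤ e} := by
  refine Submodule.span_le.2 ?_
  rintro _ ⟨τ, hτ, rfl⟩
  exact Finsupp.single_mem_supported Kqt _ (show τ.deg ≤ e by omega)

/-- The images of the monomials of degree at most `d` span the tableaux of degree at most `d`. -/
theorem span_toMod_monFamily (d : ℕ) :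
    Submodule.span Kqt ((fun p => toMod n mu (monFamily n mu p)) '' {p | ∑ i, p.1 i ≤ d}) =
      Finsupp.supported Kqt Kqt {τ : PSYT n mu | τ.deg ≤ d} := by
  apply le_antisymm
  · refine Submodule.span_le.2 ?_
    rintro _ ⟨⟨α, ρ⟩, hp, rfl⟩
    exact modDeg_le_supported hp (toMod_mem (Submodule.subset_span ⟨α, ρ, rfl, rfl⟩))
  · rw [Finsupp.supported_eq_span_single]
    refine Submodule.span_le.2 ?_
    rintro _ ⟨τ, hτ, rfl⟩
    obtain ⟨v, hv, e⟩ := exists_toMod_eq τ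
    change eb τ ∈ _
    rw [← e]
    suffices h : degEq n mu τ.deg ≤ (Submodule.span Kqt
      ((fun p => toMod n mu (monFamily n mu p)) '' {p | ∑ i, p.1 i ≤ d})).comap (toMod n mu) from
      h hv
    refine Submodule.span_le.2 ?_
    rintro _ ⟨α, ρ, hα, rfl⟩
    exact Submodule.subset_span ⟨(α, ρ), show ∑ i, α i ≤ d by rw [hα]; exact hτ, rfl⟩

/-- In degree at most `d` the images span a space whose dimension is the number of tableaux of that
degree, and `ofStandard` injects the monomials into these tableaux. A spanning family no larger than
the dimension is independent; the degree bound is removed by an increasing union. -/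
theorem linearIndependent_toMod_monFamily :
    LinearIndependent Kqt fun p => toMod n mu (monFamily n mu p) := by
  have hd : ∀ d, LinearIndepOn Kqt (fun p => toMod n mu (monFamily n mu p))
      {p | ∑ i, p.1 i ≤ d} := by
    intro d
    have hfinJ := finite_deg_le (n := n) (mu := mu) d
    have hmaps : Set.MapsTo (ofStandard (n := n) (mu := mu)) {p | ∑ i, p.1 i ≤ d}
        {τ | τ.deg ≤ d} := fun p hp => by
      rw [Set.mem_ofPred_eq, ofStandard_deg]; exact hp
    have hfinI : {p : (Fin n → ℕ) × SYT n mu | ∑ i, p.1 i ≤ d}.Finite :=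
      Set.Finite.of_injOn hmaps ofStandard_injective.injOn hfinJ
    have := hfinI.fintype
    have := hfinJ.fintype
    unfold LinearIndepOn
    rw [linearIndependent_iff_card_le_finrank_span]
    have e : Set.range (fun p : {p : (Fin n → ℕ) × SYT n mu | ∑ i, p.1 i ≤ d} =>
        toMod n mu (monFamily n mu p)) =
        (fun p => toMod n mu (monFamily n mu p)) '' {p | ∑ i, p.1 i ≤ d} := by
      ext x; simp [Set.mem_image]
    rw [Set.finrank, e, span_toMod_monFamily,
      (Finsupp.supportedEquivFinsupp {τ : PSYT n mu | τ.deg ≤ d}).finrank_eq,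
      Module.finrank_finsupp_self]
    exact Fintype.card_le_of_injective (fun p => (⟨ofStandard p.1, hmaps p.2⟩ :
      {τ : PSYT n mu | τ.deg ≤ d})) fun a b h =>
      Subtype.ext (ofStandard_injective (congrArg Subtype.val h))
  rw [← linearIndepOn_univ_iff]
  have hU : (⋃ d : ℕ, {p : (Fin n → ℕ) × SYT n mu | ∑ i, p.1 i ≤ d}) = Set.univ :=
    Set.eq_univ_of_forall fun p => Set.mem_iUnion.2 ⟨_, le_refl (∑ i, p.1 i)⟩
  rw [← hU]
  refine linearIndepOn_iUnion_of_directed (Monotone.directed_le fun d e hde p hp => ?_) hd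
  exact le_trans hp hde

/-- The monomials span the source and have independent images. -/
theorem toMod_injective : Function.Injective (toMod n mu) := by
  rw [← LinearMap.ker_eq_bot, LinearMap.ker_eq_bot']
  intro v hv
  have hmem : v ∈ Submodule.span Kqt (Set.range (monFamily n mu)) := by
    rw [span_monFamily]; trivial
  obtain ⟨c, rfl⟩ := (Finsupp.mem_span_range_iff_exists_finsupp).1 hmem
  rw [Finsupp.sum, map_sum] at hv
  simp only [map_smul] at hv
  have h0 := (linearIndependent_iff.1 linearIndependent_toMod_monFamily) c
    (by rw [Finsupp.linearCombination_apply, Finsupp.sum]; exact hv)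
  rw [h0, Finsupp.sum_zero_index]

theorem toMod_surjective : Function.Surjective (toMod n mu) := by
  rw [← LinearMap.range_eq_top, eq_top_iff]
  intro v _
  induction v using Finsupp.induction_linear with
  | zero => exact Submodule.zero_mem _
  | add f g hf hg => exact Submodule.add_mem _ (hf trivial) (hg trivial)
  | single τ a =>
    obtain ⟨v, -, e⟩ := exists_toMod_eq τ
    refine ⟨a • v, ?_⟩
    rw [map_smul, e, eb, Finsupp.smul_single, smul_eq_mul, mul_one]

/-- The induced module has the periodic tableaux as a basis. -/
noncomputable def modEquiv (n : ℕ) (mu : YoungDiagram) : V n mu ≃ₗ[Kqt] Mod n mu :=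
  LinearEquiv.ofBijective (toMod n mu) ⟨toMod_injective, toMod_surjective⟩

theorem modEquiv_smul (a : Daha n) (v : V n mu) :
    modEquiv n mu (a • v) = rho n mu a (modEquiv n mu v) := toMod_smul a v

theorem modEquiv_symm_rho (a : Daha n) (v : Mod n mu) :
    (modEquiv n mu).symm (rho n mu a v) = a • (modEquiv n mu).symm v := by
  rw [LinearEquiv.symm_apply_eq, modEquiv_smul, LinearEquiv.apply_symm_apply]

theorem modEquiv_vSYT (τ : SYT n mu) : modEquiv n mu (vSYT τ) = eb τ.1 := toMod_vSYT τ

theorem modEquiv_symm_eb_mem (τ : PSYT n mu) : (modEquiv n mu).symm (eb τ) ∈ degEq n mu τ.deg := by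
  obtain ⟨v, hv, e⟩ := exists_toMod_eq τ
  have : (modEquiv n mu).symm (eb τ) = v := by rw [LinearEquiv.symm_apply_eq]; exact e.symm
  rwa [this]

end Iso

/-! ### The non-symmetric Macdonald polynomials -/

section Nonsym

variable {n : ℕ} {mu : YoungDiagram}

/-- The correction term in the Knop–Sahi relation exactly cancels the diagonal part of t T_i⁻¹. -/
theorem opTi_eb_up {τ : PSYT n mu} {i : ℕ} {h : i + 1 < n} (hu : Up τ.wt (τ.lo i h) (τ.hi i h)) :
    t • opTi i (eb τ) + ((t - 1) * xw τ (i + 1) / (xw τ i - xw τ (i + 1))) • eb τ =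
      eb (τ.sw i h) := by
  have hxy := sub_ne_zero.2 (xw_ne_succ τ h)
  rw [opTi, if_pos h, LinearMap.smul_apply, smul_inv_smul₀ t_ne_zero, LinearMap.add_apply,
    Module.algebraMap_end_apply, opT_eb_up hu]
  generalize xw τ i = x at *
  generalize xw τ (i + 1) = y at *
  have e3 : gC x y + (t - 1) + (t - 1) * y / (x - y) = 0 := by
    have : y - x ≠ 0 := by rwa [← neg_sub, neg_ne_zero]
    unfold gC
    field_simp
    ring
  rw [add_right_comm (gC x y • eb τ), add_right_comm, ← add_smul, ← add_smul, e3, zero_smul,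
    zero_add]

theorem pi_mul_Pr :
    (psytData n mu).pi * (psytData n mu).Pr (n - 1) = t ^ (n - 1) • opTh 0 := by
  rw [HeckeData.pi, smul_mul_assoc, mul_assoc, HeckeData.Q_mul_Pr, mul_one]; rfl

/-- Composing π with the reversed product of the T's gives t^{n-1} θ_1, whose eigenvalues are
nonzero. -/
theorem exists_pi_eq (hn : 0 < n) (τ : PSYT n mu) : ∃ v, (psytData n mu).pi v = eb τ := by
  refine ⟨(t ^ (n - 1) * xw τ 0)⁻¹ • (psytData n mu).Pr (n - 1) (eb τ), ?_⟩
  have h := LinearMap.congr_fun (pi_mul_Pr (n := n) (mu := mu)) (eb τ)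
  rw [Module.End.mul_apply, LinearMap.smul_apply, opTh_eb, smul_smul] at h
  rw [map_smul, h, inv_smul_smul₀ (mul_ne_zero (pow_ne_zero _ t_ne_zero) (xw_ne_zero τ hn))]

/-- The basis of `V_μ` indexed by the periodic tableaux. -/
noncomputable def mac (τ : PSYT n mu) : V n mu := (modEquiv n mu).symm (eb τ)

@[simp] theorem modEquiv_mac (τ : PSYT n mu) : modEquiv n mu (mac τ) = eb τ :=
  LinearEquiv.apply_symm_apply _ _

theorem isNonsymMac_mac : IsNonsymMac (mac : PSYT n mu → V n mu) where
  weight τ i := by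
    apply (modEquiv n mu).injective
    rw [modEquiv_smul, map_smul, modEquiv_mac, rho_gTheta, opTh_eb, xw_eq]
  standard τ := by
    apply (modEquiv n mu).injective
    rw [modEquiv_mac, modEquiv_vSYT]
  swap τ σ i h hs := by
    obtain ⟨rfl, hu⟩ := (swapUp_iff _ _).1 hs
    apply (modEquiv n mu).injective
    rw [map_add, modEquiv_smul, map_smul, map_smul, modEquiv_mac, modEquiv_mac, rho_gTinv,
      ← opTi_eb_up hu, ← xw_eq, ← xw_eq]
    rfl
  psi τ h := by
    obtain ⟨v, hv⟩ := exists_pi_eq h τ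
    refine ⟨(modEquiv n mu).symm v, ?_, ?_⟩
    · rw [← modEquiv_symm_rho, rho_gPi, hv]; rfl
    · apply (modEquiv n mu).injective
      rw [map_smul, modEquiv_smul, rho_gX, HeckeData.X_last, LinearEquiv.apply_symm_apply,
        Module.End.mul_apply, hv, modEquiv_mac]
      change _ = q ^ τ.w ⟨0, h⟩ • opA (eb τ)
      rw [opA_eb h, smul_inv_smul₀ (pow_ne_zero _ q_ne_zero)]

/-- Induction over the building steps. In the Ψ step the preimage `v` under π is not prescribed, but
this is harmless: X_n = A π, so X_n v depends only on π v. -/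
theorem IsNonsymMac.eq_mac {F : PSYT n mu → V n mu} (hF : IsNonsymMac F) (σ : PSYT n mu) :
    F σ = mac σ := by
  induction σ using PSYT.induction with
  | hstd τ => rw [hF.standard, isNonsymMac_mac.standard]
  | hpsi τ hn ih =>
    obtain ⟨v, h1, h2⟩ := hF.psi τ hn
    obtain ⟨v', h1', h2'⟩ := isNonsymMac_mac.psi τ hn
    have key : ∀ v : V n mu, gPi hn • v = mac τ →
        modEquiv n mu (gX (n - 1) (Nat.sub_lt hn Nat.one_pos) • v) = opA (eb τ) := by
      intro v hv
      rw [modEquiv_smul, rho_gX, HeckeData.X_last, Module.End.mul_apply, ← rho_gPi hn,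
        ← modEquiv_smul, hv, modEquiv_mac]
      rfl
    rw [h2, h2']
    congr 1
    apply (modEquiv n mu).injective
    rw [key v (h1.trans ih), key v' h1']
  | hup τ i h hu ih =>
    have hs : SwapUp i h τ (τ.sw i h) := (swapUp_iff _ _).2 ⟨rfl, hu⟩
    rw [← hF.swap _ _ i h hs, ← isNonsymMac_mac.swap _ _ i h hs, ih]

theorem nonsymMac_eq (σ : PSYT n mu) : nonsymMac σ = mac σ :=
  (Classical.epsilon_spec (⟨_, isNonsymMac_mac⟩ : ∃ F : PSYT n mu → V n mu, IsNonsymMac F)).eq_mac σ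

end Nonsym

end VVMac

namespace VVMac

open PSYT

/-! ### The symmetrization identity -/

section Symmetrization

variable {F : Type*} [Field F]

open Polynomial in
-- Lagrange interpolation of ∏ (z - t x_i) at the nodes 0 and x_k, comparing leading coefficients.
-- The node 0 contributes t^n, where n is the number of the x_i, and the node x_k contributes (1 -
-- t) times the k-th summand.
theorem sum_prod_sub_mul_div_sub {ι : Type*} [Fintype ι] [DecidableEq ι] {x : ι → F}
    (hx : Function.Injective x) (h0 : ∀ i, x i ≠ 0) (t : F) :
    (1 - t) * ∑ k, ∏ j ∈ Finset.univ.erase k, (x k - t * x j) / (x k - x j) =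
      1 - t ^ Fintype.card ι := by
  classical
  set P : F[X] := Lagrange.nodal Finset.univ fun i => t * x i with hP
  let v : Option ι → F := fun o => o.elim 0 x
  have hv : Function.Injective v := by
    rintro (_ | a) (_ | b) h
    · rfl
    · exact absurd h.symm (h0 b)
    · exact absurd h (h0 a)
    · exact congrArg some (hx h)
  have key := Lagrange.leadingCoeff_eq_sum (s := Finset.univ) (v := v) hv.injOn (P := P)
    (by rw [hP, Lagrange.degree_nodal, Finset.card_univ, Finset.card_univ, Fintype.card_option]; rfl)
  rw [hP, Lagrange.nodal_monic.leadingCoeff, Fintype.sum_option] at key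
  have e0 : P.eval (v none) / ∏ j ∈ Finset.univ.erase none, (v none - v j) =
      t ^ Fintype.card ι := by
    have : (Finset.univ : Finset (Option ι)).erase none = Finset.univ.map Function.Embedding.some := by
      ext (_ | a) <;> simp
    rw [this, Finset.prod_map, hP, Lagrange.eval_nodal, ← Finset.prod_div_distrib]
    simp only [v, Option.elim, Function.Embedding.some_apply, zero_sub]
    rw [Finset.prod_congr rfl fun i _ => show -(t * x i) / -x i = t by
      rw [neg_div_neg_eq, mul_div_cancel_right₀ _ (h0 i)]]
    simp
  have e1 : ∀ k, P.eval (v (some k)) / ∏ j ∈ Finset.univ.erase (some k), (v (some k) - v j) =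
      (1 - t) * ∏ j ∈ Finset.univ.erase k, (x k - t * x j) / (x k - x j) := by
    intro k
    have : (Finset.univ : Finset (Option ι)).erase (some k) =
        insert none ((Finset.univ.erase k).map Function.Embedding.some) := by
      ext (_ | a) <;> simp
    rw [this, Finset.prod_insert (by simp), Finset.prod_map, hP, Lagrange.eval_nodal,
      ← Finset.mul_prod_erase _ _ (Finset.mem_univ k), Finset.prod_div_distrib]
    simp only [v, Option.elim, Function.Embedding.some_apply, sub_zero]
    rw [show x k - t * x k = x k * (1 - t) by ring, mul_assoc, mul_div_mul_left _ _ (h0 k),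
      mul_div_assoc]
  rw [Finset.mul_sum, ← Finset.sum_congr rfl fun k _ => e1 k, eq_sub_iff_add_eq', ← e0]
  exact key.symm

/-- Induction on n, splitting permutations by their first value p: the factors involving p form the
p-th term of the preceding identity, and the remaining factors give the sum for the other variables.
-/
theorem sum_perm_prod (t : F) {n : ℕ} {x : Fin n → F} (hx : Function.Injective x)
    (h0 : ∀ i, x i ≠ 0) :
    (1 - t) ^ n * ∑ w : Equiv.Perm (Fin n), ∏ i, ∏ j ∈ Finset.Ioi i,
      (x (w i) - t * x (w j)) / (x (w i) - x (w j)) = ∏ i ∈ Finset.range n, (1 - t ^ (i + 1)) := by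
  induction n with
  | zero => simp
  | succ n ih =>
    have e1 : ∀ (p : Fin (n + 1)) (f : Fin (n + 1) → F),
        ∏ j : Fin n, f (Equiv.swap 0 p j.succ) = ∏ b ∈ Finset.univ.erase p, f b := by
      intro p f
      have h1 : ∏ j : Fin n, f (Equiv.swap 0 p j.succ) =
          ∏ b ∈ Finset.univ.erase (0 : Fin (n + 1)), f (Equiv.swap 0 p b) := by
        have : (Finset.univ : Finset (Fin (n + 1))).erase 0 =
            Finset.univ.map (Fin.succEmb n) := by
          ext b; refine Fin.cases ?_ ?_ b <;> simp
        rw [this, Finset.prod_map]; rfl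
      rw [h1]
      refine Finset.prod_equiv (Equiv.swap 0 p) (fun b => ?_) fun _ _ => rfl
      simp only [Finset.mem_erase, Finset.mem_univ, and_true, ne_eq]
      have := (Equiv.swap 0 p).apply_eq_iff_eq (x := b) (y := 0)
      rw [Equiv.swap_apply_left] at this
      rw [this]
    have e2 : ∀ p : Fin (n + 1), (1 - t) ^ n * ∑ e : Equiv.Perm (Fin n),
        ∏ i, ∏ j ∈ Finset.Ioi i,
          (x (Equiv.Perm.decomposeFin.symm (p, e) i) -
              t * x (Equiv.Perm.decomposeFin.symm (p, e) j)) /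
            (x (Equiv.Perm.decomposeFin.symm (p, e) i) -
              x (Equiv.Perm.decomposeFin.symm (p, e) j)) =
        (∏ b ∈ Finset.univ.erase p, (x p - t * x b) / (x p - x b)) *
          ∏ i ∈ Finset.range n, (1 - t ^ (i + 1)) := by
      intro p
      rw [← ih (x := fun j => x (Equiv.swap 0 p j.succ))
        (hx.comp ((Equiv.injective _).comp (Fin.succ_injective n))) (fun _ => h0 _),
        mul_left_comm]
      congr 1
      rw [Finset.mul_sum]
      refine Finset.sum_congr rfl fun e _ => ?_
      rw [Fin.prod_univ_succ, Fin.prod_Ioi_zero]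
      simp only [Equiv.Perm.decomposeFin_symm_apply_zero,
        Equiv.Perm.decomposeFin_symm_apply_succ, Fin.prod_Ioi_succ]
      congr 1
      rw [Equiv.prod_comp e fun j => (x p - t * x (Equiv.swap 0 p j.succ)) /
        (x p - x (Equiv.swap 0 p j.succ)), e1 p fun b => (x p - t * x b) / (x p - x b)]
    rw [← Equiv.sum_comp Equiv.Perm.decomposeFin.symm, Fintype.sum_prod_type, pow_succ, mul_right_comm,
      Finset.mul_sum, Finset.sum_congr rfl fun p _ => e2 p, ← Finset.sum_mul, mul_right_comm,
      mul_comm _ (1 - t), sum_prod_sub_mul_div_sub hx h0, Finset.prod_range_succ, Fintype.card_fin,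
      mul_comm]

theorem sum_equiv_prod {α : Type*} [Fintype α] [DecidableEq α] (t : F) {n : ℕ}
    (hn : Fintype.card α = n) {x : α → F} (hx : Function.Injective x) (h0 : ∀ i, x i ≠ 0) :
    (1 - t) ^ n * ∑ e : α ≃ Fin n, ∏ a, ∏ b,
      (if e a < e b then (x a - t * x b) / (x a - x b) else 1) =
        ∏ i ∈ Finset.range n, (1 - t ^ (i + 1)) := by
  have e0 : α ≃ Fin n := Fintype.equivFinOfCardEq hn
  rw [← sum_perm_prod t (hx.comp e0.symm.injective) fun i => h0 _]
  congr 1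
  -- Numberings become permutations after comparison with one fixed numbering `e0`.
  let Q : (α ≃ Fin n) ≃ Equiv.Perm (Fin n) :=
    { toFun := fun e => e.symm.trans e0
      invFun := fun w => e0.trans w.symm
      left_inv := fun e => by ext; simp
      right_inv := fun e => by ext; simp }
  rw [← Equiv.sum_comp Q]
  refine Finset.sum_congr rfl fun e _ => ?_
  rw [← Equiv.prod_comp e.symm]
  refine Finset.prod_congr rfl fun i _ => ?_
  rw [← Equiv.prod_comp e.symm, ← Finset.prod_filter]
  refine Finset.prod_congr (by ext; simp) fun j _ => ?_
  simp [Q]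

end Symmetrization

/-! ### The two orders of the boxes -/

namespace PSYT

variable {n : ℕ} {mu : YoungDiagram}

/-- The order of the boxes by decreasing exponents, then by columns. -/
def Before (T : Box mu → ℕ) (a b : Box mu) : Prop :=
  T b < T a ∨ (T a = T b ∧ colBefore a b)

theorem Before.trans {T : Box mu → ℕ} {a b c : Box mu} (h1 : Before T a b) (h2 : Before T b c) :
    Before T a c := by
  unfold Before colBefore at *; omega

theorem Before.asymm {T : Box mu → ℕ} {a b : Box mu} (h1 : Before T a b) : ¬ Before T b a := by
  unfold Before colBefore at *; omega

theorem before_or {a b : Box mu} (T : Box mu → ℕ) (h : a ≠ b) : Before T a b ∨ Before T b a := by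
  have : ¬ (a.1.1 = b.1.1 ∧ a.1.2 = b.1.2) := fun h' => h (box_ext h'.1 h'.2)
  unfold Before colBefore; omega

theorem mem_inv {τ : PSYT n mu} {p : Box mu × Box mu} :
    p ∈ τ.inv ↔ Before τ.wt p.1 p.2 ∧ τ.idx p.2 < τ.idx p.1 := by
  simp [inv, Before]

/-- With equal exponents, a content gap larger than one puts the box of the label i strictly
north-east of the other, hence in a later column. Upward steps are thus the exchanges of adjacent
inversions. -/
theorem before_of_up (τ : PSYT n mu) {i : ℕ} {h : i + 1 < n}
    (hu : Up τ.wt (τ.lo i h) (τ.hi i h)) : Before τ.wt (τ.hi i h) (τ.lo i h) := by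
  rcases hu with hu | ⟨hu, hc⟩
  · exact Or.inl hu
  · refine Or.inr ⟨hu.symm, Or.inl ?_⟩
    by_contra hcon
    have := τ.adjacent_of_le (τ.idx_hi_lo i h) hu (by unfold content at hc; omega) (by omega)
    unfold content at hc
    omega

theorem before_of_rigid (τ : PSYT n mu) {i : ℕ} {h : i + 1 < n}
    (hr : Rigid τ.wt (τ.lo i h) (τ.hi i h)) : Before τ.wt (τ.lo i h) (τ.hi i h) := by
  refine Or.inr ⟨hr.1, ?_⟩
  have := hr.content_eq τ (τ.idx_hi_lo i h)
  unfold content at this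
  unfold colBefore
  omega

theorem up_of_before (τ : PSYT n mu) {i : ℕ} {h : i + 1 < n}
    (hb : Before τ.wt (τ.hi i h) (τ.lo i h)) : Up τ.wt (τ.lo i h) (τ.hi i h) := by
  by_cases hr : Rigid τ.wt (τ.lo i h) (τ.hi i h)
  · exact absurd hb (τ.before_of_rigid hr).asymm
  · refine (τ.up_or_up (τ.idx_hi_lo i h) hr).resolve_right fun hu => ?_
    have h1 := before_of_up (τ.sw i h) (i := i) (h := h)
    rw [sw_lo τ hr, sw_hi τ hr, sw_wt] at h1
    exact (h1 hu).asymm hb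

open Classical in
-- The exchange changes the relative order of one pair only, so an upward step removes exactly one
-- inversion and fixes the rest. This drives all recursions for products over inversions.
theorem inv_of_up (τ : PSYT n mu) {i : ℕ} {h : i + 1 < n}
    (hu : Up τ.wt (τ.lo i h) (τ.hi i h)) :
    (τ.hi i h, τ.lo i h) ∉ (τ.sw i h).inv ∧
      τ.inv = insert (τ.hi i h, τ.lo i h) (τ.sw i h).inv := by
  have hr := τ.not_rigid_of_up hu
  have hb := τ.before_of_up hu
  have e : ∀ b, ((τ.sw i h).idx b : ℕ) =
      if (τ.idx b : ℕ) = i then i + 1 else if (τ.idx b : ℕ) = i + 1 then i else τ.idx b := by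
    intro b
    rw [sw_idx τ hr, Equiv.trans_apply, swap_val]
  have l1 := τ.idx_lo i h
  have l2 := τ.idx_hi i h
  refine ⟨fun hm => ?_, ?_⟩
  · rw [mem_inv] at hm
    have := Fin.lt_def.1 hm.2
    simp only [e, l1, l2] at this
    grind
  · ext ⟨a, b⟩
    rw [Finset.mem_insert, mem_inv, mem_inv, sw_wt, Fin.lt_def, Fin.lt_def]
    simp only [e, Prod.mk.injEq]
    have ka : (τ.idx a : ℕ) = i ↔ a = τ.lo i h := ⟨fun h => τ.eq_lo h, fun h => h ▸ l1⟩
    have kb : (τ.idx b : ℕ) = i ↔ b = τ.lo i h := ⟨fun h => τ.eq_lo h, fun h => h ▸ l1⟩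
    have ka' : (τ.idx a : ℕ) = i + 1 ↔ a = τ.hi i h := ⟨fun h => τ.eq_hi h, fun h => h ▸ l2⟩
    have kb' : (τ.idx b : ℕ) = i + 1 ↔ b = τ.hi i h := ⟨fun h => τ.eq_hi h, fun h => h ▸ l2⟩
    rw [← ka', ← kb]
    have : (τ.idx b : ℕ) = i + 1 → (τ.idx a : ℕ) = i → ¬ Before τ.wt a b := by
      intro h1 h2
      rw [ka.1 h2, kb'.1 h1]
      exact hb.asymm
    have h3 : (τ.idx a : ℕ) = i + 1 → (τ.idx b : ℕ) = i → Before τ.wt a b := by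
      intro h1 h2
      rw [ka'.1 h1, kb.1 h2]
      exact hb
    grind

/-- A transitive relation that holds for the boxes of consecutive labels follows the labels. -/
theorem rel_of_consecutive (τ : PSYT n mu) {R : Box mu → Box mu → Prop}
    (ht : ∀ a b c, R a b → R b c → R a c)
    (hR : ∀ (i : ℕ) (h : i + 1 < n), R (τ.lo i h) (τ.hi i h)) {a b : Box mu}
    (hab : τ.idx a < τ.idx b) : R a b := by
  have key : ∀ (d i : ℕ) (h : i + d + 1 < n),
      R (τ.idx.symm ⟨i, by omega⟩) (τ.idx.symm ⟨i + d + 1, h⟩) := by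
    intro d i
    induction d with
    | zero => intro h; exact hR i h
    | succ d ih => intro h; exact ht _ _ _ (ih (by omega)) (hR (i + d + 1) h)
  have h1 := (τ.idx b).2
  have hab' := Fin.lt_def.1 hab
  have := key ((τ.idx b : ℕ) - τ.idx a - 1) (τ.idx a) (by omega)
  have e : (⟨(τ.idx a : ℕ) + ((τ.idx b : ℕ) - τ.idx a - 1) + 1, by omega⟩ : Fin n) = τ.idx b :=
    Fin.ext (by simp only; omega)
  rw [e] at this
  simpa using this

/-- Tableaux with the same exponents and the same order of labels agree. -/
theorem eq_of_lt_imp {τ σ : PSYT n mu} (hw : τ.wt = σ.wt)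
    (h : ∀ a b, τ.idx a < τ.idx b → σ.idx a < σ.idx b) : τ = σ := by
  have hm : StrictMono (τ.idx.symm.trans σ.idx) := fun i j hij => by
    apply h; simpa using hij
  -- The comparison of the two numberings is an order automorphism of a finite chain, hence the
  -- identity.
  have e : (hm.orderIsoOfSurjective _ (Equiv.surjective _) : Fin n ≃o Fin n) = OrderIso.refl _ :=
    Subsingleton.elim _ _
  refine ext_idx hw fun b => ?_
  have := congrArg (fun f : Fin n ≃o Fin n => f (τ.idx b)) e
  simp at this
  rw [this]

theorem eq_of_inv_eq_empty {τ σ : PSYT n mu} (hw : τ.wt = σ.wt) (hτ : τ.inv = ∅) (hσ : σ.inv = ∅) :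
    τ = σ := by
  refine eq_of_lt_imp hw fun a b hab => ?_
  have hne : a ≠ b := by rintro rfl; exact lt_irrefl _ hab
  have h1 : Before τ.wt a b := (before_or _ hne).resolve_right fun hb => by
    have : (b, a) ∈ τ.inv := mem_inv.2 ⟨hb, hab⟩
    simp [hτ] at this
  by_contra hcon
  have : (a, b) ∈ σ.inv := mem_inv.2 ⟨hw ▸ h1,
    lt_of_le_of_ne (not_lt.1 hcon) fun e => hne (σ.idx.injective e).symm⟩
  simp [hσ] at this

/-- If no consecutive pair could be exchanged upwards, consecutive labels would follow the box
order, and by transitivity all labels would. -/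
theorem exists_up_of_inv_ne {τ : PSYT n mu} (h : τ.inv ≠ ∅) :
    ∃ (i : ℕ) (h : i + 1 < n), Up τ.wt (τ.lo i h) (τ.hi i h) := by
  by_contra! hcon
  obtain ⟨p, hp⟩ := Finset.nonempty_iff_ne_empty.2 h
  rw [mem_inv] at hp
  refine (τ.rel_of_consecutive (R := Before τ.wt) (fun _ _ _ => Before.trans) (fun i h => ?_)
    hp.2).asymm hp.1
  refine (before_or _ fun e => ?_).resolve_right fun hb => hcon i h (τ.up_of_before hb)
  have := τ.idx_hi_lo i h
  rw [e] at this
  omega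

theorem card_inv_of_up {τ : PSYT n mu} {i : ℕ} {h : i + 1 < n}
    (hu : Up τ.wt (τ.lo i h) (τ.hi i h)) : τ.inv.card = (τ.sw i h).inv.card + 1 := by
  classical
  rw [(τ.inv_of_up hu).2, Finset.card_insert_of_notMem (τ.inv_of_up hu).1]

theorem LE.of_up {τ : PSYT n mu} {i : ℕ} {h : i + 1 < n}
    (hu : Up τ.wt (τ.lo i h) (τ.hi i h)) : LE τ (τ.sw i h) :=
  Relation.ReflTransGen.single (Or.inr ⟨i, h, (swapUp_iff _ _).2 ⟨rfl, hu⟩⟩)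

/-- Along the order the degree increases, and where it does not, the inversions decrease. -/
theorem LE.eq_or {τ σ : PSYT n mu} (hle : LE τ σ) :
    τ = σ ∨ τ.deg < σ.deg ∨ (τ.deg = σ.deg ∧ σ.inv.card < τ.inv.card) := by
  induction hle with
  | refl => exact Or.inl rfl
  | @tail σ ρ _ hc ih =>
    have h2 : σ = ρ ∨ σ.deg < ρ.deg ∨ (σ.deg = ρ.deg ∧ ρ.inv.card < σ.inv.card) := by
      rcases hc with rfl | ⟨i, h, hs⟩
      · rcases Nat.eq_zero_or_pos n with rfl | hn
        · left
          exact ext_idx (funext fun b => (σ.idx b).elim0) fun b => (σ.idx b).elim0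
        · right; left; rw [deg_psi σ hn]; omega
      · obtain ⟨rfl, hu⟩ := (swapUp_iff _ _).1 hs
        right; right
        rw [deg_sw, card_inv_of_up hu]
        exact ⟨rfl, Nat.lt_succ_self _⟩
    rcases ih with rfl | ih
    · exact h2
    · rcases h2 with rfl | h2
      · exact Or.inr ih
      · right; omega

theorem LE.antisymm {τ σ : PSYT n mu} (h1 : LE τ σ) (h2 : LE σ τ) : τ = σ := by
  rcases h1.eq_or with h | h
  · exact h
  · rcases h2.eq_or with h' | h'
    · exact h'.symm
    · omega

theorem exists_le_inv_eq_empty (τ : PSYT n mu) : ∃ σ, σ.wt = τ.wt ∧ LE τ σ ∧ σ.inv = ∅ := by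
  induction hm : τ.inv.card using Nat.strong_induction_on generalizing τ with
  | _ m ih =>
    by_cases h : τ.inv = ∅
    · exact ⟨τ, rfl, Relation.ReflTransGen.refl, h⟩
    · obtain ⟨i, hi, hu⟩ := exists_up_of_inv_ne h
      obtain ⟨σ, h1, h2, h3⟩ := ih _ (by rw [← hm, card_inv_of_up hu]; omega) (τ.sw i hi) rfl
      exact ⟨σ, h1.trans (τ.sw_wt i hi), (LE.of_up hu).trans h2, h3⟩

/-- Climbing removes inversions until none is left, and a tableau without inversions is determined
by its exponents; antisymmetry of the order identifies it with the maximum. -/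
theorem isTop_iff {T : Box mu → ℕ} {τ : PSYT n mu} : IsTop T τ ↔ τ.wt = T ∧ τ.inv = ∅ := by
  constructor
  · rintro ⟨rfl, h⟩
    obtain ⟨σ, h1, h2, h3⟩ := τ.exists_le_inv_eq_empty
    rw [h2.antisymm (h σ h1)]
    exact ⟨rfl, h3⟩
  · rintro ⟨rfl, h⟩
    refine ⟨rfl, fun σ hσ => ?_⟩
    obtain ⟨ρ, h1, h2, h3⟩ := σ.exists_le_inv_eq_empty
    rwa [← eq_of_inv_eq_empty (h1.trans hσ) h3 h]

end PSYT

end VVMac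

namespace VVMac

open PSYT

/-! ### Hecke invariant vectors -/

section Invariants

variable {n : ℕ} {mu : YoungDiagram}

/-- The coefficient of `F_τ` in a symmetric Macdonald polynomial. -/
noncomputable def kap (τ : PSYT n mu) : Kqt :=
  ∏ p ∈ τ.inv, (t * boxWeight τ.wt p.1 - boxWeight τ.wt p.2) /
    (boxWeight τ.wt p.1 - boxWeight τ.wt p.2)

theorem kap_of_up {τ : PSYT n mu} {i : ℕ} {h : i + 1 < n}
    (hu : Up τ.wt (τ.lo i h) (τ.hi i h)) :
    kap τ = (t * xw τ (i + 1) - xw τ i) / (xw τ (i + 1) - xw τ i) * kap (τ.sw i h) := by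
  classical
  rw [kap, (τ.inv_of_up hu).2, Finset.prod_insert (τ.inv_of_up hu).1, xw_lo τ i h, xw_hi τ i h, kap,
    sw_wt]

theorem kap_of_inv_eq_empty {τ : PSYT n mu} (h : τ.inv = ∅) : kap τ = 1 := by
  rw [kap, h, Finset.prod_empty]

theorem eb_apply_self (τ : PSYT n mu) : eb τ τ = 1 := Finsupp.single_eq_same

theorem eb_apply_of_ne {τ σ : PSYT n mu} (h : τ ≠ σ) : eb τ σ = 0 :=
  Finsupp.single_eq_of_ne h.symm

/-- The transposed matrix of T_i: the coefficient at τ is fed by τ and by s_i(τ), so the roles of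
the two boxes are interchanged. -/
theorem opT_coeff {i : ℕ} (h : i + 1 < n) (v : Mod n mu) (τ : PSYT n mu) :
    opT i v τ = gC (xw τ i) (xw τ (i + 1)) * v τ +
      bC τ.wt (τ.hi i h) (τ.lo i h) * v (τ.sw i h) := by
  induction v using Finsupp.induction_linear with
  | zero => simp
  | add f g hf hg =>
    rw [map_add, Finsupp.add_apply, Finsupp.add_apply, Finsupp.add_apply, hf, hg]; ring
  | single σ c =>
    have e : Finsupp.single σ c = c • eb σ := by rw [eb, Finsupp.smul_single, smul_eq_mul, mul_one]
    rw [e, map_smul, opT_eb h, opR_eb i h]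
    simp only [Finsupp.smul_apply, Finsupp.add_apply, smul_eq_mul]
    have h2 : bC σ.wt (σ.lo i h) (σ.hi i h) * eb (σ.sw i h) τ =
        bC τ.wt (τ.hi i h) (τ.lo i h) * eb σ (τ.sw i h) := by
      by_cases hs : σ.sw i h = τ
      · have hs' : σ = τ.sw i h := by rw [← hs, sw_sw]
        subst hs
        rw [sw_sw, eb_apply_self, eb_apply_self, sw_wt]
        by_cases hr : Rigid σ.wt (σ.lo i h) (σ.hi i h)
        · rw [sw_of_rigid σ hr, bC_of_rigid hr, bC_of_rigid hr.symm]
        · rw [sw_lo σ hr, sw_hi σ hr]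
      · rw [eb_apply_of_ne hs, eb_apply_of_ne fun hs' => hs (by rw [hs', sw_sw]), mul_zero,
          mul_zero]
    rw [h2]
    by_cases hs : σ = τ
    · subst hs; ring
    · rw [eb_apply_of_ne hs]; ring

/-- Vectors fixed by the Hecke algebra. -/
def HeckeFixed (v : Mod n mu) : Prop := ∀ i, i + 1 < n → opT i v = v

theorem xw_hi_ne_t_mul {τ : PSYT n mu} {i : ℕ} {h : i + 1 < n}
    (hr : ¬ Rigid τ.wt (τ.lo i h) (τ.hi i h)) :
    xw τ (i + 1) - t * xw τ i ≠ 0 ∧ xw τ i - t * xw τ (i + 1) ≠ 0 := by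
  rw [xw_lo τ i h, xw_hi τ i h, sub_ne_zero, sub_ne_zero]
  exact (τ.boxWeight_ne_t_mul (τ.idx_hi_lo i h) hr).symm

theorem gC_of_row {τ : PSYT n mu} {i : ℕ} {h : i + 1 < n}
    (hr : Rigid τ.wt (τ.lo i h) (τ.hi i h)) (hrow : (τ.lo i h).1.1 = (τ.hi i h).1.1) :
    gC (xw τ i) (xw τ (i + 1)) = 1 := by
  have hc : content (τ.hi i h) = content (τ.lo i h) + 1 := by
    have := hr.content_eq τ (τ.idx_hi_lo i h)
    unfold content at *; omega
  have h0 := xw_ne_zero τ (Nat.lt_of_succ_lt h)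
  have e := boxWeight_of_content_eq hr.1.symm hc
  rw [← xw_lo τ i h, ← xw_hi τ i h] at e
  rw [gC, e, ← sub_one_mul, div_self (mul_ne_zero t_sub_one_ne_zero h0)]

theorem gC_of_col {τ : PSYT n mu} {i : ℕ} {h : i + 1 < n}
    (hr : Rigid τ.wt (τ.lo i h) (τ.hi i h)) (hcol : (τ.lo i h).1.2 = (τ.hi i h).1.2) :
    gC (xw τ i) (xw τ (i + 1)) = -t := by
  have hc : content (τ.lo i h) = content (τ.hi i h) + 1 := by
    have := hr.content_eq τ (τ.idx_hi_lo i h)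
    unfold content at *; omega
  have h0 := xw_ne_zero τ h
  have e := boxWeight_of_content_eq hr.1 hc
  rw [← xw_lo τ i h, ← xw_hi τ i h] at e
  have h1 := one_sub_t_ne_zero
  rw [gC, e, ← one_sub_mul, div_eq_iff (mul_ne_zero h1 h0)]
  ring

/-- The two equations differ by the factor -(y - t x)/(y - x), which is nonzero. -/
theorem up_coeff_iff {x y v u : Kqt} (hxy : y - x ≠ 0) (hr : y - t * x ≠ 0) :
    gC x y * v + cC y x * u = v ↔ v = (t * y - x) / (y - x) * u := by
  have e1 : gC x y * v + cC y x * u - v =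
      -((y - t * x) / (y - x)) * (v - (t * y - x) / (y - x) * u) := by
    unfold gC cC; field_simp; ring
  rw [← sub_eq_zero, e1, ← sub_eq_zero (b := _ * u), mul_eq_zero,
    or_iff_right (neg_ne_zero.2 (div_ne_zero hr hxy))]

theorem HeckeFixed.apply_of_up {v : Mod n mu} (hv : HeckeFixed v) {τ : PSYT n mu} {i : ℕ}
    {h : i + 1 < n} (hu : Up τ.wt (τ.lo i h) (τ.hi i h)) :
    v τ = (t * xw τ (i + 1) - xw τ i) / (xw τ (i + 1) - xw τ i) * v (τ.sw i h) := by
  have hr := τ.not_rigid_of_up hu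
  have e := opT_coeff h v τ
  rw [hv i h, bC_of_down (fun h' => hr h'.symm) hu, ← xw_lo τ i h, ← xw_hi τ i h] at e
  exact (up_coeff_iff (sub_ne_zero.2 (xw_ne_succ τ h).symm) (xw_hi_ne_t_mul hr).1).1 e.symm

/-- Here T_i multiplies the coefficient by -t, and t + 1 is nonzero. -/
theorem HeckeFixed.apply_of_col {v : Mod n mu} (hv : HeckeFixed v) {τ : PSYT n mu} {i : ℕ}
    {h : i + 1 < n} (hr : Rigid τ.wt (τ.lo i h) (τ.hi i h))
    (hcol : (τ.lo i h).1.2 = (τ.hi i h).1.2) : v τ = 0 := by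
  have e := opT_coeff h v τ
  rw [hv i h, bC_of_rigid hr.symm, zero_mul, add_zero, gC_of_col hr hcol] at e
  have : (t + 1) * v τ = 0 := by linear_combination e
  exact (mul_eq_zero.1 this).resolve_left t_add_one_ne_zero

theorem heckeFixed_of {v : Mod n mu}
    (h1 : ∀ (τ : PSYT n mu) (i : ℕ) (h : i + 1 < n), Up τ.wt (τ.lo i h) (τ.hi i h) →
      v τ = (t * xw τ (i + 1) - xw τ i) / (xw τ (i + 1) - xw τ i) * v (τ.sw i h))
    (h2 : ∀ (τ : PSYT n mu) (i : ℕ) (h : i + 1 < n), Rigid τ.wt (τ.lo i h) (τ.hi i h) →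
      (τ.lo i h).1.2 = (τ.hi i h).1.2 → v τ = 0) : HeckeFixed v := by
  intro i h
  ext τ
  rw [opT_coeff h]
  have hxy := sub_ne_zero.2 (xw_ne_succ τ h)
  have hyx := sub_ne_zero.2 (xw_ne_succ τ h).symm
  by_cases hr : Rigid τ.wt (τ.lo i h) (τ.hi i h)
  · rw [bC_of_rigid hr.symm, zero_mul, add_zero]
    rcases hr.2 with h' | h'
    · rw [gC_of_row hr h', one_mul]
    · rw [h2 τ i h hr h', mul_zero]
  · have hr' : ¬ Rigid τ.wt (τ.hi i h) (τ.lo i h) := fun h' => hr h'.symm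
    rcases τ.up_or_up (τ.idx_hi_lo i h) hr with hu | hu
    · rw [bC_of_down hr' hu, ← xw_lo τ i h, ← xw_hi τ i h]
      exact (up_coeff_iff hyx (xw_hi_ne_t_mul hr).1).2 (h1 τ i h hu)
    · rw [bC_of_up hr' hu]
      -- A downward exchange for τ is an upward one for s_i(τ), so the hypothesis at s_i(τ) gives
      -- the condition at τ.
      have hu' : Up (τ.sw i h).wt ((τ.sw i h).lo i h) ((τ.sw i h).hi i h) := by
        rwa [sw_wt, sw_lo τ hr, sw_hi τ hr]
      have e := h1 _ i h hu'
      rw [sw_sw, xw_sw τ hr, xw_sw τ hr, Equiv.swap_apply_left, Equiv.swap_apply_right] at e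
      have e2 : (t * xw τ i - xw τ (i + 1)) / (xw τ i - xw τ (i + 1)) * v τ =
          (1 - gC (xw τ i) (xw τ (i + 1))) * v τ := by
        unfold gC
        congr 1
        generalize xw τ i = x at *
        generalize xw τ (i + 1) = y at *
        field_simp
        ring
      rw [e, e2]
      ring

/-- Climbing from τ to the top tableau multiplies the coefficient at each step by the factor of the
inversion removed. -/
theorem HeckeFixed.apply_eq {v : Mod n mu} (hv : HeckeFixed v) {τ σ : PSYT n mu}
    (hσ : IsTop τ.wt σ) : v τ = kap τ * v σ := by
  rw [isTop_iff] at hσ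
  induction hm : τ.inv.card using Nat.strong_induction_on generalizing τ with
  | _ m ih =>
    by_cases h : τ.inv = ∅
    · rw [kap_of_inv_eq_empty h, one_mul, eq_of_inv_eq_empty hσ.1 hσ.2 h]
    · obtain ⟨i, hi, hu⟩ := exists_up_of_inv_ne h
      have h1 := ih _ (by rw [← hm, card_inv_of_up hu]; omega) (τ := τ.sw i hi)
        (by rwa [sw_wt]) rfl
      rw [hv.apply_of_up hu, kap_of_up hu, h1, mul_assoc]

theorem PSYT.wt_le (τ : PSYT n mu) {a b : Box mu} (h1 : a.1.1 ≤ b.1.1) (h2 : a.1.2 ≤ b.1.2) :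
    τ.wt b ≤ τ.wt a := by
  by_cases hne : a = b
  · rw [hne]
  · have := τ.labelLT_of_le h1 h2 hne
    simp only [labelLT] at this
    omega

theorem exists_isTop (τ : PSYT n mu) : ∃ σ : PSYT n mu, IsTop τ.wt σ := by
  obtain ⟨σ, h1, -, h3⟩ := τ.exists_le_inv_eq_empty
  exact ⟨σ, isTop_iff.2 ⟨h1, h3⟩⟩

/-- Fixed vectors are supported on tableaux with column strict exponents. -/
theorem HeckeFixed.exists_rssyt {v : Mod n mu} (hv : HeckeFixed v) {τ : PSYT n mu} (h0 : v τ ≠ 0) :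
    ∃ S : RSSYT mu, S.toFun = τ.wt := by
  refine ⟨⟨τ.wt, fun a b h1 h2 => τ.wt_le h1.le h2.le, fun a b h1 h2 => ?_⟩, rfl⟩
  by_contra hcon
  apply h0
  -- Equal exponents at `a` and `b` propagate to the box just below `a`. These vertical neighbours
  -- will carry consecutive labels in the top tableau, whose coefficient then vanishes.
  let a' : Box mu := ⟨(a.1.1 + 1, a.1.2), mu.up_left_mem h2 h1.le b.2⟩
  have hw : τ.wt a' = τ.wt a := by
    have e1 : τ.wt a' ≤ τ.wt a := τ.wt_le (a := a) (b := a') (Nat.le_succ _) le_rfl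
    have e2 : τ.wt b ≤ τ.wt a' := τ.wt_le (a := a') (b := b) h2 h1.le
    omega
  obtain ⟨σ, hσ⟩ := exists_isTop τ
  rw [hv.apply_eq hσ]
  rw [isTop_iff] at hσ
  have hlt : ∀ c d, Before σ.wt c d → σ.idx c < σ.idx d := by
    intro c d hcd
    by_contra hcon
    have hne : c ≠ d := by rintro rfl; exact hcd.asymm hcd
    have : (c, d) ∈ σ.inv := mem_inv.2 ⟨hcd,
      lt_of_le_of_ne (not_lt.1 hcon) fun e => hne (σ.idx.injective e).symm⟩
    simp [hσ.2] at this
  have hb : Before σ.wt a a' := Or.inr ⟨by rw [hσ.1, hw], Or.inr ⟨rfl, Nat.lt_succ_self _⟩⟩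
  -- In the order by exponent and then by columns, no box lies between two vertical neighbours with
  -- equal exponents.
  have hidx : (σ.idx a' : ℕ) = σ.idx a + 1 := by
    have l1 := Fin.lt_def.1 (hlt _ _ hb)
    by_contra hcon
    have l2 := (σ.idx a').2
    set c := σ.idx.symm ⟨σ.idx a + 1, by omega⟩ with hc
    have hci : (σ.idx c : ℕ) = σ.idx a + 1 := by simp [hc]
    have h1 : ¬ Before σ.wt c a := fun h => by have := Fin.lt_def.1 (hlt _ _ h); omega
    have h2 : ¬ Before σ.wt a' c := fun h => by have := Fin.lt_def.1 (hlt _ _ h); omega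
    have hca : c ≠ a := by intro e; rw [e] at hci; omega
    have hca' : c ≠ a' := by intro e; rw [e] at hci; omega
    have h1' := (before_or σ.wt hca).resolve_left h1
    have h2' := (before_or σ.wt hca').resolve_right h2
    rw [hσ.1] at h1' h2'
    simp only [Before, colBefore, hw, a'] at h1' h2'
    have : ¬ (c.1.1 = a.1.1 + 1 ∧ c.1.2 = a.1.2) := fun h => hca' (box_ext h.1 h.2)
    omega
  have h := (σ.idx a').2
  rw [hidx] at h
  have k1 : a = σ.lo (σ.idx a) h := σ.eq_lo rfl
  have k2 : a' = σ.hi (σ.idx a) h := σ.eq_hi hidx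
  rw [hv.apply_of_col (τ := σ) (i := σ.idx a) (h := h), mul_zero]
  · rw [← k1, ← k2]
    exact ⟨by rw [hσ.1, hw], Or.inr rfl⟩
  · rw [← k1, ← k2]

theorem finite_wt (T : Box mu → ℕ) : {τ : PSYT n mu | τ.wt = T}.Finite := by
  refine Set.Finite.of_injOn (f := fun τ : PSYT n mu => τ.idx) (t := Set.univ)
    (fun _ _ => Set.mem_univ _) (fun τ hτ σ hσ h => ?_) Set.finite_univ
  exact PSYT.ext h (hτ.trans hσ.symm)

/-- The symmetric vector with exponents `T`. -/
noncomputable def symVec (n : ℕ) (T : Box mu → ℕ) : Mod n mu :=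
  ∑ σ ∈ (finite_wt (n := n) T).toFinset, kap σ • eb σ

open Classical in
theorem symVec_apply (T : Box mu → ℕ) (τ : PSYT n mu) :
    symVec n T τ = if τ.wt = T then kap τ else 0 := by
  rw [symVec, Finsupp.finsetSum_apply]
  split_ifs with h
  · rw [Finset.sum_eq_single τ]
    · rw [Finsupp.smul_apply, eb_apply_self, smul_eq_mul, mul_one]
    · intro σ _ hne
      rw [Finsupp.smul_apply, eb_apply_of_ne hne, smul_zero]
    · intro hτ
      exact absurd ((finite_wt T).mem_toFinset.2 h) hτ
  · refine Finset.sum_eq_zero fun σ hσ => ?_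
    have h1 : σ.wt = T := (finite_wt T).mem_toFinset.1 hσ
    rw [Finsupp.smul_apply, eb_apply_of_ne fun e : σ = τ => h (e ▸ h1), smul_zero]

theorem RSSYT.not_rigid_col (S : RSSYT mu) {a b : Box mu} (hr : Rigid S.toFun a b)
    (hcol : a.1.2 = b.1.2) : a = b := by
  by_contra hne
  have h1 : a.1.1 ≠ b.1.1 := fun h => hne (box_ext h hcol)
  have h2 := hr.1
  rcases Nat.lt_or_gt_of_ne h1 with h | h
  · have := S.col_strict a b hcol h; omega
  · have := S.col_strict b a hcol.symm h; omega

theorem lo_ne_hi (τ : PSYT n mu) (i : ℕ) (h : i + 1 < n) : τ.lo i h ≠ τ.hi i h := by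
  intro e
  have := τ.idx_hi_lo i h
  rw [e] at this
  omega

/-- The recursion along upward steps is that of `kap`; rigid pairs in a column do not occur, because
the exponents are column strict. -/
theorem heckeFixed_symVec (S : RSSYT mu) : HeckeFixed (symVec n S.toFun) := by
  classical
  apply heckeFixed_of
  · intro τ i h hu
    rw [symVec_apply, symVec_apply, sw_wt, mul_ite, mul_zero, ← kap_of_up hu]
  · intro τ i h hr hcol
    rw [symVec_apply, if_neg]
    intro hw
    rw [hw] at hr
    exact lo_ne_hi τ i h (S.not_rigid_col hr hcol)

/-- An injective key numbers the elements of a finite type. -/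
theorem exists_idx {α β : Type*} [Fintype α] [LinearOrder β] (hn : Fintype.card α = n) {f : α → β}
    (hf : Function.Injective f) : ∃ e : α ≃ Fin n, ∀ a b, e a < e b ↔ f a < f b := by
  let I : LinearOrder α := LinearOrder.lift' f hf
  exact ⟨(Fintype.orderIsoFinOfCardEq α hn).symm.toEquiv,
    fun a b => (Fintype.orderIsoFinOfCardEq α hn).symm.lt_iff_lt⟩

/-- Numbering by decreasing exponents and then column by column is a tableau: along columns the
exponents themselves decrease strictly, and along rows ties are broken to the right. -/
theorem exists_isTop_rssyt (hn : Fintype.card (Box mu) = n) (S : RSSYT mu) :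
    ∃ τ : PSYT n mu, IsTop S.toFun τ := by
  let f : Box mu → ℕᵒᵈ ×ₗ ℕ ×ₗ ℕ := fun b =>
    toLex (OrderDual.toDual (S.toFun b), toLex (b.1.2, b.1.1))
  have hlt : ∀ a b, f a < f b ↔ Before S.toFun a b := by
    intro a b
    simp only [f, Prod.Lex.toLex_lt_toLex, OrderDual.toDual_lt_toDual, OrderDual.toDual_inj]
    rfl
  obtain ⟨e, he⟩ := exists_idx hn (f := f) fun a b h => by
    simp only [f, EmbeddingLike.apply_eq_iff_eq, Prod.mk.injEq] at h
    exact box_ext h.2.2 h.2.1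
  simp only [hlt] at he
  have key : ∀ a b : Box mu, Before S.toFun a b →
      labelLT ((e a : ℕ), S.toFun a) ((e b : ℕ), S.toFun b) := by
    intro a b h
    have h1 := Fin.lt_def.1 ((he a b).2 h)
    unfold Before at h
    unfold labelLT
    simp only
    omega
  let τ : PSYT n mu :=
    { idx := e
      wt := S.toFun
      row_lt := fun a b h1 h2 => key a b (by
        have := S.row_weak a b h1 h2
        unfold Before colBefore
        omega)
      col_lt := fun a b h1 h2 => key a b (Or.inl (S.col_strict a b h1 h2)) }
  refine ⟨τ, isTop_iff.2 ⟨rfl, Finset.eq_empty_of_forall_notMem fun p hp => ?_⟩⟩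
  rw [mem_inv] at hp
  exact ((he _ _).1 hp.2).asymm hp.1

theorem mem_W_iff (P : V n mu) : P ∈ W n mu ↔ HeckeFixed (modEquiv n mu P) := by
  constructor
  · intro h i hi
    rw [← rho_gT i hi, ← modEquiv_smul, h i hi]
  · intro h i hi
    apply (modEquiv n mu).injective
    rw [modEquiv_smul, rho_gT, h i hi]

/-- The prescribed form makes the top coefficient 1 and kills all coefficients with other exponents.
Invariance then determines the remaining ones. -/
theorem IsSymMac.eq {S : RSSYT mu} {P : V n mu} (h : IsSymMac S P) :
    P = (modEquiv n mu).symm (symVec n S.toFun) := by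
  classical
  obtain ⟨h1, τ, hτ, h2⟩ := h
  rw [mem_W_iff] at h1
  rw [LinearEquiv.eq_symm_apply]
  set v := modEquiv n mu P with hv
  have key : ∀ σ : PSYT n mu, (σ.wt = S.toFun → σ = τ) → (v - eb τ) σ = 0 := by
    intro σ hσ
    have h3 : P - mac τ ∈ (LinearMap.ker (Finsupp.lapply σ : Mod n mu →ₗ[Kqt] Kqt)).comap
        (modEquiv n mu).toLinearMap := by
      rw [← nonsymMac_eq]
      refine Submodule.span_le.2 ?_ h2
      rintro _ ⟨y, hy, hne, rfl⟩
      rw [nonsymMac_eq]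
      simp only [SetLike.mem_coe, Submodule.mem_comap, LinearEquiv.coe_coe, modEquiv_mac,
        LinearMap.mem_ker, Finsupp.lapply_apply]
      exact eb_apply_of_ne fun e => hne (e ▸ hσ (e ▸ hy))
    simpa [hv] using h3
  have hτ1 : v τ = 1 := by
    have := key τ fun _ => rfl
    rw [Finsupp.sub_apply, eb_apply_self, sub_eq_zero] at this
    exact this
  ext σ
  rw [symVec_apply]
  split_ifs with hσ
  · rw [h1.apply_eq (τ := σ) (σ := τ) (by rwa [hσ]), hτ1, mul_one]
  · have := key σ fun h => absurd h hσ
    rw [Finsupp.sub_apply, eb_apply_of_ne, sub_zero] at this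
    · exact this
    · rintro rfl
      exact hσ hτ.1

theorem isSymMac_symVec (hn : Fintype.card (Box mu) = n) (S : RSSYT mu) :
    IsSymMac S ((modEquiv n mu).symm (symVec n S.toFun)) := by
  classical
  obtain ⟨τ, hτ⟩ := exists_isTop_rssyt hn S
  refine ⟨?_, τ, hτ, ?_⟩
  · rw [mem_W_iff, LinearEquiv.apply_symm_apply]
    exact heckeFixed_symVec S
  · have hm : τ ∈ (finite_wt (n := n) S.toFun).toFinset := (finite_wt S.toFun).mem_toFinset.2 hτ.1
    rw [nonsymMac_eq, mac, ← map_sub, symVec, ← Finset.add_sum_erase _ _ hm,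
      kap_of_inv_eq_empty (isTop_iff.1 hτ).2, one_smul, add_sub_cancel_left, map_sum]
    refine Submodule.sum_mem _ fun σ hσ => ?_
    rw [Finset.mem_erase, Set.Finite.mem_toFinset] at hσ
    rw [map_smul]
    exact Submodule.smul_mem _ _ (Submodule.subset_span ⟨σ, hσ.2, hσ.1, by rw [nonsymMac_eq, mac]⟩)

theorem symMac_eq (hn : Fintype.card (Box mu) = n) (S : RSSYT mu) :
    symMac n S = (modEquiv n mu).symm (symVec n S.toFun) :=
  (Classical.epsilon_spec (⟨_, isSymMac_symVec hn S⟩ : ∃ P : V n mu, IsSymMac S P)).eq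

/-- The coefficients are the values at the top tableaux; the support condition of
`HeckeFixed.exists_rssyt` ensures that no other exponents occur. -/
theorem HeckeFixed.exists_linearCombination (hn : Fintype.card (Box mu) = n) {v : Mod n mu}
    (hv : HeckeFixed v) : ∃ c : RSSYT mu →₀ Kqt,
      Finsupp.linearCombination Kqt (fun S : RSSYT mu => symVec n S.toFun) c = v := by
  classical
  choose top htop using fun S : RSSYT mu => exists_isTop_rssyt hn S
  have hinj : Function.Injective top := fun S S' h =>
    RSSYT.ext ((htop S).1.symm.trans ((congrArg PSYT.wt h).trans (htop S').1))
  refine ⟨Finsupp.comapDomain top v hinj.injOn, ?_⟩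
  ext τ
  rw [Finsupp.linearCombination_apply, Finsupp.sum, Finsupp.finsetSum_apply]
  simp only [Finsupp.smul_apply, Finsupp.comapDomain_apply, smul_eq_mul, symVec_apply]
  by_cases h0 : v τ = 0
  · rw [h0]
    refine Finset.sum_eq_zero fun S hS => ?_
    split_ifs with hw
    · have := hv.apply_eq (τ := τ) (σ := top S) (by rw [hw]; exact htop S)
      rw [mul_comm, ← this, h0]
    · rw [mul_zero]
  · obtain ⟨S, hS⟩ := hv.exists_rssyt h0
    have e := hv.apply_eq (τ := τ) (σ := top S) (by rw [← hS]; exact htop S)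
    rw [Finset.sum_eq_single S]
    · rw [if_pos hS.symm, e, mul_comm]
    · intro S' _ hne
      rw [if_neg fun h => hne (RSSYT.ext (h.symm.trans hS.symm)), mul_zero]
    · intro hS'
      rw [Finsupp.mem_support_iff, not_not, Finsupp.comapDomain_apply] at hS'
      rw [hS', zero_mul]

end Invariants

end VVMac

namespace VVMac

open PSYT

/-! ### The smallest tableau with given exponents -/

section Minimum

variable {n : ℕ} {mu : YoungDiagram}

/-- The order of the boxes by increasing exponents, then by rows. -/
def MinBefore (T : Box mu → ℕ) (a b : Box mu) : Prop :=
  T a < T b ∨ (T a = T b ∧ (a.1.1 < b.1.1 ∨ (a.1.1 = b.1.1 ∧ a.1.2 < b.1.2)))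

theorem MinBefore.trans {T : Box mu → ℕ} {a b c : Box mu} (h1 : MinBefore T a b)
    (h2 : MinBefore T b c) : MinBefore T a c := by
  unfold MinBefore at *; omega

theorem MinBefore.asymm {T : Box mu → ℕ} {a b : Box mu} (h1 : MinBefore T a b) :
    ¬ MinBefore T b a := by
  unfold MinBefore at *; omega

theorem minBefore_or {a b : Box mu} (T : Box mu → ℕ) (h : a ≠ b) :
    MinBefore T a b ∨ MinBefore T b a := by
  have : ¬ (a.1.1 = b.1.1 ∧ a.1.2 = b.1.2) := fun h' => h (box_ext h'.1 h'.2)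
  unfold MinBefore; omega

/-- Numbering by increasing exponents and then row by row is a tableau. Any other tableau admits a
downward step: without one, consecutive labels, and hence all labels, follow this order. -/
theorem exists_isMin (hn : Fintype.card (Box mu) = n) (S : RSSYT mu) :
    ∃ τ : PSYT n mu, IsMin S.toFun τ ∧
      ∀ a b, τ.idx a < τ.idx b ↔ MinBefore S.toFun a b := by
  let f : Box mu → ℕ ×ₗ ℕ ×ₗ ℕ := fun b => toLex (S.toFun b, toLex (b.1.1, b.1.2))
  have hlt : ∀ a b, f a < f b ↔ MinBefore S.toFun a b := by
    intro a b
    simp only [f, Prod.Lex.toLex_lt_toLex]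
    rfl
  obtain ⟨e, he⟩ := exists_idx hn (f := f) fun a b h => by
    simp only [f, EmbeddingLike.apply_eq_iff_eq, Prod.mk.injEq] at h
    exact box_ext h.2.1 h.2.2
  simp only [hlt] at he
  let τ : PSYT n mu :=
    { idx := e
      wt := S.toFun
      row_lt := fun a b h1 h2 => by
        rcases (S.row_weak a b h1 h2).lt_or_eq with h | h
        · exact Or.inl h
        · exact Or.inr ⟨h.symm, Fin.lt_def.1 ((he a b).2 (Or.inr ⟨h.symm, Or.inr ⟨h1, h2⟩⟩))⟩
      col_lt := fun a b h1 h2 => Or.inl (S.col_strict a b h1 h2) }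
  refine ⟨τ, ⟨rfl, fun σ hσ => ?_⟩, he⟩
  -- Going down creates inversions, and there are at most as many as pairs of boxes, so the
  -- difference serves as a decreasing measure.
  have hbound : ∀ σ : PSYT n mu, σ.inv.card ≤ (Finset.univ : Finset (Box mu × Box mu)).card :=
    fun σ => Finset.card_le_card (Finset.subset_univ _)
  induction hm : (Finset.univ : Finset (Box mu × Box mu)).card - σ.inv.card
    using Nat.strong_induction_on generalizing σ with
  | _ m ih =>
    by_cases h : ∃ (i : ℕ) (h : i + 1 < n), Up σ.wt (σ.hi i h) (σ.lo i h)
    · obtain ⟨i, hi, hu⟩ := h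
      have hr : ¬ Rigid σ.wt (σ.lo i hi) (σ.hi i hi) := fun hr => by
        have h1 := hr.content_eq σ (σ.idx_hi_lo i hi)
        have h3 := hr.1
        unfold Up at hu
        omega
      have hu' : Up (σ.sw i hi).wt ((σ.sw i hi).lo i hi) ((σ.sw i hi).hi i hi) := by
        rwa [sw_wt, sw_lo σ hr, sw_hi σ hr]
      have hc := card_inv_of_up hu'
      have hle := LE.of_up hu'
      rw [sw_sw] at hc hle
      have := hbound (σ.sw i hi)
      exact Relation.ReflTransGen.trans
        (ih _ (by omega) (σ.sw i hi) ((σ.sw_wt i hi).trans hσ) rfl) hle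
    · push Not at h
      suffices σ = τ by rw [this]; exact Relation.ReflTransGen.refl
      refine eq_of_lt_imp hσ fun a b hab => (he a b).2 ?_
      refine σ.rel_of_consecutive (fun _ _ _ => MinBefore.trans) (fun i hi => ?_) hab
      rw [← hσ]
      by_cases hr : Rigid σ.wt (σ.lo i hi) (σ.hi i hi)
      · refine Or.inr ⟨hr.1, ?_⟩
        have h1 := hr.content_eq σ (σ.idx_hi_lo i hi)
        unfold content at h1
        omega
      -- An upward pair that is not rigid has either a smaller exponent at the first label, or equal
      -- exponents with the first box to the north-east, hence in a higher row. Both are the order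
      -- of the minimum.
      · have hu := (σ.up_or_up (σ.idx_hi_lo i hi) hr).resolve_right (h i hi)
        have hb := σ.before_of_up hu
        have hl := fun h1 h2 => σ.labelLT_of_le (a := σ.hi i hi) (b := σ.lo i hi) h1 h2
          (lo_ne_hi σ i hi).symm
        simp only [labelLT, idx_hi, idx_lo] at hl
        unfold Up content at hu
        unfold Before colBefore at hb
        unfold MinBefore
        omega

theorem PSYT.IsMin.lt_iff (hn : Fintype.card (Box mu) = n) {S : RSSYT mu} {τ : PSYT n mu}
    (h : IsMin S.toFun τ) (a b : Box mu) : τ.idx a < τ.idx b ↔ MinBefore S.toFun a b := by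
  obtain ⟨σ, h1, h2⟩ := exists_isMin hn S
  rw [(h.2 σ h1.1).antisymm (h1.2 τ h.1)]
  exact h2 a b

/-- Boxes of one row with equal entries, from left to right. -/
def Lnk (S : RSSYT mu) (a b : Box mu) : Prop :=
  S.toFun a = S.toFun b ∧ a.1.1 = b.1.1 ∧ a.1.2 < b.1.2

theorem RSSYT.lt_of_lt_of_le (S : RSSYT mu) {a b : Box mu} (h1 : a.1.1 < b.1.1)
    (h2 : a.1.2 ≤ b.1.2) : S.toFun b < S.toFun a := by
  let m : Box mu := ⟨(b.1.1, a.1.2), mu.up_left_mem le_rfl h2 b.2⟩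
  have e1 : S.toFun m < S.toFun a := S.col_strict a m rfl h1
  rcases h2.lt_or_eq with h | h
  · have e2 : S.toFun b ≤ S.toFun m := S.row_weak m b rfl h
    omega
  · have e : m = b := box_ext rfl h
    rwa [e] at e1

theorem lnk_iff (S : RSSYT mu) (a b : Box mu) :
    Lnk S a b ↔ Before S.toFun a b ∧ MinBefore S.toFun a b := by
  constructor
  · rintro ⟨h1, h2, h3⟩
    exact ⟨Or.inr ⟨h1, Or.inl h3⟩, Or.inr ⟨h1, Or.inr ⟨h2, h3⟩⟩⟩
  · rintro ⟨h1, h2⟩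
    have := fun h h' => S.lt_of_lt_of_le (a := a) (b := b) h h'
    unfold Before colBefore at h1
    unfold MinBefore at h2
    unfold Lnk
    omega

open Classical in
-- The labels of Min follow `MinBefore`, and `Before` and `MinBefore` agree on a pair exactly when
-- it is linked. All other pairs in `Before` order are inversions.
theorem IsMin.inv_eq (hn : Fintype.card (Box mu) = n) {S : RSSYT mu} {τ : PSYT n mu}
    (h : IsMin S.toFun τ) : τ.inv =
      (Finset.univ.filter fun p : Box mu × Box mu => Before S.toFun p.1 p.2).filter
        fun p => ¬ Lnk S p.1 p.2 := by
  ext p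
  rw [mem_inv, h.1, h.lt_iff hn, Finset.mem_filter, Finset.mem_filter, lnk_iff]
  simp only [Finset.mem_univ, true_and]
  constructor
  · exact fun h' => ⟨h'.1, fun h'' => h''.2.asymm h'.2⟩
  · intro h'
    refine ⟨h'.1, (minBefore_or _ ?_).resolve_left fun h'' => h'.2 ⟨h'.1, h''⟩⟩
    intro e
    rw [e] at h'
    exact h'.1.asymm h'.1

/-- A chain of linked labels stays in one row with one exponent. Conversely, between two such boxes
the row order passes only through boxes of that row with that exponent. -/
theorem IsMin.linked_iff (hn : Fintype.card (Box mu) = n) {S : RSSYT mu} {τ : PSYT n mu}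
    (h : IsMin S.toFun τ) (a b : Box mu) :
    (τ.idx a ≤ τ.idx b ∧ ∀ k : ℕ, (τ.idx a : ℕ) ≤ k → k < τ.idx b → τ.Linked k) ↔
      a = b ∨ Lnk S a b := by
  have hlt := h.lt_iff hn
  constructor
  · rintro ⟨h1, h2⟩
    rcases h1.eq_or_lt with h1 | h1
    · exact Or.inl (τ.idx.injective h1)
    right
    have key : ∀ (k : ℕ) (c : Box mu), (τ.idx c : ℕ) = k → τ.idx a ≤ τ.idx c →
        τ.idx c ≤ τ.idx b → S.toFun a = S.toFun c ∧ a.1.1 = c.1.1 := by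
      intro k
      induction k with
      | zero =>
        intro c hc h3 _
        have : a = c := τ.idx.injective (le_antisymm h3 (Fin.le_def.2 (by omega)))
        rw [this]; exact ⟨rfl, rfl⟩
      | succ k ih =>
        intro c hc h3 h4
        rcases h3.eq_or_lt with h3 | h3
        · rw [τ.idx.injective h3]; exact ⟨rfl, rfl⟩
        · have h3' := Fin.lt_def.1 h3
          have h4' := Fin.le_def.1 h4
          obtain ⟨c1, c2, e1, e2, e3, e4⟩ := h2 k (by omega) (by omega)
          have : c2 = c := τ.idx.injective (Fin.ext (by omega))
          subst this
          have := ih c1 e1 (Fin.le_def.2 (by omega)) (Fin.le_def.2 (by omega))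
          rw [h.1] at e4
          omega
    have h3 := key _ b rfl h1.le le_rfl
    have h4 := (hlt a b).1 h1
    unfold MinBefore at h4
    exact ⟨h3.1, h3.2, by omega⟩
  · rintro (rfl | hl)
    · exact ⟨le_rfl, fun k h1 h2 => by omega⟩
    · have hab : τ.idx a < τ.idx b := (hlt a b).2 ((lnk_iff S a b).1 hl).2
      refine ⟨hab.le, fun k h1 h2 => ?_⟩
      have key : ∀ c : Box mu, τ.idx a ≤ τ.idx c → τ.idx c ≤ τ.idx b →
          S.toFun c = S.toFun a ∧ c.1.1 = a.1.1 := by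
        intro c h3 h4
        obtain ⟨l1, l2, l3⟩ := hl
        rcases h3.eq_or_lt with h3 | h3
        · rw [τ.idx.injective h3]; exact ⟨rfl, rfl⟩
        rcases h4.eq_or_lt with h4 | h4
        · rw [τ.idx.injective h4]; exact ⟨l1.symm, l2.symm⟩
        have k1 := (hlt _ _).1 h3
        have k2 := (hlt _ _).1 h4
        unfold MinBefore at k1 k2
        omega
      have hb := (τ.idx b).2
      have i1 : τ.idx a ≤ ⟨k, by omega⟩ := Fin.le_def.2 h1
      have i2 : (⟨k + 1, by omega⟩ : Fin n) ≤ τ.idx b := Fin.le_def.2 h2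
      have c1 := key (τ.idx.symm ⟨k, by omega⟩) (by simpa using i1)
        (by rw [Equiv.apply_symm_apply]; exact Fin.le_def.2 h2.le)
      have c2 := key (τ.idx.symm ⟨k + 1, by omega⟩)
        (by rw [Equiv.apply_symm_apply]; exact Fin.le_def.2 (by simp only; omega))
        (by simpa using i2)
      exact ⟨_, _, by simp, by simp, c1.2.trans c2.2.symm, by rw [h.1, c1.1, c2.1]⟩

open Classical in
theorem IsMin.blockPos_eq (hn : Fintype.card (Box mu) = n) {S : RSSYT mu} {τ : PSYT n mu}
    (h : IsMin S.toFun τ) (b : Box mu) :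
    τ.blockPos (τ.idx b) = (Finset.univ.filter fun a => Lnk S a b).card + 1 := by
  have hnot : b ∉ Finset.univ.filter fun a => Lnk S a b := fun hb =>
    lt_irrefl _ (Finset.mem_filter.1 hb).2.2.2
  rw [blockPos, ← Finset.card_insert_of_notMem hnot]
  symm
  refine Finset.card_bij (fun a _ => τ.idx a) (fun a ha => ?_) (fun a _ b _ h => τ.idx.injective h)
    fun i hi => ?_
  · rw [Finset.mem_filter]
    refine ⟨Finset.mem_univ _, (IsMin.linked_iff hn h a b).2 ?_⟩
    simpa using ha
  · refine ⟨τ.idx.symm i, ?_, by simp⟩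
    rw [Finset.mem_filter] at hi
    have := (IsMin.linked_iff hn h (τ.idx.symm i) b).1 (by simpa using hi.2)
    simpa using this

theorem eq_range_card_of_lower (s : Finset ℕ) (h : ∀ a b, a < b → b ∈ s → a ∈ s) :
    s = Finset.range s.card := by
  apply Finset.eq_of_subset_of_card_le
  · intro b hb
    rw [Finset.mem_range, Nat.lt_iff_add_one_le, ← Finset.card_range (b + 1)]
    refine Finset.card_le_card fun a ha => ?_
    rcases (Nat.lt_succ_iff.1 (Finset.mem_range.1 ha)).eq_or_lt with h' | h'
    · rwa [h']
    · exact h a b h' hb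
  · rw [Finset.card_range]

theorem prod_range_tInt (m : ℕ) :
    ∏ d ∈ Finset.range m, (1 - t ^ (d + 2)) / (1 - t ^ (d + 1)) = tInt (m + 1) := by
  have h0 : ∀ d, 1 - t ^ (d + 1) ≠ 0 := fun d => sub_ne_zero.2 (t_pow_ne_one d.succ_pos).symm
  induction m with
  | zero => rw [Finset.prod_range_zero, tInt, zero_add, pow_one, div_self one_sub_t_ne_zero]
  | succ m ih =>
    rw [Finset.prod_range_succ, ih, tInt, tInt, div_mul_div_comm, mul_comm (1 - t),
      mul_div_mul_left _ _ (h0 m)]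

open Classical in
-- The boxes linked to `b` from the left have weights t⁻¹, t⁻², … times that of `b`, without gaps,
-- so the product telescopes to a t-integer.
theorem prod_lnk (S : RSSYT mu) (b : Box mu) :
    ∏ a ∈ Finset.univ.filter (fun a => Lnk S a b),
      (boxWeight S.toFun a - t * boxWeight S.toFun b) /
        (boxWeight S.toFun a - boxWeight S.toFun b) =
      tInt ((Finset.univ.filter fun a => Lnk S a b).card + 1) := by
  set s := Finset.univ.filter fun a => Lnk S a b with hs
  have hmem : ∀ a, a ∈ s ↔ Lnk S a b := fun a => by simp [hs]
  let f : Box mu → ℕ := fun a => b.1.2 - a.1.2 - 1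
  have hinj : Set.InjOn f s := by
    intro a ha a' ha' h
    rw [Finset.mem_coe, hmem] at ha ha'
    obtain ⟨-, h1, h2⟩ := ha
    obtain ⟨-, h3, h4⟩ := ha'
    simp only [f] at h
    exact box_ext (by omega) (by omega)
  have himg : s.image f = Finset.range s.card := by
    rw [← Finset.card_image_of_injOn hinj]
    apply eq_range_card_of_lower
    intro c d hcd hd
    rw [Finset.mem_image] at hd ⊢
    obtain ⟨a, ha, rfl⟩ := hd
    rw [hmem] at ha
    obtain ⟨h1, h2, h3⟩ := ha
    simp only [f] at hcd
    let a' : Box mu := ⟨(b.1.1, b.1.2 - c - 1), mu.up_left_mem le_rfl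
      ((Nat.sub_le _ _).trans (Nat.sub_le _ _)) b.2⟩
    have e1 : a'.1.1 = b.1.1 := rfl
    have e2 : a'.1.2 = b.1.2 - c - 1 := rfl
    have k1 := S.row_weak a a' (by omega) (by omega)
    have k2 := S.row_weak a' b (by omega) (by omega)
    exact ⟨a', (hmem _).2 ⟨by omega, by omega, by omega⟩, by
      change b.1.2 - (b.1.2 - c - 1) - 1 = c; omega⟩
  rw [← prod_range_tInt, ← himg, Finset.prod_image hinj]
  refine Finset.prod_congr rfl fun a ha => ?_
  rw [hmem] at ha
  obtain ⟨h1, h2, h3⟩ := ha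
  have e : boxWeight S.toFun b = t ^ (f a + 1) * boxWeight S.toFun a := by
    unfold boxWeight
    have : content b = (f a + 1 : ℕ) + content a := by
      simp only [f, content]; omega
    rw [h1, this, zpow_add₀ t_ne_zero, zpow_natCast]
    ring
  have h0 := boxWeight_ne_zero S.toFun a
  rw [e, ← mul_assoc, ← pow_succ', ← one_sub_mul, ← one_sub_mul, mul_div_mul_right _ _ h0]

open Classical in
-- The block factorials are exactly the factors of the linked pairs, the ones absent from the
-- inversion product of Min.
theorem IsMin.blockFact_eq (hn : Fintype.card (Box mu) = n) {S : RSSYT mu} {τ : PSYT n mu}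
    (h : IsMin S.toFun τ) : τ.blockFact =
      ∏ p ∈ (Finset.univ.filter fun p : Box mu × Box mu => Before S.toFun p.1 p.2).filter
        (fun p => Lnk S p.1 p.2), (boxWeight S.toFun p.1 - t * boxWeight S.toFun p.2) /
          (boxWeight S.toFun p.1 - boxWeight S.toFun p.2) := by
  have e : (Finset.univ.filter fun p : Box mu × Box mu => Before S.toFun p.1 p.2).filter
        (fun p => Lnk S p.1 p.2) = Finset.univ.filter fun p => Lnk S p.1 p.2 := by
    ext p
    simp only [Finset.mem_filter, Finset.mem_univ, true_and, and_iff_right_iff_imp]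
    exact fun h => ((lnk_iff S _ _).1 h).1
  rw [e, blockFact, ← Equiv.prod_comp τ.idx, Finset.prod_filter, Fintype.prod_prod_type_right]
  refine Finset.prod_congr rfl fun b _ => ?_
  rw [IsMin.blockPos_eq hn h, ← prod_lnk, Finset.prod_filter]

end Minimum

end VVMac

namespace VVMac

open PSYT

/-! ### The coefficient functionals -/

section Functional

variable {n : ℕ} {mu : YoungDiagram}

/-- Equal contents put two boxes on one diagonal, where the entries decrease strictly. -/
theorem RSSYT.boxWeight_injective (S : RSSYT mu) : Function.Injective (boxWeight S.toFun) := by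
  intro a b h
  obtain ⟨h1, h2⟩ := boxWeight_inj h
  have k1 := fun h h' => S.lt_of_lt_of_le (a := a) (b := b) h h'
  have k2 := fun h h' => S.lt_of_lt_of_le (a := b) (b := a) h h'
  unfold content at h2
  exact box_ext (by omega) (by omega)

/-- Equality would give equal entries with `b` strictly below and weakly to the right of `a`,
against column strictness. -/
theorem RSSYT.boxWeight_ne_t_mul (S : RSSYT mu) {a b : Box mu} (h : Before S.toFun a b) :
    boxWeight S.toFun a - t * boxWeight S.toFun b ≠ 0 := by
  intro h'
  obtain ⟨h1, h2⟩ := boxWeight_eq_t_mul (sub_eq_zero.1 h')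
  have k1 := fun h h' => S.lt_of_lt_of_le (a := a) (b := b) h h'
  unfold content at h2
  unfold Before colBefore at h
  omega

/-- Each unordered pair is counted once by either relation, up to its orientation. -/
theorem prod_filter_tournament {α M : Type*} [Fintype α] [CommMonoid M] {R R' : α → α → Prop}
    [DecidableRel R] [DecidableRel R']
    (h : ∀ a b, R a b → ¬ R b a) (h' : ∀ a b, R' a b → ¬ R' b a)
    (ht : ∀ a b, a ≠ b → R a b ∨ R b a) (ht' : ∀ a b, a ≠ b → R' a b ∨ R' b a) (f : α × α → M) :
    ∏ p ∈ Finset.univ.filter (fun p : α × α => R p.1 p.2), f p =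
      ∏ p ∈ Finset.univ.filter (fun p : α × α => R' p.1 p.2),
        if R p.1 p.2 then f p else f p.swap := by
  rw [← Finset.prod_filter_mul_prod_filter_not _ (fun p : α × α => R' p.1 p.2),
    Finset.prod_ite]
  congr 1
  · rw [Finset.filter_filter, Finset.filter_filter]
    exact Finset.prod_congr (by ext; simp [and_comm]) fun _ _ => rfl
  · refine Finset.prod_equiv (Equiv.prodComm α α) (fun p => ?_) fun p _ => by simp
    simp only [Finset.mem_filter, Finset.mem_univ, true_and, Equiv.prodComm_apply, Prod.fst_swap,
      Prod.snd_swap]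
    constructor
    · rintro ⟨h1, h2⟩
      exact ⟨(ht' _ _ fun e : p.1 = p.2 => h _ _ h1 (by rwa [e] at h1 ⊢)).resolve_left h2, h _ _ h1⟩
    · rintro ⟨h1, h2⟩
      exact ⟨(ht _ _ fun e : p.1 = p.2 => h' _ _ h1 (by rwa [e] at h1 ⊢)).resolve_right h2, h' _ _ h1⟩

/-- The symmetrization weight of a numbering of the boxes. -/
noncomputable def numWeight (S : RSSYT mu) (e : Box mu ≃ Fin n) : Kqt :=
  ∏ a, ∏ b, if e a < e b then
    (boxWeight S.toFun a - t * boxWeight S.toFun b) / (boxWeight S.toFun a - boxWeight S.toFun b)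
  else 1

open Classical in
/-- The product over all pairs of boxes. -/
noncomputable def pairProd (S : RSSYT mu) : Kqt :=
  ∏ p ∈ Finset.univ.filter (fun p : Box mu × Box mu => Before S.toFun p.1 p.2),
    (boxWeight S.toFun p.1 - t * boxWeight S.toFun p.2) /
      (boxWeight S.toFun p.1 - boxWeight S.toFun p.2)

/-- The value of the coefficient functional on a basis vector, up to normalization. -/
noncomputable def eta (τ : PSYT n mu) : Kqt :=
  ∏ p ∈ τ.inv, (boxWeight τ.wt p.1 - boxWeight τ.wt p.2) /
    (boxWeight τ.wt p.1 - t * boxWeight τ.wt p.2)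

/-- Compared with the product over all pairs, an inversion (a, b) gains the factors of `kap` and
`eta`. These change (x - t y)/(x - y) into (t x - y)/(x - y) = (y - t x)/(y - x), the factor of the
reversed pair. -/
theorem numWeight_idx (S : RSSYT mu) {σ : PSYT n mu} (hσ : σ.wt = S.toFun) :
    numWeight S σ.idx = pairProd S * (kap σ * eta σ) := by
  classical
  have e1 : numWeight S σ.idx =
      ∏ p ∈ Finset.univ.filter (fun p : Box mu × Box mu => σ.idx p.1 < σ.idx p.2),
        (boxWeight S.toFun p.1 - t * boxWeight S.toFun p.2) /
          (boxWeight S.toFun p.1 - boxWeight S.toFun p.2) := by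
    rw [Finset.prod_filter, Fintype.prod_prod_type]; rfl
  have e2 : kap σ * eta σ =
      ∏ p ∈ Finset.univ.filter (fun p : Box mu × Box mu => Before S.toFun p.1 p.2),
        if σ.idx p.1 < σ.idx p.2 then 1 else
          (t * boxWeight S.toFun p.1 - boxWeight S.toFun p.2) /
            (boxWeight S.toFun p.1 - boxWeight S.toFun p.2) *
            ((boxWeight S.toFun p.1 - boxWeight S.toFun p.2) /
            (boxWeight S.toFun p.1 - t * boxWeight S.toFun p.2)) := by
    rw [kap, eta, ← Finset.prod_mul_distrib, hσ, Finset.prod_ite, Finset.prod_const_one, one_mul]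
    refine Finset.prod_congr ?_ fun _ _ => rfl
    ext p
    rw [mem_inv, hσ, Finset.mem_filter, Finset.mem_filter]
    simp only [Finset.mem_univ, true_and, not_lt]
    refine and_congr_right fun hb => ⟨le_of_lt, fun h => lt_of_le_of_ne h fun e => ?_⟩
    rw [σ.idx.injective e] at hb
    exact hb.asymm hb
  rw [e1, e2, pairProd, ← Finset.prod_mul_distrib,
    prod_filter_tournament (R := fun a b => σ.idx a < σ.idx b) (R' := Before S.toFun)
      (fun _ _ h => h.asymm) (fun _ _ h => h.asymm)
      (fun a b h => lt_or_gt_of_ne fun e => h (σ.idx.injective e)) (fun a b h => before_or _ h)]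
  refine Finset.prod_congr rfl fun p hp => ?_
  have hb := (Finset.mem_filter.1 hp).2
  split_ifs
  · rw [mul_one]
  · have h1 := S.boxWeight_ne_t_mul hb
    have h2 : boxWeight S.toFun p.1 - boxWeight S.toFun p.2 ≠ 0 := sub_ne_zero.2 fun h => by
      have e := S.boxWeight_injective h
      rw [e] at hb
      exact hb.asymm hb
    have h3 : boxWeight S.toFun p.2 - boxWeight S.toFun p.1 ≠ 0 := by
      rwa [← neg_sub, neg_ne_zero]
    simp only [Prod.fst_swap, Prod.snd_swap]
    generalize boxWeight S.toFun p.1 = x at *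
    generalize boxWeight S.toFun p.2 = y at *
    rw [show y - t * x = -(t * x - y) by ring, show y - x = -(x - y) by ring, neg_div_neg_eq]
    generalize x - t * y = w at *
    field_simp

/-- Column strictness takes care of the columns, so a numbering fails to be a tableau only by
reversing two neighbours of a row with equal entries. Their weights differ by a factor t, and the
corresponding numerator vanishes. -/
theorem numWeight_eq_zero (S : RSSYT mu) {e : Box mu ≃ Fin n}
    (he : ∀ σ : PSYT n mu, σ.wt = S.toFun → σ.idx ≠ e) : numWeight S e = 0 := by
  by_contra h0
  have hstep : ∀ a b : Box mu, a.1.1 = b.1.1 → b.1.2 = a.1.2 + 1 → S.toFun a = S.toFun b →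
      e a < e b := by
    intro a b h1 h2 h3
    by_contra hcon
    have hne : a ≠ b := by rintro rfl; omega
    apply h0
    refine Finset.prod_eq_zero (Finset.mem_univ b) (Finset.prod_eq_zero (Finset.mem_univ a) ?_)
    rw [if_pos (lt_of_le_of_ne (not_lt.1 hcon) fun e' => hne (e.injective e').symm),
      boxWeight_of_content_eq h3.symm (a := b) (b := a) (by unfold content; omega), sub_self,
      zero_div]
  have hrow : ∀ (d : ℕ) (a b : Box mu), a.1.1 = b.1.1 → b.1.2 = a.1.2 + d + 1 →
      S.toFun a = S.toFun b → e a < e b := by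
    intro d
    induction d with
    | zero => exact fun a b h1 h2 h3 => hstep a b h1 h2 h3
    | succ d ih =>
      intro a b h1 h2 h3
      let m : Box mu := ⟨(b.1.1, a.1.2 + d + 1), mu.up_left_mem le_rfl (by rw [h2]; omega) b.2⟩
      have e1 : m.1.1 = b.1.1 := rfl
      have e2 : m.1.2 = a.1.2 + d + 1 := rfl
      have k1 := S.row_weak a m (by omega) (by omega)
      have k2 := S.row_weak m b (by omega) (by omega)
      exact (ih a m (by omega) (by omega) (by omega)).trans
        (hstep m b (by omega) (by omega) (by omega))
  refine he ⟨e, S.toFun, fun a b h1 h2 => ?_, fun a b h1 h2 => Or.inl (S.col_strict a b h1 h2)⟩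
    rfl rfl
  rcases (S.row_weak a b h1 h2).lt_or_eq with h | h
  · exact Or.inl h
  · exact Or.inr ⟨h.symm, Fin.lt_def.1 (hrow (b.1.2 - a.1.2 - 1) a b h1 (by omega) h.symm)⟩

/-- Adding the vanishing terms of the other numberings extends the sum to all numberings, where the
symmetrization identity applies. -/
theorem sum_kap_mul_eta (hn : Fintype.card (Box mu) = n) (S : RSSYT mu) :
    pairProd S * ∑ σ ∈ (finite_wt (n := n) S.toFun).toFinset, kap σ * eta σ = tFact n := by
  classical
  have h1 := sum_equiv_prod t hn S.boxWeight_injective (boxWeight_ne_zero S.toFun)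
  have h2 : pairProd S * ∑ σ ∈ (finite_wt (n := n) S.toFun).toFinset, kap σ * eta σ =
      ∑ e : Box mu ≃ Fin n, numWeight S e := by
    rw [Finset.mul_sum]
    refine Finset.sum_of_injOn (fun σ : PSYT n mu => σ.idx) (fun σ hσ τ hτ h => ?_)
      (fun _ _ => Finset.mem_coe.2 (Finset.mem_univ _)) (fun e _ he => ?_) fun σ hσ => ?_
    · have k1 := (finite_wt S.toFun).mem_toFinset.1 hσ
      have k2 := (finite_wt S.toFun).mem_toFinset.1 hτ
      exact PSYT.ext h (Eq.trans k1 (Eq.symm k2))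
    · exact numWeight_eq_zero S fun σ hσ h =>
        he ⟨σ, Finset.mem_coe.2 ((finite_wt S.toFun).mem_toFinset.2 hσ), h⟩
    · exact (numWeight_idx S ((finite_wt S.toFun).mem_toFinset.1 hσ)).symm
  have h3 : (1 - t) ^ n * tFact n = ∏ i ∈ Finset.range n, (1 - t ^ (i + 1)) := by
    rw [tFact, ← Finset.card_range n, ← Finset.prod_const, Finset.card_range,
      ← Finset.prod_mul_distrib]
    refine Finset.prod_congr rfl fun i _ => ?_
    rw [tInt, mul_div_cancel₀ _ one_sub_t_ne_zero]
  rw [h2]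
  apply mul_left_cancel₀ (pow_ne_zero n one_sub_t_ne_zero)
  rw [h3, ← h1]
  rfl

theorem kFactor_eq (hn : Fintype.card (Box mu) = n) (S : RSSYT mu) :
    kFactor n S.toFun = pairProd S / tFact n := by
  classical
  have h : ∃ τ : PSYT n mu, IsMin S.toFun τ := (exists_isMin hn S).imp fun _ h => h.1
  rw [kFactor, dif_pos h, IsMin.blockFact_eq hn h.choose_spec, IsMin.inv_eq hn h.choose_spec,
    pairProd, div_mul_eq_mul_div, Finset.prod_filter_mul_prod_filter_not]

open Classical in
/-- The functional that computes the coefficient of `P_S` in a fixed vector. -/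
noncomputable def coeffFun (n : ℕ) (S : RSSYT mu) : Mod n mu →ₗ[Kqt] Kqt :=
  Finsupp.linearCombination Kqt fun τ : PSYT n mu =>
    if τ.wt = S.toFun then kFactor n S.toFun * eta τ else 0

open Classical in
theorem coeffFun_eb (S : RSSYT mu) (τ : PSYT n mu) :
    coeffFun n S (eb τ) = if τ.wt = S.toFun then kFactor n S.toFun * eta τ else 0 := by
  rw [coeffFun, eb, Finsupp.linearCombination_single, one_smul]

theorem coeffFun_symVec (hn : Fintype.card (Box mu) = n) (S : RSSYT mu) :
    coeffFun n S (symVec n S.toFun) = 1 := by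
  classical
  rw [symVec, map_sum, Finset.sum_congr rfl fun σ hσ => show coeffFun n S (kap σ • eb σ) =
    kFactor n S.toFun * (kap σ * eta σ) by
      rw [map_smul, coeffFun_eb, if_pos (show σ.wt = S.toFun from (finite_wt S.toFun).mem_toFinset.1 hσ),
        smul_eq_mul]
      ring, ← Finset.mul_sum, kFactor_eq hn, div_mul_eq_mul_div, sum_kap_mul_eta hn,
    div_self (tFact_ne_zero n)]

theorem coeffFun_symVec_of_ne {S S' : RSSYT mu} (h : S' ≠ S) :
    coeffFun n S (symVec n S'.toFun) = 0 := by
  classical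
  rw [symVec, map_sum]
  refine Finset.sum_eq_zero fun σ hσ => ?_
  rw [map_smul, coeffFun_eb, if_neg, smul_zero]
  intro h'
  have k1 : σ.wt = S'.toFun := (finite_wt S'.toFun).mem_toFinset.1 hσ
  exact h (RSSYT.ext (k1.symm.trans h'))

theorem eta_of_up {τ : PSYT n mu} {i : ℕ} {h : i + 1 < n}
    (hu : Up τ.wt (τ.lo i h) (τ.hi i h)) :
    eta τ = (xw τ (i + 1) - xw τ i) / (xw τ (i + 1) - t * xw τ i) * eta (τ.sw i h) := by
  classical
  rw [eta, (τ.inv_of_up hu).2, Finset.prod_insert (τ.inv_of_up hu).1, xw_lo τ i h, xw_hi τ i h, eta,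
    sw_wt]

/-- The values `eta` solve the recursion for a left eigenvector of every T_i with eigenvalue 1.
Rigid pairs in a column, where the eigenvalue would be -t, do not occur for exponents S. -/
theorem coeffFun_opT (S : RSSYT mu) {i : ℕ} (h : i + 1 < n) (v : Mod n mu) :
    coeffFun n S (opT i v) = coeffFun n S v := by
  classical
  suffices coeffFun n S ∘ₗ opT i = coeffFun n S from LinearMap.congr_fun this v
  refine Finsupp.lhom_ext' fun τ => LinearMap.ext_ring ?_
  change coeffFun n S (opT i (eb τ)) = coeffFun n S (eb τ)
  rw [opT_eb h, map_add, map_smul, opR_eb i h, map_smul, coeffFun_eb, coeffFun_eb, sw_wt]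
  split_ifs with hw
  swap
  · simp
  have hxy := sub_ne_zero.2 (xw_ne_succ τ h)
  have hyx := sub_ne_zero.2 (xw_ne_succ τ h).symm
  by_cases hr : Rigid τ.wt (τ.lo i h) (τ.hi i h)
  · rw [bC_of_rigid hr, zero_smul, add_zero]
    rcases hr.2 with h' | h'
    · rw [gC_of_row hr h', one_smul]
    · rw [hw] at hr
      exact absurd (S.not_rigid_col hr h') (lo_ne_hi τ i h)
  · have hne := xw_hi_ne_t_mul hr
    rcases τ.up_or_up (τ.idx_hi_lo i h) hr with hu | hu
    · rw [bC_of_up hr hu, one_smul, eta_of_up hu]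
      generalize xw τ i = x at *
      generalize xw τ (i + 1) = y at *
      rw [smul_eq_mul, gC]
      have := hne.1
      field_simp
      ring
    · have hu' : Up (τ.sw i h).wt ((τ.sw i h).lo i h) ((τ.sw i h).hi i h) := by
        rwa [sw_wt, sw_lo τ hr, sw_hi τ hr]
      rw [bC_of_down hr hu, eta_of_up hu', sw_sw, xw_sw τ hr, xw_sw τ hr, Equiv.swap_apply_left,
        Equiv.swap_apply_right, ← xw_lo τ i h, ← xw_hi τ i h]
      generalize xw τ i = x at *
      generalize xw τ (i + 1) = y at *
      rw [smul_eq_mul, smul_eq_mul, gC, cC]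
      have := hne.2
      field_simp
      ring

/-- The functionals are dual to the symmetric vectors, which gives uniqueness and the values at
once. -/
theorem HeckeFixed.linearCombination_iff (hn : Fintype.card (Box mu) = n) {v : Mod n mu}
    (hv : HeckeFixed v) : ∃ d : RSSYT mu →₀ Kqt, (∀ S, d S = coeffFun n S v) ∧
      ∀ c, Finsupp.linearCombination Kqt (fun S : RSSYT mu => symVec n S.toFun) c = v ↔ c = d := by
  classical
  have key : ∀ c : RSSYT mu →₀ Kqt, ∀ S,
      c S = coeffFun n S (Finsupp.linearCombination Kqt (fun S : RSSYT mu => symVec n S.toFun) c) := by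
    intro c S
    rw [Finsupp.linearCombination_apply, Finsupp.sum, map_sum, Finset.sum_eq_single S]
    · rw [map_smul, coeffFun_symVec hn, smul_eq_mul, mul_one]
    · intro S' _ hne
      rw [map_smul, coeffFun_symVec_of_ne hne, smul_zero]
    · intro hS
      rw [Finsupp.notMem_support_iff.1 hS, zero_smul, map_zero]
  obtain ⟨d, hd⟩ := hv.exists_linearCombination hn
  refine ⟨d, fun S => by rw [key d S, hd], fun c => ⟨fun hc => ?_, fun hc => hc ▸ hd⟩⟩
  ext S
  rw [key c S, key d S, hc, hd]

end Functional

end VVMac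

namespace VVMac

open PSYT

/-! ### Elementary symmetric polynomials -/

section SetMonomials

variable {n : ℕ} {mu : YoungDiagram}

/-- The product of the `X_i`, `i ∈ A`. -/
noncomputable def gSet (A : Finset (Fin n)) : Daha n := gMon fun i => if i ∈ A then 1 else 0

theorem gSet_empty : gSet (∅ : Finset (Fin n)) = 1 := by
  rw [gSet, ← gMon_zero]; congr 1

theorem gX_mul_gSet {A : Finset (Fin n)} {k : Fin n} (hk : k ∉ A) :
    gX k.1 k.2 * gSet A = gSet (insert k A) := by
  rw [gSet, gX_mul_gMon, gSet]
  congr 1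
  ext i
  by_cases h : i = k
  · subst h; simp [hk]
  · simp [h]

theorem commute_gT_gSet {i : ℕ} {h : i + 1 < n} {B : Finset (Fin n)}
    (h1 : (⟨i, Nat.lt_of_succ_lt h⟩ : Fin n) ∉ B) (h2 : (⟨i + 1, h⟩ : Fin n) ∉ B) :
    Commute (gT i h) (gSet B) := by
  induction B using Finset.induction_on with
  | empty => rw [gSet_empty]; exact Commute.one_right _
  | insert k B hk ih =>
    rw [Finset.mem_insert, not_or] at h1 h2
    rw [← gX_mul_gSet hk]
    refine Commute.mul_right ?_ (ih h1.2 h2.2)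
    exact gT_mul_gX i k h k.2 (fun e => h1.1 (Fin.ext e.symm)) fun e => h2.1 (Fin.ext e.symm)

theorem commute_gT_add (i : ℕ) (h : i + 1 < n) :
    Commute (gT i h) (gX i (Nat.lt_of_succ_lt h) + gX (i + 1) h) := by
  rw [Commute, SemiconjBy, mul_add, gT_mul_gX_self, gT_mul_gX_succ, add_mul]
  have : (1 - t) • gX i (Nat.lt_of_succ_lt h) = -((t - 1) • gX i (Nat.lt_of_succ_lt h)) := by
    rw [Algebra.smul_def, Algebra.smul_def, ← neg_mul, ← map_neg, neg_sub]
  rw [this]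
  abel

theorem commute_gT_mul (i : ℕ) (h : i + 1 < n) :
    Commute (gT i h) (gX i (Nat.lt_of_succ_lt h) * gX (i + 1) h) := by
  have e : (1 - t) • gX i (Nat.lt_of_succ_lt h) = -((t - 1) • gX i (Nat.lt_of_succ_lt h)) := by
    rw [Algebra.smul_def, Algebra.smul_def, ← neg_mul, ← map_neg, neg_sub]
  rw [Commute, SemiconjBy, ← mul_assoc, gT_mul_gX_self, add_mul, mul_assoc, gT_mul_gX_succ, mul_add,
    ← mul_assoc, e, neg_mul, mul_smul_comm, smul_mul_assoc, gX_comm (i + 1) i]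
  abel

/-- Apart from variables untouched by T_i, the sum over the exchange orbit involves only X_i +
X_{i+1} or X_i X_{i+1}, or neither variable. -/
theorem commute_gT_gSet_add (i : ℕ) (h : i + 1 < n) (A : Finset (Fin n)) :
    Commute (gT i h) (gSet A + gSet (A.map (Equiv.swap ⟨i, Nat.lt_of_succ_lt h⟩
      ⟨i + 1, h⟩).toEmbedding)) := by
  set a : Fin n := ⟨i, Nat.lt_of_succ_lt h⟩ with ha
  set b : Fin n := ⟨i + 1, h⟩ with hb
  have hab : a ≠ b := fun e => by simp [ha, hb] at e
  set B := (A.erase a).erase b with hB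
  have haB : a ∉ B := by simp [hB]
  have hbB : b ∉ B := by simp [hB]
  have hc := commute_gT_gSet (h := h) haB hbB
  have hmap : B.map (Equiv.swap a b).toEmbedding = B := by
    rw [Finset.map_eq_image]
    conv_rhs => rw [← Finset.image_id (s := B)]
    refine Finset.image_congr fun x hx => ?_
    exact Equiv.swap_apply_of_ne_of_ne (fun e => haB (e ▸ hx)) fun e => hbB (e ▸ hx)
  by_cases h1 : a ∈ A <;> by_cases h2 : b ∈ A
  · have hA : A = insert a (insert b B) := by
      ext x; simp only [hB, Finset.mem_insert, Finset.mem_erase]; grind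
    rw [hA, Finset.map_insert, Finset.map_insert, hmap]
    simp only [Equiv.coe_toEmbedding, Equiv.swap_apply_left, Equiv.swap_apply_right]
    rw [Finset.insert_comm b a, ← gX_mul_gSet (by simp [hab, haB]), ← gX_mul_gSet hbB, ← mul_assoc]
    have := (commute_gT_mul i h).mul_right hc
    exact this.add_right this
  · have hA : A = insert a B := by
      ext x; simp only [hB, Finset.mem_insert, Finset.mem_erase]; grind
    rw [hA, Finset.map_insert, hmap]
    simp only [Equiv.coe_toEmbedding, Equiv.swap_apply_left]
    rw [← gX_mul_gSet haB, ← gX_mul_gSet hbB, ← add_mul]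
    exact (commute_gT_add i h).mul_right hc
  · have hA : A = insert b B := by
      ext x; simp only [hB, Finset.mem_insert, Finset.mem_erase]; grind
    rw [hA, Finset.map_insert, hmap]
    simp only [Equiv.coe_toEmbedding, Equiv.swap_apply_right]
    rw [← gX_mul_gSet haB, ← gX_mul_gSet hbB, ← add_mul, add_comm]
    exact (commute_gT_add i h).mul_right hc
  · have hA : A = B := by
      ext x; simp only [hB, Finset.mem_erase]; grind
    rw [hA, hmap]
    exact hc.add_right hc

theorem gElem_eq (n r : ℕ) : gElem n r = ∑ A ∈ (Finset.univ : Finset (Fin n)).powersetCard r, gSet A :=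
  rfl

theorem commute_gT_gElem (i : ℕ) (h : i + 1 < n) (r : ℕ) : Commute (gT i h) (gElem n r) := by
  set s := Equiv.swap (⟨i, Nat.lt_of_succ_lt h⟩ : Fin n) ⟨i + 1, h⟩ with hs
  have e1 : ∑ A ∈ (Finset.univ : Finset (Fin n)).powersetCard r, gSet (A.map s.toEmbedding) =
      gElem n r := by
    rw [gElem_eq]
    refine Finset.sum_nbij' (fun A => A.map s.toEmbedding) (fun A => A.map s.symm.toEmbedding)
      ?_ ?_ ?_ ?_ fun _ _ => rfl
    · intro A hA; simpa using hA
    · intro A hA; simpa using hA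
    · intro A _; rw [Finset.map_map]; ext; simp
    · intro A _; rw [Finset.map_map]; ext; simp
  -- Pairing each index set with its exchange counts every set twice; the factor 2 is invertible.
  have e2 : Commute (gT i h) (gElem n r + gElem n r) := by
    nth_rewrite 2 [← e1]
    rw [gElem_eq, ← Finset.sum_add_distrib]
    exact Commute.sum_right _ _ _ fun A _ => commute_gT_gSet_add i h A
  have e3 : gElem n r = (2⁻¹ : Kqt) • (gElem n r + gElem n r) := by
    rw [← two_smul Kqt, inv_smul_smul₀ two_ne_zero]
  rw [e3]
  exact e2.smul_right _

theorem HeckeFixed.gElem {v : Mod n mu} (hv : HeckeFixed v) (r : ℕ) :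
    HeckeFixed (rho n mu (gElem n r) v) := by
  intro i h
  rw [← rho_gT i h, ← Module.End.mul_apply, ← map_mul, (commute_gT_gElem i h r).eq, map_mul,
    Module.End.mul_apply, rho_gT, hv i h]

/-- Moving an index of a monomial up multiplies the value of an invariant functional by `t`. -/
theorem functional_gSet_step {v : Mod n mu} (hv : HeckeFixed v) {L : Mod n mu →ₗ[Kqt] Kqt}
    (hL : ∀ i, i + 1 < n → ∀ u, L (opT i u) = L u) {i : ℕ} {h : i + 1 < n} {B : Finset (Fin n)}
    (h1 : (⟨i, Nat.lt_of_succ_lt h⟩ : Fin n) ∉ B) (h2 : (⟨i + 1, h⟩ : Fin n) ∉ B) :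
    L (rho n mu (gSet (insert ⟨i, Nat.lt_of_succ_lt h⟩ B)) v) =
      t⁻¹ * L (rho n mu (gSet (insert ⟨i + 1, h⟩ B)) v) := by
  have hu : opT i (rho n mu (gSet B) v) = rho n mu (gSet B) v := by
    rw [← rho_gT i h, ← Module.End.mul_apply, ← map_mul, (commute_gT_gSet h1 h2).eq, map_mul,
      Module.End.mul_apply, rho_gT, hv i h]
  rw [← gX_mul_gSet h1, ← gX_mul_gSet h2, map_mul, map_mul, Module.End.mul_apply,
    Module.End.mul_apply, rho_gX, rho_gX, HeckeData.X_eq _ h, LinearMap.smul_apply, map_smul,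
    smul_eq_mul]
  congr 1
  change L (opT i ((psytData n mu).X (i + 1) (opT i _))) = _
  rw [hL i h, hu]

/-- The last `r` indices. -/
def lastSet (n r : ℕ) : Finset (Fin n) := Finset.univ.filter fun i => n - r ≤ (i : ℕ)

/-- A set of indices closed under successor is a final segment. -/
theorem eq_lastSet {A : Finset (Fin n)}
    (hA : ∀ (i : ℕ) (h : i + 1 < n), (⟨i, Nat.lt_of_succ_lt h⟩ : Fin n) ∈ A →
      (⟨i + 1, h⟩ : Fin n) ∈ A) : A = lastSet n A.card := by
  have hup : ∀ (d i : ℕ) (h : i + d < n), (⟨i, by omega⟩ : Fin n) ∈ A →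
      (⟨i + d, h⟩ : Fin n) ∈ A := by
    intro d i
    induction d with
    | zero => exact fun _ h => h
    | succ d ih => intro h hi; exact hA _ h (ih (by omega) hi)
  have hinj : Set.InjOn (fun i : Fin n => n - 1 - (i : ℕ)) A := fun i _ j _ hij => by
    have := i.2; have := j.2; simp only at hij; exact Fin.ext (by omega)
  have himg : A.image (fun i : Fin n => n - 1 - (i : ℕ)) = Finset.range A.card := by
    rw [← Finset.card_image_of_injOn hinj]
    apply eq_range_card_of_lower
    intro a b hab hb
    rw [Finset.mem_image] at hb ⊢
    obtain ⟨i, hi, rfl⟩ := hb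
    have := i.2
    refine ⟨⟨i + (n - 1 - i - a), by omega⟩, hup _ _ _ hi, by simp only; omega⟩
  ext i
  have hi := i.2
  have h1 : i ∈ A ↔ n - 1 - (i : ℕ) ∈ A.image (fun i : Fin n => n - 1 - (i : ℕ)) := by
    rw [Finset.mem_image]
    constructor
    · exact fun h => ⟨i, h, rfl⟩
    · rintro ⟨j, hj, e⟩
      have := j.2
      have : j = i := Fin.ext (by omega)
      rwa [← this]
  rw [h1, himg, Finset.mem_range, lastSet, Finset.mem_filter]
  simp only [Finset.mem_univ, true_and]
  omega

theorem functional_gSet {v : Mod n mu} (hv : HeckeFixed v) {L : Mod n mu →ₗ[Kqt] Kqt}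
    (hL : ∀ i, i + 1 < n → ∀ u, L (opT i u) = L u) (A : Finset (Fin n)) :
    (∏ i ∈ lastSet n A.card, t ^ (i : ℕ)) * L (rho n mu (gSet A) v) =
      (∏ i ∈ A, t ^ (i : ℕ)) * L (rho n mu (gSet (lastSet n A.card)) v) := by
  -- A crude bound on the index sum, so that n * n minus this sum decreases whenever an index is
  -- raised.
  have hb : ∀ A : Finset (Fin n), ∑ i ∈ A, (i : ℕ) ≤ n * n := fun A => by
    calc ∑ i ∈ A, (i : ℕ) ≤ ∑ i ∈ A, n := Finset.sum_le_sum fun i _ => i.2.le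
      _ = A.card * n := by rw [Finset.sum_const, smul_eq_mul]
      _ ≤ n * n := Nat.mul_le_mul_right n (by simpa using Finset.card_le_univ A)
  induction hm : n * n - ∑ i ∈ A, (i : ℕ) using Nat.strong_induction_on generalizing A with
  | _ m ih =>
    by_cases hA : ∀ (i : ℕ) (h : i + 1 < n), (⟨i, Nat.lt_of_succ_lt h⟩ : Fin n) ∈ A →
      (⟨i + 1, h⟩ : Fin n) ∈ A
    · have e := eq_lastSet hA
      rw [← e]
    · push Not at hA
      obtain ⟨i, h, h1, h2⟩ := hA
      set B := A.erase ⟨i, Nat.lt_of_succ_lt h⟩ with hB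
      have hA : A = insert ⟨i, Nat.lt_of_succ_lt h⟩ B := (Finset.insert_erase h1).symm
      have k1 : (⟨i, Nat.lt_of_succ_lt h⟩ : Fin n) ∉ B := Finset.notMem_erase _ _
      have k2 : (⟨i + 1, h⟩ : Fin n) ∉ B := fun hh => h2 (Finset.mem_of_mem_erase hh)
      have hcard : A.card = (insert (⟨i + 1, h⟩ : Fin n) B).card := by
        rw [hA, Finset.card_insert_of_notMem k1, Finset.card_insert_of_notMem k2]
      have hb' := hb (insert (⟨i + 1, h⟩ : Fin n) B)
      have := ih _ (by
        rw [← hm, hA, Finset.sum_insert k1]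
        rw [Finset.sum_insert k2] at hb' ⊢
        simp only at hb' ⊢
        omega) (insert ⟨i + 1, h⟩ B) rfl
      rw [hcard]
      rw [hA, functional_gSet_step hv hL k1 k2, mul_left_comm, this, Finset.prod_insert k1,
        Finset.prod_insert k2, pow_succ', ← mul_assoc, ← mul_assoc, ← mul_assoc,
        inv_mul_cancel₀ t_ne_zero, one_mul]

theorem functional_gElem {v : Mod n mu} (hv : HeckeFixed v) {L : Mod n mu →ₗ[Kqt] Kqt}
    (hL : ∀ i, i + 1 < n → ∀ u, L (opT i u) = L u) (r : ℕ) :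
    (∏ i ∈ lastSet n r, t ^ (i : ℕ)) * L (rho n mu (gElem n r) v) =
      (∑ A ∈ (Finset.univ : Finset (Fin n)).powersetCard r, ∏ i ∈ A, t ^ (i : ℕ)) *
        L (rho n mu (gSet (lastSet n r)) v) := by
  rw [gElem_eq, map_sum, LinearMap.sum_apply, map_sum, Finset.mul_sum, Finset.sum_mul]
  refine Finset.sum_congr rfl fun A hA => ?_
  rw [← (Finset.mem_powersetCard.1 hA).2]
  exact functional_gSet hv hL A

end SetMonomials

end VVMac

namespace VVMac

open PSYT

/-! ### The finite rank Pieri coefficients -/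

namespace HeckeData

variable {n : ℕ} {R : Type*} [Ring R] [Algebra Kqt R] (D : HeckeData n R)

/-- The product `X_(j+r-1) ⋯ X_j`. -/
noncomputable def Xs (j : ℕ) : ℕ → R
  | 0 => 1
  | r + 1 => D.X (j + r) * Xs j r

theorem pi_mul_Xs (j : ℕ) {r : ℕ} (h : j + r < n) : D.pi * D.Xs j r = D.Xs (j + 1) r * D.pi := by
  induction r with
  | zero => rw [Xs, Xs, mul_one, one_mul]
  | succ r ih =>
    rw [Xs, Xs, ← mul_assoc, D.pi_mul_X (by omega), mul_assoc, ih (by omega), mul_assoc,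
      show j + 1 + r = j + r + 1 by omega]

/-- The last variable is A π, and π moves past the other r - 1 variables, shifting each index up by
one; induction applies to what remains. -/
theorem Xs_last {r : ℕ} (h : r ≤ n) : D.Xs (n - r) r = D.A ^ r * D.pi ^ r := by
  induction r with
  | zero => rw [Xs, pow_zero, pow_zero, mul_one]
  | succ r ih =>
    rw [Xs, show n - (r + 1) + r = n - 1 by omega, X_last, mul_assoc, D.pi_mul_Xs _ (by omega),
      show n - (r + 1) + 1 = n - r by omega, ih (by omega), pow_succ', pow_succ]
    simp only [mul_assoc]

/-- The product `θ_0 ⋯ θ_(r-1)`. -/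
def Th : ℕ → R
  | 0 => 1
  | r + 1 => Th r * D.th r

/-- The product `θ_1 ⋯ θ_r`. -/
def Th' : ℕ → R
  | 0 => 1
  | r + 1 => Th' r * D.th (r + 1)

theorem th_mul_Th' (r : ℕ) : D.th 0 * D.Th' r = D.Th (r + 1) := by
  induction r with
  | zero => simp [Th, Th']
  | succ r ih => rw [Th', ← mul_assoc, ih]; rfl

theorem commute_Th {a : R} {r : ℕ} (h : ∀ i < r, Commute a (D.th i)) : Commute a (D.Th r) := by
  induction r with
  | zero => exact Commute.one_right a
  | succ r ih => exact (ih fun i hi => h i (by omega)).mul_right (h r (by omega))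

/-- Each T_i⁻¹ meets its θ_i and turns it into θ_{i+1} T_i up to t, while commuting with the θ's of
smaller index. -/
theorem Q_mul_Th {r : ℕ} (h : r < n) : t ^ r • (D.Q r * D.Th r) = D.Th' r * D.P r := by
  induction r with
  | zero => simp [Q, Th, Th', P]
  | succ r ih =>
    have h1 : Commute (D.Ti r) (D.Th r) := (D.commute_Ti (D.commute_Th fun i hi =>
      D.T_th r i h (by omega) (by omega) (by omega)).symm).symm
    have h2 : Commute (D.th (r + 1)) (D.P r) := D.commute_P fun i hi =>
      (D.T_th i (r + 1) (by omega) h (by omega) (by omega)).symm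
    calc t ^ (r + 1) • (D.Q r * D.Ti r * (D.Th r * D.th r))
        = (t ^ r • (D.Q r * D.Th r)) * (t • (D.Ti r * D.th r)) := by
          rw [mul_smul_comm, smul_mul_assoc, ← mul_smul, pow_succ']
          congr 1
          simp only [mul_assoc]
          rw [← mul_assoc (D.Ti r), h1.eq, mul_assoc]
      _ = D.Th' r * D.th (r + 1) * (D.P r * D.T r) := by
          rw [ih (by omega), D.Ti_mul_th h]
          simp only [mul_assoc]
          rw [← mul_assoc (D.P r), ← h2.eq, mul_assoc]

end HeckeData

/-! ### The Pieri coefficients from the action on invariant vectors. -/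

section Pieri

variable {n : ℕ} {mu : YoungDiagram}

theorem HeckeFixed.opTi {v : Mod n mu} (hv : HeckeFixed v) {i : ℕ} (h : i + 1 < n) :
    opTi i v = v := by
  conv_lhs => rw [← hv i h]
  exact LinearMap.congr_fun ((psytData n mu).Ti_T i) v

theorem HeckeFixed.P {v : Mod n mu} (hv : HeckeFixed v) {m : ℕ} (h : m < n) :
    (psytData n mu).P m v = v := by
  induction m with
  | zero => rfl
  | succ m ih =>
    rw [HeckeData.P, Module.End.mul_apply]
    change (psytData n mu).P m (opT m v) = v
    rw [hv m h, ih (by omega)]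

/-- The inverses T_j⁻¹ with j ≥ r commute with θ_0 ⋯ θ_{r-1} and fix v. The others shift the θ's by
one index at the cost of t^r, and the leading θ_0 of π completes the longer product. -/
theorem HeckeFixed.pi_Th {v : Mod n mu} (hv : HeckeFixed v) {r : ℕ} (h : r < n) :
    (psytData n mu).pi ((psytData n mu).Th r v) =
      t ^ (n - 1 - r) • (psytData n mu).Th (r + 1) v := by
  set D := psytData n mu
  have h1 : ∀ m, r + m < n → D.Q (r + m) (D.Th r v) = D.Q r (D.Th r v) := by
    intro m
    induction m with
    | zero => exact fun _ => rfl
    | succ m ih =>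
      intro hm
      have hc : Commute (D.Ti (r + m)) (D.Th r) := (D.commute_Ti (D.commute_Th fun i hi =>
        D.T_th (r + m) i hm (by omega) (by omega) (by omega)).symm).symm
      have e : D.Ti (r + m) (D.Th r v) = D.Th r v := by
        rw [← Module.End.mul_apply, hc.eq, Module.End.mul_apply]
        exact congrArg _ (hv.opTi hm)
      rw [show r + (m + 1) = r + m + 1 by omega, HeckeData.Q, Module.End.mul_apply, e,
        ih (by omega)]
  have h2 := LinearMap.congr_fun (D.Q_mul_Th h) v
  rw [LinearMap.smul_apply, Module.End.mul_apply, Module.End.mul_apply, hv.P h] at h2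
  have h3 := h1 (n - 1 - r) (by omega)
  rw [show r + (n - 1 - r) = n - 1 by omega] at h3
  rw [HeckeData.pi, LinearMap.smul_apply, Module.End.mul_apply, h3,
    show t ^ (n - 1) = t ^ (n - 1 - r) * t ^ r by rw [← pow_add]; congr 1; omega, mul_smul,
    ← map_smul, h2, ← Module.End.mul_apply, D.th_mul_Th']

theorem HeckeFixed.pi_pow {v : Mod n mu} (hv : HeckeFixed v) {r : ℕ} (h : r ≤ n) :
    ((psytData n mu).pi ^ r) v =
      (∏ j ∈ Finset.range r, t ^ (n - 1 - j)) • (psytData n mu).Th r v := by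
  induction r with
  | zero => rw [pow_zero, Finset.prod_range_zero, one_smul]; rfl
  | succ r ih =>
    rw [pow_succ', Module.End.mul_apply, ih (by omega), map_smul, hv.pi_Th h, ← mul_smul,
      Finset.prod_range_succ]

theorem prod_lastSet {r : ℕ} (h : r ≤ n) :
    ∏ i ∈ lastSet n r, t ^ (i : ℕ) = ∏ j ∈ Finset.range r, t ^ (n - 1 - j) := by
  refine Finset.prod_bij' (fun i _ => n - 1 - (i : ℕ))
    (fun j hj => ⟨n - 1 - j, by have := Finset.mem_range.1 hj; omega⟩) ?_ ?_ ?_ ?_ ?_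
  · intro i hi
    have := (Finset.mem_filter.1 hi).2
    have := i.2
    rw [Finset.mem_range]; omega
  · intro j hj
    have := Finset.mem_range.1 hj
    rw [lastSet, Finset.mem_filter]
    exact ⟨Finset.mem_univ _, by simp only; omega⟩
  · intro i hi
    have := i.2
    exact Fin.ext (by simp only; omega)
  · intro j hj
    have := Finset.mem_range.1 hj
    simp only; omega
  · intro i hi
    have := i.2
    congr 1; omega

theorem rho_gSet_lastSet {r : ℕ} (h : r ≤ n) :
    rho n mu (gSet (lastSet n r)) = opA ^ r * (psytData n mu).pi ^ r := by
  have key : ∀ j m, j + m ≤ n →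
      rho n mu (gSet (Finset.univ.filter fun i : Fin n => j ≤ (i : ℕ) ∧ (i : ℕ) < j + m)) =
        (psytData n mu).Xs j m := by
    intro j m
    induction m with
    | zero =>
      intro _
      rw [Finset.filter_false_of_mem fun i _ => by omega, gSet_empty, map_one]; rfl
    | succ m ih =>
      intro hm
      have e : (Finset.univ.filter fun i : Fin n => j ≤ (i : ℕ) ∧ (i : ℕ) < j + (m + 1)) =
          insert ⟨j + m, by omega⟩
            (Finset.univ.filter fun i : Fin n => j ≤ (i : ℕ) ∧ (i : ℕ) < j + m) := by
        ext i
        simp only [Finset.mem_filter, Finset.mem_univ, true_and, Finset.mem_insert, Fin.ext_iff]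
        omega
      rw [e, ← gX_mul_gSet (by simp), map_mul, ih (by omega), rho_gX]; rfl
  have h1 := key (n - r) r (by omega)
  rw [HeckeData.Xs_last _ h] at h1
  rw [← show lastSet n r = (Finset.univ.filter fun i : Fin n =>
    n - r ≤ (i : ℕ) ∧ (i : ℕ) < n - r + r) by
      ext i
      simp only [lastSet, Finset.mem_filter, Finset.mem_univ, true_and]
      have := i.2
      omega] at h1
  exact h1

theorem Th_eb (τ : PSYT n mu) (r : ℕ) :
    (psytData n mu).Th r (eb τ) = (∏ j ∈ Finset.range r, xw τ j) • eb τ := by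
  induction r with
  | zero => rw [Finset.prod_range_zero, one_smul]; rfl
  | succ r ih =>
    rw [HeckeData.Th, Module.End.mul_apply]
    change (psytData n mu).Th r (opTh r (eb τ)) = _
    rw [opTh_eb, map_smul, ih, ← mul_smul, Finset.prod_range_succ, mul_comm]

theorem PSYT.psi_w (τ : PSYT n mu) (j : ℕ) (h : j + 1 < n) :
    τ.psi.w ⟨j, Nat.lt_of_succ_lt h⟩ = τ.w ⟨j + 1, h⟩ := by
  rw [w, psi_idx_symm_of_lt τ j h, psi_wt, w, if_neg]
  simp

theorem opA_pow_eb (τ : PSYT n mu) {r : ℕ} (h : r ≤ n) :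
    (opA ^ r) (eb τ) = (∏ j ∈ Finset.range r, if h : j < n then (q ^ τ.w ⟨j, h⟩)⁻¹ else 1) •
      eb (PSYT.psi^[r] τ) := by
  induction r generalizing τ with
  | zero => rw [Finset.prod_range_zero, one_smul]; rfl
  | succ r ih =>
    rw [pow_succ, Module.End.mul_apply, opA_eb (by omega), map_smul, ih _ (by omega), ← mul_smul,
      Function.iterate_succ_apply, Finset.prod_range_succ', mul_comm]
    congr 2
    · refine Finset.prod_congr rfl fun j hj => ?_
      have := Finset.mem_range.1 hj
      rw [dif_pos (by omega : j < n), dif_pos (by omega : j + 1 < n), psi_w τ j (by omega)]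
    · rw [dif_pos (by omega)]

/-- The powers of q in the θ-eigenvalues of the first r labels are exactly the normalizing factors
of A^r, so only the contents remain. -/
theorem opA_Th_eb (τ : PSYT n mu) {r : ℕ} (h : r ≤ n) :
    (opA ^ r) ((psytData n mu).Th r (eb τ)) =
      (∏ i : Fin n, if (i : ℕ) < r then t ^ τ.c i else 1) • eb (PSYT.psi^[r] τ) := by
  rw [Th_eb, map_smul, opA_pow_eb τ h, ← mul_smul, ← Finset.prod_mul_distrib]
  congr 1
  have e := Fin.prod_univ_eq_prod_range
    (fun j => if j < r then (if h : j < n then t ^ τ.c ⟨j, h⟩ else 1) else 1) n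
  simp only [Fin.is_lt, dif_pos] at e
  rw [e, ← Finset.prod_filter]
  refine Finset.prod_congr ?_ fun j hj => ?_
  · ext j
    simp only [Finset.mem_range, Finset.mem_filter]
    omega
  · have hj' : j < n := by
      have := (Finset.mem_filter.1 hj).1
      rwa [Finset.mem_range] at this
    have h2 := xw_eq τ ⟨j, hj'⟩
    rw [dif_pos hj', dif_pos hj', h2, mul_comm, inv_mul_cancel_left₀ (pow_ne_zero _ q_ne_zero)]

/-- Reducing all monomials to the last one and rewriting that as A^r π^r introduces the same power
of t on both sides, by `prod_lastSet`, and it cancels. What is left is the sum of `kap` times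
content powers times the functional at Ψ^r(τ). -/
theorem coeffFun_gElem (S T : RSSYT mu) {r : ℕ} (h : r ≤ n) :
    coeffFun n S (rho n mu (gElem n r) (symVec n T.toFun)) = pieriFormula n r S T := by
  classical
  have hv := heckeFixed_symVec (n := n) T
  have h0 : ∏ j ∈ Finset.range r, t ^ (n - 1 - j) ≠ 0 :=
    Finset.prod_ne_zero_iff.2 fun _ _ => pow_ne_zero _ t_ne_zero
  have h1 := functional_gElem hv (L := coeffFun n S) (fun i h u => coeffFun_opT S h u) r
  rw [rho_gSet_lastSet h, Module.End.mul_apply, hv.pi_pow h, map_smul, map_smul, prod_lastSet h,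
    smul_eq_mul, mul_left_comm] at h1
  rw [mul_left_cancel₀ h0 h1, pieriFormula, mul_assoc]
  congr 1
  have hfin : {τ : PSYT n mu | τ.wt = T.toFun ∧ (PSYT.psi^[r] τ).wt = S.toFun}.Finite :=
    (finite_wt T.toFun).subset fun _ h => h.1
  have hset : hfin.toFinset = (finite_wt (n := n) T.toFun).toFinset.filter
      fun τ => (PSYT.psi^[r] τ).wt = S.toFun := by
    ext τ; simp
  have hsum : ∀ f : PSYT n mu → Kqt,
      (∑ᶠ (τ : PSYT n mu) (_ : τ.wt = T.toFun ∧ (PSYT.psi^[r] τ).wt = S.toFun), f τ) =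
        ∑ τ ∈ hfin.toFinset, f τ := fun f => finsum_mem_eq_finite_toFinset_sum f hfin
  rw [symVec, map_sum, map_sum, map_sum, hsum, hset, Finset.mul_sum, Finset.sum_filter]
  refine Finset.sum_congr rfl fun τ hτ => ?_
  have hτ' : τ.wt = T.toFun := (finite_wt T.toFun).mem_toFinset.1 hτ
  rw [map_smul, map_smul, map_smul, opA_Th_eb τ h, map_smul, coeffFun_eb, smul_eq_mul, smul_eq_mul]
  split_ifs with hS
  · rw [kap, eta, hτ', hS]; ring
  · rw [mul_zero, mul_zero]

/-- The Pieri rule in finite rank. -/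
theorem exists_isUniqueExpansion (hn : Fintype.card (Box mu) = n) {r : ℕ} (h : r ≤ n)
    (T : RSSYT mu) : ∃ d : RSSYT mu →₀ Kqt,
      IsUniqueExpansion (symMac n) (gElem n r • symMac n T) d ∧
        ∀ S, d S = pieriFormula n r S T := by
  obtain ⟨d, h1, h2⟩ := ((heckeFixed_symVec (n := n) T).gElem r).linearCombination_iff hn
  refine ⟨d, fun c => ?_, fun S => by rw [h1, coeffFun_gElem S T h]⟩
  rw [← h2 c, symMac_eq hn, ← modEquiv_symm_rho, LinearEquiv.eq_symm_apply]
  have e : modEquiv n mu (Finsupp.linearCombination Kqt (symMac n) c) =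
      Finsupp.linearCombination Kqt (fun S : RSSYT mu => symVec n S.toFun) c := by
    rw [Finsupp.linearCombination_apply, Finsupp.linearCombination_apply, Finsupp.sum, Finsupp.sum,
      map_sum]
    refine Finset.sum_congr rfl fun S _ => ?_
    rw [map_smul, symMac_eq hn, LinearEquiv.apply_symm_apply]
  rw [e]

end Pieri

end VVMac

namespace VVMac

open PSYT

/-! ### Adding a box at the end of the first row -/

/-- The diagram `mu'` arises from `mu` by adding the box `z` at the end of the first row, in a new
column. -/
structure AddBox (n : ℕ) (mu mu' : YoungDiagram) where
  z : Box mu'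
  sub : ∀ b ∈ mu, b ∈ mu'
  mem : ∀ b : Box mu', b ≠ z → b.1 ∈ mu
  row : z.1.1 = 0
  col : ∀ b ∈ mu, b.2 < z.1.2
  card : Fintype.card (Box mu) = n
  card' : Fintype.card (Box mu') = n + 1

namespace AddBox

variable {n : ℕ} {mu mu' : YoungDiagram} (E : AddBox n mu mu')

/-- The inclusion of boxes. -/
def inc (b : Box mu) : Box mu' := ⟨b.1, E.sub _ b.2⟩

theorem inc_injective : Function.Injective E.inc := fun _ _ h =>
  Subtype.ext (congrArg Subtype.val h :)

theorem inc_ne (b : Box mu) : E.inc b ≠ E.z := fun h => by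
  have := E.col b.1 b.2
  have e : b.1 = E.z.1 := congrArg Subtype.val h
  rw [e] at this
  exact lt_irrefl _ this

theorem eq_inc {b : Box mu'} (h : b ≠ E.z) : b = E.inc ⟨b.1, E.mem b h⟩ := rfl

theorem eq_or (b : Box mu') : b = E.z ∨ ∃ a, b = E.inc a := by
  by_cases h : b = E.z
  · exact Or.inl h
  · exact Or.inr ⟨_, E.eq_inc h⟩

open Classical in
/-- The numbering extended to the new box. -/
noncomputable def extIdx (e : Box mu ≃ Fin n) (b : Box mu') : Fin (n + 1) :=
  if h : b = E.z then Fin.last n else (e ⟨b.1, E.mem b h⟩).castSucc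

theorem extIdx_z (e : Box mu ≃ Fin n) : E.extIdx e E.z = Fin.last n := dif_pos rfl

theorem extIdx_inc (e : Box mu ≃ Fin n) (b : Box mu) : E.extIdx e (E.inc b) = (e b).castSucc :=
  dif_neg (E.inc_ne b)

theorem extIdx_bijective (e : Box mu ≃ Fin n) : Function.Bijective (E.extIdx e) := by
  refine (Fintype.bijective_iff_injective_and_card _).2 ⟨?_, by rw [E.card', Fintype.card_fin]⟩
  intro a b h
  rcases E.eq_or a with rfl | ⟨a, rfl⟩ <;> rcases E.eq_or b with rfl | ⟨b, rfl⟩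
  · rfl
  · rw [extIdx_z, extIdx_inc] at h
    exact absurd h.symm (Fin.castSucc_lt_last _).ne
  · rw [extIdx_z, extIdx_inc] at h
    exact absurd h (Fin.castSucc_lt_last _).ne
  · rw [extIdx_inc, extIdx_inc] at h
    rw [e.injective (Fin.castSucc_injective _ h)]

open Classical in
/-- Exponents extended by zero. -/
noncomputable def extWt (T : Box mu → ℕ) (b : Box mu') : ℕ :=
  if h : b = E.z then 0 else T ⟨b.1, E.mem b h⟩

theorem extWt_z (T : Box mu → ℕ) : E.extWt T E.z = 0 := dif_pos rfl

theorem extWt_inc (T : Box mu → ℕ) (b : Box mu) : E.extWt T (E.inc b) = T b :=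
  dif_neg (E.inc_ne b)

/-- The tableau extended by the last label, with exponent zero, in the new box. -/
noncomputable def ext (τ : PSYT n mu) : PSYT (n + 1) mu' where
  idx := Equiv.ofBijective _ (E.extIdx_bijective τ.idx)
  wt := E.extWt τ.wt
  row_lt a b h1 h2 := by
    simp only [Equiv.ofBijective_apply]
    rcases E.eq_or a with rfl | ⟨a, rfl⟩ <;> rcases E.eq_or b with rfl | ⟨b, rfl⟩
    · exact absurd h2 (lt_irrefl _)
    · have := E.col b.1 b.2
      change E.z.1.2 < b.1.2 at h2
      omega
    · rw [extIdx_z, extIdx_inc, extWt_z, extWt_inc]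
      have := (τ.idx a).2
      simp only [labelLT, Fin.val_last, Fin.val_castSucc]
      omega
    · rw [extIdx_inc, extIdx_inc, extWt_inc, extWt_inc]
      exact τ.row_lt a b h1 h2
  col_lt a b h1 h2 := by
    simp only [Equiv.ofBijective_apply]
    rcases E.eq_or a with rfl | ⟨a, rfl⟩ <;> rcases E.eq_or b with rfl | ⟨b, rfl⟩
    · exact absurd h2 (lt_irrefl _)
    · have := E.col b.1 b.2
      change E.z.1.2 = b.1.2 at h1
      omega
    · rw [E.row] at h2
      exact absurd h2 (Nat.not_lt_zero _)
    · rw [extIdx_inc, extIdx_inc, extWt_inc, extWt_inc]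
      exact τ.col_lt a b h1 h2

theorem ext_idx_z (τ : PSYT n mu) : ((E.ext τ).idx E.z : ℕ) = n := by
  change ((E.extIdx τ.idx E.z : Fin (n + 1)) : ℕ) = n
  rw [extIdx_z]; rfl

theorem ext_idx_inc (τ : PSYT n mu) (b : Box mu) :
    ((E.ext τ).idx (E.inc b) : ℕ) = τ.idx b := by
  change ((E.extIdx τ.idx (E.inc b) : Fin (n + 1)) : ℕ) = _
  rw [extIdx_inc]; rfl

theorem ext_wt_z (τ : PSYT n mu) : (E.ext τ).wt E.z = 0 := E.extWt_z _

theorem ext_wt_inc (τ : PSYT n mu) (b : Box mu) : (E.ext τ).wt (E.inc b) = τ.wt b := E.extWt_inc _ _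

theorem ext_idx_symm (τ : PSYT n mu) (j : ℕ) (h : j < n) :
    (E.ext τ).idx.symm ⟨j, by omega⟩ = E.inc (τ.idx.symm ⟨j, h⟩) := by
  rw [Equiv.symm_apply_eq]
  apply Fin.ext
  rw [ext_idx_inc]
  simp

theorem ext_idx_symm_last (τ : PSYT n mu) :
    (E.ext τ).idx.symm ⟨n, Nat.lt_succ_self n⟩ = E.z := by
  rw [Equiv.symm_apply_eq]
  exact Fin.ext (E.ext_idx_z τ).symm

theorem eq_ext {τ' : PSYT (n + 1) mu'} {τ : PSYT n mu} (h1 : (τ'.idx E.z : ℕ) = n)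
    (h2 : τ'.wt E.z = 0) (h3 : ∀ b, (τ'.idx (E.inc b) : ℕ) = τ.idx b)
    (h4 : ∀ b, τ'.wt (E.inc b) = τ.wt b) : τ' = E.ext τ := by
  refine ext_idx (funext fun b => ?_) fun b => ?_
  · rcases E.eq_or b with rfl | ⟨b, rfl⟩
    · rw [h2, ext_wt_z]
    · rw [h4, ext_wt_inc]
  · rcases E.eq_or b with rfl | ⟨b, rfl⟩
    · rw [h1, ext_idx_z]
    · rw [h3, ext_idx_inc]

theorem ext_injective : Function.Injective (E.ext) := by
  intro τ σ h
  refine ext_idx (funext fun b => ?_) fun b => ?_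
  · rw [← E.ext_wt_inc, h, ext_wt_inc]
  · rw [← E.ext_idx_inc, h, ext_idx_inc]

theorem exists_ext {τ' : PSYT (n + 1) mu'} (h1 : (τ'.idx E.z : ℕ) = n) (h2 : τ'.wt E.z = 0) :
    ∃ τ, τ' = E.ext τ := by
  have hlt : ∀ b, (τ'.idx (E.inc b) : ℕ) < n := fun b => by
    have := (τ'.idx (E.inc b)).2
    have hne : (τ'.idx (E.inc b) : ℕ) ≠ n := fun e =>
      E.inc_ne b (τ'.idx.injective (Fin.ext (e.trans h1.symm)))
    omega
  have hb : Function.Bijective fun b : Box mu => (⟨τ'.idx (E.inc b), hlt b⟩ : Fin n) := by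
    refine (Fintype.bijective_iff_injective_and_card _).2 ⟨fun a b h => ?_, by
      rw [E.card, Fintype.card_fin]⟩
    exact E.inc_injective (τ'.idx.injective (Fin.ext (by simpa using h)))
  refine ⟨⟨Equiv.ofBijective _ hb, fun b => τ'.wt (E.inc b), fun a b k1 k2 => ?_,
    fun a b k1 k2 => ?_⟩, E.eq_ext h1 h2 (fun _ => rfl) fun _ => rfl⟩
  · exact τ'.row_lt (E.inc a) (E.inc b) k1 k2
  · exact τ'.col_lt (E.inc a) (E.inc b) k1 k2

theorem boxWeight_inc {T' : Box mu' → ℕ} {T : Box mu → ℕ} {b : Box mu} (h : T' (E.inc b) = T b) :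
    boxWeight T' (E.inc b) = boxWeight T b := by
  unfold boxWeight; rw [h]; rfl

theorem xw_ext (τ : PSYT n mu) {j : ℕ} (h : j < n) : xw (E.ext τ) j = xw τ j := by
  rw [xw, xw, dif_pos h, dif_pos (by omega), ext_idx_symm E τ j h,
    E.boxWeight_inc (E.ext_wt_inc τ _)]

theorem ext_lo (τ : PSYT n mu) {i : ℕ} (h : i + 1 < n) (h' : i + 1 < n + 1) :
    (E.ext τ).lo i h' = E.inc (τ.lo i h) := E.ext_idx_symm τ i _

theorem ext_hi (τ : PSYT n mu) {i : ℕ} (h : i + 1 < n) (h' : i + 1 < n + 1) :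
    (E.ext τ).hi i h' = E.inc (τ.hi i h) := E.ext_idx_symm τ (i + 1) h

theorem rigid_ext (τ : PSYT n mu) (a b : Box mu) :
    Rigid (E.ext τ).wt (E.inc a) (E.inc b) ↔ Rigid τ.wt a b := by
  unfold Rigid; rw [ext_wt_inc, ext_wt_inc]; rfl

theorem bC_ext (τ : PSYT n mu) (a b : Box mu) :
    bC (E.ext τ).wt (E.inc a) (E.inc b) = bC τ.wt a b := by
  classical
  have h1 := E.rigid_ext τ a b
  have h2 : Up (E.ext τ).wt (E.inc a) (E.inc b) ↔ Up τ.wt a b := by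
    unfold Up; rw [ext_wt_inc, ext_wt_inc]; rfl
  unfold bC
  rw [E.boxWeight_inc (E.ext_wt_inc τ _), E.boxWeight_inc (E.ext_wt_inc τ _),
    if_congr h1 rfl (if_congr h2 rfl rfl)]

theorem sw_ext (τ : PSYT n mu) {i : ℕ} (h : i + 1 < n) (h' : i + 1 < n + 1) :
    (E.ext τ).sw i h' = E.ext (τ.sw i h) := by
  by_cases hr : Rigid τ.wt (τ.lo i h) (τ.hi i h)
  · rw [sw_of_rigid τ hr, sw_of_rigid]
    rwa [E.ext_lo τ h, E.ext_hi τ h, rigid_ext]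
  · have hr' : ¬ Rigid (E.ext τ).wt ((E.ext τ).lo i h') ((E.ext τ).hi i h') := by
      rwa [E.ext_lo τ h, E.ext_hi τ h, rigid_ext]
    apply E.eq_ext
    · rw [sw_idx _ hr', Equiv.trans_apply, swap_val, ext_idx_z, if_neg (by simp only; omega),
        if_neg (by simp only; omega)]
    · rw [sw_wt, ext_wt_z]
    · intro b
      rw [sw_idx _ hr', sw_idx _ hr, Equiv.trans_apply, Equiv.trans_apply, swap_val, swap_val,
        ext_idx_inc]
    · intro b
      rw [sw_wt, sw_wt, ext_wt_inc]

/-- Ψ moves the label of the new box from last to second last and wraps the first label into the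
last place with a positive exponent. One upward exchange of these two labels restores the extended
form. -/
theorem psi_ext (τ : PSYT n mu) (hn : 0 < n) (h' : n - 1 + 1 < n + 1) :
    Up (E.ext τ).psi.wt ((E.ext τ).psi.lo (n - 1) h') ((E.ext τ).psi.hi (n - 1) h') ∧
      (E.ext τ).psi.sw (n - 1) h' = E.ext τ.psi := by
  have hlo : (E.ext τ).psi.lo (n - 1) h' = E.z := by
    symm
    apply eq_lo
    rw [psi_idx, ext_idx_z, if_neg hn.ne']
  have hhi : (E.ext τ).psi.hi (n - 1) h' = E.inc (τ.idx.symm ⟨0, hn⟩) := by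
    symm
    apply eq_hi
    rw [psi_idx, ext_idx_inc]
    simp
    omega
  have hu : Up (E.ext τ).psi.wt ((E.ext τ).psi.lo (n - 1) h') ((E.ext τ).psi.hi (n - 1) h') := by
    left
    rw [hlo, hhi, psi_wt, psi_wt, ext_idx_z, if_neg hn.ne', ext_wt_z, ext_idx_inc]
    simp
  have hr := not_rigid_of_up _ hu
  refine ⟨hu, E.eq_ext ?_ ?_ ?_ ?_⟩
  · rw [sw_idx _ hr, Equiv.trans_apply, swap_val, psi_idx, ext_idx_z, if_neg hn.ne', if_pos rfl]
    simp only; omega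
  · rw [sw_wt, psi_wt, ext_idx_z, if_neg hn.ne', ext_wt_z]
  · intro b
    have hb := (τ.idx b).2
    rw [sw_idx _ hr, Equiv.trans_apply, swap_val, psi_idx, ext_idx_inc, psi_idx]
    simp only
    grind
  · intro b
    rw [sw_wt, psi_wt, psi_wt, ext_idx_inc, ext_wt_inc]

/-- The map dual to the extension of tableaux. -/
noncomputable def phi : Mod (n + 1) mu' →ₗ[Kqt] Mod n mu where
  toFun v := Finsupp.comapDomain E.ext v E.ext_injective.injOn
  map_add' v w := by ext; simp
  map_smul' c v := by ext; simp

theorem phi_apply (v : Mod (n + 1) mu') (τ : PSYT n mu) : E.phi v τ = v (E.ext τ) :=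
  Finsupp.comapDomain_apply _ _ _ _

theorem phi_eb_ext (τ : PSYT n mu) : E.phi (eb (E.ext τ)) = eb τ := by
  ext σ
  rw [phi_apply]
  by_cases h : τ = σ
  · subst h; rw [eb_apply_self, eb_apply_self]
  · rw [eb_apply_of_ne h, eb_apply_of_ne fun e => h (E.ext_injective e)]

theorem phi_eb_of_ne {τ' : PSYT (n + 1) mu'} (h : ∀ τ, τ' ≠ E.ext τ) : E.phi (eb τ') = 0 := by
  ext σ
  rw [phi_apply, eb_apply_of_ne (h σ), Finsupp.zero_apply]

/-- The operator `a'` induces the operator `a`. -/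
def Intertwines (a' : Module.End Kqt (Mod (n + 1) mu')) (a : Module.End Kqt (Mod n mu)) : Prop :=
  ∀ v, E.phi (a' v) = a (E.phi v)

variable {E}

theorem Intertwines.mul {a' b' : Module.End Kqt (Mod (n + 1) mu')} {a b : Module.End Kqt (Mod n mu)}
    (ha : E.Intertwines a' a) (hb : E.Intertwines b' b) : E.Intertwines (a' * b') (a * b) :=
  fun v => by rw [Module.End.mul_apply, ha, hb, Module.End.mul_apply]

theorem Intertwines.one : E.Intertwines 1 1 := fun _ => rfl

theorem Intertwines.smul {a' : Module.End Kqt (Mod (n + 1) mu')} {a : Module.End Kqt (Mod n mu)}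
    (k : Kqt) (ha : E.Intertwines a' a) : E.Intertwines (k • a') (k • a) :=
  fun v => by rw [LinearMap.smul_apply, map_smul, ha, LinearMap.smul_apply]

theorem Intertwines.add {a' b' : Module.End Kqt (Mod (n + 1) mu')} {a b : Module.End Kqt (Mod n mu)}
    (ha : E.Intertwines a' a) (hb : E.Intertwines b' b) : E.Intertwines (a' + b') (a + b) :=
  fun v => by rw [LinearMap.add_apply, map_add, ha, hb, LinearMap.add_apply]

theorem Intertwines.pow {a' : Module.End Kqt (Mod (n + 1) mu')} {a : Module.End Kqt (Mod n mu)}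
    (ha : E.Intertwines a' a) (k : ℕ) : E.Intertwines (a' ^ k) (a ^ k) := by
  induction k with
  | zero => exact Intertwines.one
  | succ k ih => rw [pow_succ, pow_succ]; exact ih.mul ha

variable (E)

theorem intertwines_opT {i : ℕ} (h : i + 1 < n) : E.Intertwines (opT i) (opT i) := by
  intro v
  ext τ
  rw [phi_apply, opT_coeff (by omega : i + 1 < n + 1), opT_coeff h, phi_apply, phi_apply,
    E.xw_ext τ (by omega), E.xw_ext τ h, E.ext_lo τ h, E.ext_hi τ h, bC_ext, E.sw_ext τ h]

theorem intertwines_opTi {i : ℕ} (h : i + 1 < n) : E.Intertwines (opTi i) (opTi i) := by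
  unfold opTi
  rw [if_pos h, if_pos (by omega)]
  refine Intertwines.smul _ ((E.intertwines_opT h).add ?_)
  intro v
  rw [Module.algebraMap_end_apply, map_smul, Module.algebraMap_end_apply]

theorem diag_apply (f : (ℕ → Kqt) → Kqt) (v : Mod n mu) (τ : PSYT n mu) :
    diag f v τ = f (xw τ) * v τ := by
  induction v using Finsupp.induction_linear with
  | zero => simp
  | add v w hv hw => rw [map_add, Finsupp.add_apply, Finsupp.add_apply, hv, hw, mul_add]
  | single σ c =>
    have e : Finsupp.single σ c = c • eb σ := by rw [eb, Finsupp.smul_single, smul_eq_mul, mul_one]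
    rw [e, map_smul, diag_eb, Finsupp.smul_apply, Finsupp.smul_apply, Finsupp.smul_apply,
      smul_eq_mul, smul_eq_mul, smul_eq_mul]
    by_cases h : σ = τ
    · subst h; ring
    · rw [eb_apply_of_ne h]; ring

theorem intertwines_opTh {i : ℕ} (h : i < n) : E.Intertwines (opTh i) (opTh i) := by
  intro v
  ext τ
  rw [phi_apply, opTh, diag_apply, opTh, diag_apply, phi_apply, E.xw_ext τ h]

/-- The last label of Ψ(τ) has a positive exponent, whereas in an extended tableau it has exponent
zero. -/
theorem phi_opA (v : Mod (n + 1) mu') : E.phi (opA v) = 0 := by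
  suffices E.phi ∘ₗ opA = 0 from LinearMap.congr_fun this v
  refine Finsupp.lhom_ext' fun τ => LinearMap.ext_ring ?_
  change E.phi (opA (eb τ)) = 0
  rw [opA_eb (Nat.succ_pos n), map_smul, phi_eb_of_ne, smul_zero]
  intro σ h
  have h1 : τ.psi.w ⟨n, Nat.lt_succ_self n⟩ = 0 := by
    rw [h, w, ext_idx_symm_last, ext_wt_z]
  have h2 := psi_idx_symm_last τ (Nat.succ_pos n)
  rw [w] at h1
  change τ.psi.idx.symm ⟨n, _⟩ = _ at h2
  rw [h2, psi_wt, if_pos (by simp)] at h1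
  omega

/-- The diagonal term of T dies by `phi_opA`; the exchange term restores an extended tableau exactly
when τ is one, by `psi_ext`. -/
theorem phi_opT_opA (hn : 0 < n) (v : Mod (n + 1) mu') :
    E.phi (opT (n - 1) (opA v)) = opA (E.phi v) := by
  suffices E.phi ∘ₗ opT (n - 1) ∘ₗ opA = opA ∘ₗ E.phi from LinearMap.congr_fun this v
  refine Finsupp.lhom_ext' fun τ => LinearMap.ext_ring ?_
  change E.phi (opT (n - 1) (opA (eb τ))) = opA (E.phi (eb τ))
  have h' : n - 1 + 1 < n + 1 := by omega
  have h0 := E.phi_opA (eb τ)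
  rw [opA_eb (Nat.succ_pos n), map_smul] at h0
  have h0' : E.phi (eb τ.psi) = 0 :=
    (smul_eq_zero.1 h0).resolve_left (inv_ne_zero (pow_ne_zero _ q_ne_zero))
  rw [opA_eb (Nat.succ_pos n), map_smul, opT_eb h', map_smul, map_add, map_smul, h0', smul_zero,
    zero_add, opR_eb _ h', map_smul]
  by_cases hτ : ∃ σ, τ = E.ext σ
  · obtain ⟨σ, rfl⟩ := hτ
    obtain ⟨hu, hs⟩ := E.psi_ext σ hn h'
    rw [bC_of_up (not_rigid_of_up _ hu) hu, one_smul, hs, phi_eb_ext, phi_eb_ext, opA_eb hn]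
    congr 3
    rw [w, w, E.ext_idx_symm σ 0 hn, ext_wt_inc]
  · rw [E.phi_eb_of_ne (τ' := τ) fun σ h => hτ ⟨σ, h⟩, map_zero]
    by_cases hr : Rigid τ.psi.wt (τ.psi.lo (n - 1) h') (τ.psi.hi (n - 1) h')
    · rw [bC_of_rigid hr, zero_smul, smul_zero]
    · rw [phi_eb_of_ne, smul_zero, smul_zero]
      -- If the exchanged Ψ(τ) were extended, then tracing the label and the exponent of the new box
      -- back through the exchange and Ψ would make τ extended.
      intro σ h
      have h1 := E.ext_idx_z σ
      have h2 := E.ext_wt_z σ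
      rw [← h, sw_wt, psi_wt] at h2
      rw [← h, sw_idx _ hr, Equiv.trans_apply, swap_val, psi_idx] at h1
      have h3 := (τ.idx E.z).2
      refine hτ (E.exists_ext ?_ ?_)
      · simp only at h1
        grind
      · grind

end AddBox

end VVMac

namespace VVMac

open PSYT

-- The removal of the new box is now compared with π, the X_i and e_r, beginning from its
-- compatibility with T_i, θ_i and A.
namespace AddBox

variable {n : ℕ} {mu mu' : YoungDiagram} (E : AddBox n mu mu')

theorem intertwines_Q {m : ℕ} (h : m < n) :
    E.Intertwines ((psytData (n + 1) mu').Q m) ((psytData n mu).Q m) := by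
  induction m with
  | zero => exact Intertwines.one
  | succ m ih => exact (ih (by omega)).mul (E.intertwines_opTi h)

/-- The larger π has one more factor T⁻¹ and one more factor t; both are removed here. -/
theorem intertwines_pi (hn : 0 < n) :
    E.Intertwines (t⁻¹ • ((psytData (n + 1) mu').pi * opT (n - 1))) ((psytData n mu).pi) := by
  have e : t⁻¹ • ((psytData (n + 1) mu').pi * opT (n - 1)) =
      t ^ (n - 1) • (opTh 0 * (psytData (n + 1) mu').Q (n - 1)) := by
    obtain ⟨m, rfl⟩ : ∃ m, n = m + 1 := ⟨n - 1, by omega⟩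
    have h1 := (psytData (m + 1 + 1) mu').Ti_T m
    rw [HeckeData.pi]
    simp only [Nat.add_sub_cancel]
    change t⁻¹ • (t ^ (m + 1) • ((psytData (m + 1 + 1) mu').th 0 *
      ((psytData (m + 1 + 1) mu').Q m * (psytData (m + 1 + 1) mu').Ti m)) *
        (psytData (m + 1 + 1) mu').T m) = _
    rw [smul_mul_assoc, ← mul_smul, pow_succ', inv_mul_cancel_left₀ t_ne_zero, mul_assoc, mul_assoc,
      h1, mul_one]
    rfl
  rw [e]
  exact ((E.intertwines_opTh hn).mul (E.intertwines_Q (by omega))).smul _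

/-- Downward induction. In the base case the variable is t⁻¹ T A π T with the larger A and π: the
left T A becomes the smaller A, and t⁻¹ π T the smaller π. -/
theorem intertwines_X {i : ℕ} (h : i < n) :
    E.Intertwines ((psytData (n + 1) mu').X i) ((psytData n mu).X i) := by
  obtain ⟨m, hm⟩ : ∃ m, i + m = n - 1 := ⟨n - 1 - i, by omega⟩
  induction m generalizing i with
  | zero =>
    obtain rfl : i = n - 1 := by omega
    rw [HeckeData.X_eq _ (by omega : n - 1 + 1 < n + 1), show n - 1 + 1 = n + 1 - 1 by omega,
      HeckeData.X_last, HeckeData.X_last]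
    intro v
    have h1 := E.intertwines_pi (by omega) v
    rw [LinearMap.smul_apply, map_smul] at h1 ⊢
    rw [Module.End.mul_apply, Module.End.mul_apply, Module.End.mul_apply]
    change t⁻¹ • E.phi (opT (n - 1) (opA ((psytData (n + 1) mu').pi (opT (n - 1) v)))) =
      opA ((psytData n mu).pi (E.phi v))
    rw [E.phi_opT_opA (by omega), ← h1, Module.End.mul_apply, map_smul]
  | succ m ih =>
    rw [HeckeData.X_eq _ (by omega : i + 1 < n + 1), HeckeData.X_eq _ (by omega : i + 1 < n)]
    have hT := E.intertwines_opT (by omega : i + 1 < n)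
    exact ((hT.mul (ih (by omega) (by omega))).mul hT).smul _

theorem phi_X_last (v : Mod (n + 1) mu') : E.phi ((psytData (n + 1) mu').X n v) = 0 := by
  have := (psytData (n + 1) mu').X_last
  rw [Nat.add_sub_cancel] at this
  rw [this, Module.End.mul_apply]
  exact E.phi_opA _

theorem Intertwines.list_prod {m : ℕ} {f : Fin m → Module.End Kqt (Mod (n + 1) mu')}
    {g : Fin m → Module.End Kqt (Mod n mu)} (h : ∀ i, E.Intertwines (f i) (g i)) :
    E.Intertwines (List.ofFn f).prod (List.ofFn g).prod := by
  induction m with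
  | zero => rw [List.ofFn_zero, List.ofFn_zero]; exact Intertwines.one
  | succ m ih =>
    rw [List.ofFn_succ, List.ofFn_succ, List.prod_cons, List.prod_cons]
    exact (h 0).mul (ih fun i => h i.succ)

theorem intertwines_gMon {α : Fin (n + 1) → ℕ} (h : α (Fin.last n) = 0) :
    E.Intertwines (rho (n + 1) mu' (gMon α)) (rho n mu (gMon fun i => α i.castSucc)) := by
  rw [gMon, gMon, map_list_prod, map_list_prod, List.ofFn_succ', List.concat_eq_append, h, pow_zero,
    List.map_append, List.prod_append, List.map_singleton, List.prod_singleton, map_one, mul_one,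
    List.map_ofFn, List.map_ofFn]
  apply Intertwines.list_prod
  intro i
  simp only [Function.comp_apply, map_pow, rho_gX]
  exact (E.intertwines_X i.2).pow _

theorem phi_gMon {α : Fin (n + 1) → ℕ} (h : α (Fin.last n) ≠ 0) (v : Mod (n + 1) mu') :
    E.phi (rho (n + 1) mu' (gMon α) v) = 0 := by
  have e : α = Function.update (Function.update α (Fin.last n) (α (Fin.last n) - 1)) (Fin.last n)
      (Function.update α (Fin.last n) (α (Fin.last n) - 1) (Fin.last n) + 1) := by
    rw [Function.update_self, Nat.sub_add_cancel (Nat.one_le_iff_ne_zero.2 h),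
      Function.update_idem, Function.update_eq_self]
  rw [e, ← gX_mul_gMon, map_mul, Module.End.mul_apply, rho_gX]
  exact E.phi_X_last _

/-- Monomials containing the last variable are killed, since the variables commute and it can be
moved to the front; the others correspond to subsets of the smaller index set. -/
theorem intertwines_gElem (r : ℕ) :
    E.Intertwines (rho (n + 1) mu' (gElem (n + 1) r)) (rho n mu (gElem n r)) := by
  classical
  intro v
  rw [gElem_eq, gElem_eq, map_sum, map_sum, LinearMap.sum_apply, LinearMap.sum_apply, map_sum]
  symm
  refine Finset.sum_of_injOn (fun A : Finset (Fin n) => A.map Fin.castSuccEmb) ?_ ?_ ?_ ?_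
  · exact fun A _ B _ h => Finset.map_injective _ h
  · intro A hA
    simp only [Finset.mem_coe, Finset.mem_powersetCard, Finset.subset_univ, true_and] at hA ⊢
    rw [Finset.card_map, hA]
  · intro A hA hA'
    refine E.phi_gMon ?_ v
    by_cases h : Fin.last n ∈ A
    · simp [h]
    · refine absurd ⟨Finset.univ.filter fun i : Fin n => i.castSucc ∈ A, ?_, ?_⟩ hA'
      · simp only [Finset.mem_coe, Finset.mem_powersetCard, Finset.subset_univ, true_and] at hA ⊢
        rw [← hA]
        refine Finset.card_bij (fun i _ => i.castSucc) (fun i hi => (Finset.mem_filter.1 hi).2)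
          (fun i _ j _ h => Fin.castSucc_injective _ h) fun j hj => ?_
        have hj' : j ≠ Fin.last n := fun e => h (e ▸ hj)
        refine ⟨j.castPred hj', Finset.mem_filter.2 ⟨Finset.mem_univ _, ?_⟩, ?_⟩ <;> simp [hj]
      · ext j
        simp only [Finset.mem_map, Finset.mem_filter, Finset.mem_univ, true_and]
        constructor
        · rintro ⟨i, hi, rfl⟩; exact hi
        · intro hj
          have hj' : j ≠ Fin.last n := fun e => h (e ▸ hj)
          refine ⟨j.castPred hj', ?_, ?_⟩ <;> simp [hj]
  · intro A _
    have h1 := E.intertwines_gMon (α := fun i => if i ∈ A.map Fin.castSuccEmb then 1 else 0)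
      (if_neg (by
        rw [Finset.mem_map]
        rintro ⟨i, -, hi⟩
        exact (Fin.castSucc_lt_last i).ne hi)) v
    have e : (fun i : Fin n => if i.castSucc ∈ A.map Fin.castSuccEmb then 1 else 0) =
        fun i => if i ∈ A then 1 else 0 := by
      ext i
      have : i.castSucc ∈ A.map Fin.castSuccEmb ↔ i ∈ A := by
        rw [← Fin.coe_castSuccEmb, Finset.mem_map']
      rw [if_congr this rfl rfl]
    rw [e] at h1
    exact h1.symm

theorem before_ext (τ : PSYT n mu) (a b : Box mu) :
    Before (E.ext τ).wt (E.inc a) (E.inc b) ↔ Before τ.wt a b := by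
  unfold Before; rw [ext_wt_inc, ext_wt_inc]; rfl

/-- The new box is last both by label and in the box order (exponent zero, last column), so it
belongs to no inversion. -/
theorem kap_ext (τ : PSYT n mu) : kap (E.ext τ) = kap τ := by
  unfold kap
  symm
  refine Finset.prod_bij (fun p _ => (E.inc p.1, E.inc p.2)) ?_ ?_ ?_ ?_
  · intro p hp
    rw [mem_inv] at hp ⊢
    refine ⟨(E.before_ext τ _ _).2 hp.1, ?_⟩
    rw [Fin.lt_def, ext_idx_inc, ext_idx_inc]
    exact Fin.lt_def.1 hp.2
  · intro p _ p' _ h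
    exact Prod.ext (E.inc_injective (congrArg Prod.fst h :)) (E.inc_injective (congrArg Prod.snd h :))
  · rintro ⟨a, b⟩ hp
    rw [mem_inv] at hp
    obtain ⟨h1, h2⟩ := hp
    simp only at h1 h2
    rw [Fin.lt_def] at h2
    rcases E.eq_or b with rfl | ⟨b, rfl⟩
    · rw [ext_idx_z] at h2
      have := ((E.ext τ).idx a).2
      omega
    rcases E.eq_or a with rfl | ⟨a, rfl⟩
    · have := E.col b.1 b.2
      simp only [Before, colBefore, ext_wt_z, ext_wt_inc] at h1
      have e : (E.inc b).1 = b.1 := rfl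
      rw [e] at h1
      omega
    · rw [ext_idx_inc, ext_idx_inc] at h2
      exact ⟨(a, b), mem_inv.2 ⟨(E.before_ext τ a b).1 h1, Fin.lt_def.2 h2⟩, rfl⟩
  · intro p _
    simp only
    rw [E.boxWeight_inc (E.ext_wt_inc τ _), E.boxWeight_inc (E.ext_wt_inc τ _)]

theorem phi_symVec {T' : Box mu' → ℕ} {T : Box mu → ℕ} (hz : T' E.z = 0)
    (hT : ∀ b, T' (E.inc b) = T b) : E.phi (symVec (n + 1) T') = symVec n T := by
  classical
  ext τ
  rw [phi_apply, symVec_apply, symVec_apply, kap_ext]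
  refine if_congr ?_ rfl rfl
  constructor
  · intro h
    funext b
    rw [← E.ext_wt_inc, h, hT]
  · intro h
    funext b
    rcases E.eq_or b with rfl | ⟨b, rfl⟩
    · rw [ext_wt_z, hz]
    · rw [ext_wt_inc, h, hT]

theorem phi_symVec_of_ne {T' : Box mu' → ℕ} (hz : T' E.z ≠ 0) :
    E.phi (symVec (n + 1) T') = 0 := by
  classical
  ext τ
  rw [phi_apply, symVec_apply, if_neg, Finsupp.zero_apply]
  intro h
  rw [← h, ext_wt_z] at hz
  exact hz rfl

end AddBox

end VVMac

namespace VVMac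

open PSYT

/-! ### The connecting maps -/

section Connecting

variable {lam : YoungDiagram} {n : ℕ}

theorem card_box_padded (h : nMin lam ≤ n) : Fintype.card (Box (padded lam n h)) = n := by
  have hle : lam.card ≤ n := le_trans (Nat.le_add_right _ _) h
  rw [Fintype.card_of_subtype (padded lam n h).cells fun b => YoungDiagram.mem_cells b]
  change (_ ∪ _ : Finset (ℕ × ℕ)).card = n
  rw [Finset.card_union_of_disjoint, Finset.card_image_of_injective, Finset.card_image_of_injective,
    Finset.card_range]
  · change n - lam.card + lam.card = n
    omega
  · rintro ⟨a, b⟩ ⟨c, d⟩ e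
    simp only [Prod.mk.injEq, add_left_inj] at e
    exact Prod.ext e.1 e.2
  · intro a b e
    simpa using e
  · rw [Finset.disjoint_left]
    intro b hb hb'
    rw [Finset.mem_image] at hb hb'
    obtain ⟨j, -, rfl⟩ := hb
    obtain ⟨c, -, hc⟩ := hb'
    simp at hc

/-- The condition n ≥ n_λ makes the first row at least as long as λ_1; hence each added box opens a
new column. -/
theorem col_lt_of_mem_padded {h : nMin lam ≤ n} {b : ℕ × ℕ} (hb : b ∈ padded lam n h) :
    b.2 < n - lam.card := by
  rcases mem_padded.1 hb with ⟨-, h1⟩ | ⟨i, -, hi⟩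
  · exact h1
  · have h1 : (0, b.2) ∈ lam := lam.up_left_mem (Nat.zero_le i) le_rfl hi
    rw [YoungDiagram.mem_iff_lt_rowLen] at h1
    unfold nMin at h
    omega

theorem mem_padded_mono {m : ℕ} {h : nMin lam ≤ n} {h' : nMin lam ≤ m} (hnm : n ≤ m) {b : ℕ × ℕ}
    (hb : b ∈ padded lam n h) : b ∈ padded lam m h' := by
  rw [mem_padded] at hb ⊢
  rcases hb with ⟨h1, h2⟩ | hb
  · exact Or.inl ⟨h1, by omega⟩
  · exact Or.inr hb

/-- The box added to `λ^(n)`. -/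
def addBox (lam : YoungDiagram) (n : ℕ) (h : nMin lam ≤ n) :
    AddBox n (padded lam n h) (padded lam (n + 1) (Nat.le_succ_of_le h)) where
  z := newBox lam n h
  sub _ hb := mem_padded_mono (Nat.le_succ n) hb
  mem b hb := by
    have h1 := b.2
    rw [mem_padded] at h1 ⊢
    rcases h1 with ⟨h1, h2⟩ | h1
    · refine Or.inl ⟨h1, ?_⟩
      have h3 : b.1.2 ≠ n - lam.card := fun e => hb (box_ext h1 e)
      omega
    · exact Or.inr h1
  row := rfl
  col _ hb := col_lt_of_mem_padded hb
  card := card_box_padded h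
  card' := card_box_padded _

theorem modEquiv_vMon {mu : YoungDiagram} (α : Fin n → ℕ) (τ : SYT n mu) :
    modEquiv n mu (vMon α τ) = rho n mu (gMon α) (eb τ.1) := by
  rw [vMon, modEquiv_smul, modEquiv_vSYT]

/-- The connecting map in terms of periodic tableaux. -/
noncomputable def phiV (lam : YoungDiagram) (n : ℕ) (h : nMin lam ≤ n) :
    V (n + 1) (padded lam (n + 1) (Nat.le_succ_of_le h)) →ₗ[Kqt] V n (padded lam n h) :=
  (modEquiv n _).symm.toLinearMap ∘ₗ (addBox lam n h).phi ∘ₗ (modEquiv (n + 1) _).toLinearMap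

theorem modEquiv_phiV (h : nMin lam ≤ n)
    (v : V (n + 1) (padded lam (n + 1) (Nat.le_succ_of_le h))) :
    modEquiv n _ (phiV lam n h v) = (addBox lam n h).phi (modEquiv (n + 1) _ v) := by
  simp [phiV]

theorem isConnecting_phiV (h : nMin lam ≤ n) : IsConnecting (phiV lam n h) where
  restrict α τ σ hz hres := by
    have e : τ.1 = (addBox lam n h).ext σ.1 := (addBox lam n h).eq_ext hz (τ.2 _)
      (fun b => hres _ b rfl) fun b => by rw [τ.2, σ.2]
    apply (modEquiv n _).injective
    rw [modEquiv_phiV, modEquiv_vMon]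
    split_ifs with hα
    · rw [(addBox lam n h).intertwines_gMon hα, e, AddBox.phi_eb_ext, modEquiv_vMon]
    · rw [(addBox lam n h).phi_gMon hα, map_zero]
  vanish α τ hz := by
    apply (modEquiv n _).injective
    rw [modEquiv_phiV, modEquiv_vMon, map_zero]
    by_cases hα : α (Fin.last n) = 0
    · rw [(addBox lam n h).intertwines_gMon hα, AddBox.phi_eb_of_ne, map_zero]
      intro σ e
      apply hz
      rw [e]
      exact (addBox lam n h).ext_idx_z σ
    · rw [(addBox lam n h).phi_gMon hα]

/-- The two rules cover all monomials: a standard tableau with the last label in the added box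
always has a restriction. -/
theorem IsConnecting.eq_phiV {h : nMin lam ≤ n}
    {Φ : V (n + 1) (padded lam (n + 1) (Nat.le_succ_of_le h)) →ₗ[Kqt] V n (padded lam n h)}
    (hΦ : IsConnecting Φ) : Φ = phiV lam n h := by
  refine LinearMap.ext_on_range (v := monFamily (n + 1) _) span_monFamily ?_
  rintro ⟨α, τ⟩
  change Φ (vMon α τ) = phiV lam n h (vMon α τ)
  by_cases hz : (τ.1.idx (newBox lam n h) : ℕ) = n
  · obtain ⟨σ, hσ⟩ := (addBox lam n h).exists_ext hz (τ.2 _)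
    have hσ0 : ∀ b, σ.wt b = 0 := fun b => by
      rw [← (addBox lam n h).ext_wt_inc, ← hσ, τ.2]
    have hres : IsRestriction τ ⟨σ, hσ0⟩ := by
      intro a b hab
      have : a = (addBox lam n h).inc b := Subtype.ext hab
      rw [this, hσ, AddBox.ext_idx_inc]
    rw [hΦ.restrict α τ _ hz hres, (isConnecting_phiV h).restrict α τ _ hz hres]
  · rw [hΦ.vanish α τ hz, (isConnecting_phiV h).vanish α τ hz]

theorem connecting_eq (h : nMin lam ≤ n) : connecting lam n h = phiV lam n h :=
  (Classical.epsilon_spec (⟨_, isConnecting_phiV h⟩ : ∃ Φ : V (n + 1) (padded lam (n + 1)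
    (Nat.le_succ_of_le h)) →ₗ[Kqt] V n (padded lam n h), IsConnecting Φ)).eq_phiV

theorem connecting_gElem (h : nMin lam ≤ n) (r : ℕ)
    (v : V (n + 1) (padded lam (n + 1) (Nat.le_succ_of_le h))) :
    connecting lam n h (gElem (n + 1) r • v) = gElem n r • connecting lam n h v := by
  rw [connecting_eq]
  apply (modEquiv n _).injective
  rw [modEquiv_phiV, modEquiv_smul, modEquiv_smul, modEquiv_phiV]
  exact (addBox lam n h).intertwines_gElem r _

end Connecting

/-! ### Labellings of the infinite diagram -/

namespace Omega

variable {lam : YoungDiagram} (T : Omega lam)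

/-- The truncations differ only in the length of the first row. -/
theorem of_notMem {n : ℕ} {h : nMin lam ≤ n} {b : ℕ × ℕ} (hb : b ∈ infDiagram lam)
    (hb' : b ∉ padded lam n h) : b.1 = 0 ∧ n - lam.card ≤ b.2 := by
  obtain ⟨m, hm, hb⟩ := hb
  rw [mem_padded] at hb hb'
  push Not at hb'
  rcases hb with ⟨h1, h2⟩ | ⟨i, h1, h2⟩
  · exact ⟨h1, hb'.1 h1⟩
  · exact absurd h2 (hb'.2 i h1)

theorem exists_rank : ∃ n, ∃ h : nMin lam ≤ n,
    ∀ b : infDiagram lam, b.1 ∉ padded lam n h → T.toFun b = 0 := by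
  obtain ⟨M, hM⟩ := (T.finite_support.image fun b => b.1.2).bddAbove
  refine ⟨nMin lam + M + 1, by omega, fun b hb => ?_⟩
  by_contra h0
  have h1 := hM (Set.mem_image_of_mem (fun b : infDiagram lam => b.1.2) h0)
  have h2 := (of_notMem b.2 hb).2
  unfold nMin at h2
  omega

theorem rk_spec : ∃ h : nMin lam ≤ T.rk,
    ∀ b : infDiagram lam, b.1 ∉ padded lam T.rk h → T.toFun b = 0 :=
  Nat.sInf_mem T.exists_rank

theorem nMin_le_rk : nMin lam ≤ T.rk := T.rk_spec.1

theorem eq_zero_of_notMem {n : ℕ} {h : nMin lam ≤ n} (hn : T.rk ≤ n) {b : infDiagram lam}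
    (hb : b.1 ∉ padded lam n h) : T.toFun b = 0 := by
  obtain ⟨h', hT⟩ := T.rk_spec
  exact hT b fun hb' => hb (mem_padded_mono hn hb')

theorem rk_le {n : ℕ} (h : nMin lam ≤ n)
    (hT : ∀ b : infDiagram lam, b.1 ∉ padded lam n h → T.toFun b = 0) : T.rk ≤ n :=
  Nat.sInf_le ⟨h, hT⟩

theorem newBox_notMem (n : ℕ) (h : nMin lam ≤ n) : (newBox lam n h).1 ∉ padded lam n h := fun hb =>
  lt_irrefl _ (col_lt_of_mem_padded hb)

theorem restrict_newBox {n : ℕ} (h : nMin lam ≤ n) (hn : T.rk ≤ n) :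
    (T.restrict (n + 1) (Nat.le_succ_of_le h)).toFun (newBox lam n h) = 0 :=
  T.eq_zero_of_notMem hn (newBox_notMem n h)

theorem restrict_newBox_ne {n : ℕ} (h : nMin lam ≤ n) (hn : n < T.rk) :
    (T.restrict (n + 1) (Nat.le_succ_of_le h)).toFun (newBox lam n h) ≠ 0 := by
  intro h0
  refine absurd (T.rk_le h fun b hb => ?_) (not_le.2 hn)
  obtain ⟨h1, h2⟩ := of_notMem b.2 hb
  change T.toFun ⟨(newBox lam n h).1, _⟩ = 0 at h0
  rcases h2.eq_or_lt with h2 | h2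
  · rw [← h0]
    congr 1
    exact Subtype.ext (Prod.ext h1 h2.symm)
  · have := T.row_weak ⟨(newBox lam n h).1, n + 1, _, (newBox lam n h).2⟩ b h1.symm h2
    omega

variable {n : ℕ} {h : nMin lam ≤ n}

open Classical in
/-- The extension of a labelling by zero. -/
noncomputable def ofRSSYT (S : RSSYT (padded lam n h)) : Omega lam where
  toFun b := if hb : b.1 ∈ padded lam n h then S.toFun ⟨b.1, hb⟩ else 0
  finite_support := by
    refine Set.Finite.of_finite_image (f := Subtype.val)
      ((padded lam n h).cells.finite_toSet.subset ?_) Subtype.val_injective.injOn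
    rintro _ ⟨b, hb, rfl⟩
    by_contra hcon
    exact hb (dif_neg fun hb' => hcon ((YoungDiagram.mem_cells _).2 hb'))
  row_weak a b h1 h2 := by
    by_cases hb : b.1 ∈ padded lam n h
    · have ha : a.1 ∈ padded lam n h := (padded lam n h).up_left_mem h1.le h2.le hb
      rw [dif_pos hb, dif_pos ha]
      exact S.row_weak ⟨a.1, ha⟩ ⟨b.1, hb⟩ h1 h2
    · rw [dif_neg hb]; exact Nat.zero_le _
  col_strict a b h1 h2 := by
    by_cases hb : b.1 ∈ padded lam n h
    · have ha : a.1 ∈ padded lam n h := (padded lam n h).up_left_mem h2.le h1.le hb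
      rw [dif_pos hb, dif_pos ha]
      exact S.col_strict ⟨a.1, ha⟩ ⟨b.1, hb⟩ h1 h2
    · have := (of_notMem b.2 hb).1
      omega

theorem restrict_ofRSSYT (S : RSSYT (padded lam n h)) : (ofRSSYT S).restrict n h = S := by
  ext b
  exact dif_pos b.2

theorem rk_ofRSSYT (S : RSSYT (padded lam n h)) : (ofRSSYT S).rk ≤ n :=
  rk_le _ h fun _ hb => dif_neg hb

theorem ofRSSYT_restrict (hn : T.rk ≤ n) : ofRSSYT (T.restrict n h) = T := by
  ext b
  by_cases hb : b.1 ∈ padded lam n h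
  · exact dif_pos hb
  · exact (dif_neg hb).trans (T.eq_zero_of_notMem hn hb).symm

theorem ofRSSYT_injective : Function.Injective (ofRSSYT : RSSYT (padded lam n h) → Omega lam) :=
  fun S S' e => by rw [← restrict_ofRSSYT S, e, restrict_ofRSSYT]

end Omega

/-! ### The generalized symmetric Macdonald functions -/

section GenMac

variable {lam : YoungDiagram}

theorem symMac_padded {n : ℕ} (h : nMin lam ≤ n) (S : RSSYT (padded lam n h)) :
    symMac n S = (modEquiv n _).symm (symVec n S.toFun) := symMac_eq (card_box_padded h) S

theorem connecting_symMac (T : Omega lam) {n : ℕ} (h : nMin lam ≤ n) (hn : T.rk ≤ n) :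
    connecting lam n h (symMac (n + 1) (T.restrict (n + 1) (Nat.le_succ_of_le h))) =
      symMac n (T.restrict n h) := by
  rw [connecting_eq, symMac_padded, symMac_padded]
  apply (modEquiv n _).injective
  rw [modEquiv_phiV, LinearEquiv.apply_symm_apply, LinearEquiv.apply_symm_apply]
  exact (addBox lam n h).phi_symVec (T.restrict_newBox h hn) fun _ => rfl

theorem connecting_symMac_of_ne {n : ℕ} (h : nMin lam ≤ n)
    (S : RSSYT (padded lam (n + 1) (Nat.le_succ_of_le h))) (hS : S.toFun (newBox lam n h) ≠ 0) :
    connecting lam n h (symMac (n + 1) S) = 0 := by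
  rw [connecting_eq, symMac_padded]
  apply (modEquiv n _).injective
  rw [modEquiv_phiV, LinearEquiv.apply_symm_apply, map_zero]
  exact (addBox lam n h).phi_symVec_of_ne hS

open Classical in
/-- The family with components `P_{T|λ^(n)}` for `n ≥ rk(T)` and `0` otherwise. -/
noncomputable def macFamily (T : Omega lam) : Families lam := fun n =>
  if T.rk ≤ n.1 then symMac n.1 (T.restrict n.1 n.2) else 0

/-- Families compatible with the connecting maps. -/
def Compatible (w : Families lam) : Prop :=
  ∀ (n : ℕ) (h : nMin lam ≤ n), connecting lam n h (w ⟨n + 1, Nat.le_succ_of_le h⟩) = w ⟨n, h⟩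

/-- Components of small index are images of those of large index. -/
theorem Compatible.eq_of_le {w w' : Families lam} (hw : Compatible w) (hw' : Compatible w') {N : ℕ}
    (h : ∀ (n : ℕ) (h : nMin lam ≤ n), N ≤ n → w ⟨n, h⟩ = w' ⟨n, h⟩) : w = w' := by
  funext ⟨n, hn⟩
  obtain ⟨m, hm⟩ : ∃ m, N ≤ n + m := ⟨N, by omega⟩
  induction m generalizing n with
  | zero => exact h n hn hm
  | succ m ih => rw [← hw n hn, ← hw' n hn, ih (n + 1) (Nat.le_succ_of_le hn) (by omega)]

/-- Above the rank the connecting map truncates the labelling. At the passage from the rank to one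
less, the removed box has a nonzero entry and the image is zero. -/
theorem compatible_macFamily (T : Omega lam) : Compatible (macFamily T) := by
  intro n h
  rcases lt_trichotomy T.rk (n + 1) with h1 | h1 | h1
  · rw [macFamily, if_pos (by simp only; omega), macFamily, if_pos (by simp only; omega)]
    exact connecting_symMac T h (by omega)
  · rw [macFamily, if_pos (by simp only; omega), macFamily, if_neg (by simp only; omega)]
    exact connecting_symMac_of_ne h _ (T.restrict_newBox_ne h (by omega))
  · rw [macFamily, if_neg (by simp only; omega), macFamily, if_neg (by simp only; omega), map_zero]

theorem degEq_le_degLE {n d e : ℕ} {mu : YoungDiagram} (h : d ≤ e) : degEq n mu d ≤ degLE n mu e :=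
  Submodule.span_mono fun _ ⟨α, τ, h1, h2⟩ => ⟨α, τ, h1.le.trans h, h2⟩

/-- The degree of every component is bounded by the sum of all entries of T. -/
theorem macFamily_mem (T : Omega lam) : macFamily T ∈ stableW lam := by
  classical
  refine ⟨fun n => ?_, compatible_macFamily T, ∑ b ∈ T.finite_support.toFinset, T.toFun b,
    fun n => ?_⟩
  · unfold macFamily
    split_ifs
    · rw [symMac_padded, mem_W_iff, LinearEquiv.apply_symm_apply]
      exact heckeFixed_symVec _
    · intro i hi
      rw [smul_zero]
  · unfold macFamily
    split_ifs
    · rw [symMac_padded, symVec, map_sum]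
      refine Submodule.sum_mem _ fun σ hσ => ?_
      rw [map_smul]
      refine Submodule.smul_mem _ _ (degEq_le_degLE ?_ (modEquiv_symm_eb_mem σ))
      have hσ' : σ.wt = (T.restrict n.1 n.2).toFun := (finite_wt _).mem_toFinset.1 hσ
      let f : Box (padded lam n.1 n.2) ↪ infDiagram lam :=
        ⟨fun b => ⟨b.1, n.1, n.2, b.2⟩, fun a b h => Subtype.ext (congrArg (fun x => x.1) h :)⟩
      rw [PSYT.deg, hσ']
      change ∑ b, T.toFun (f b) ≤ _
      rw [← Finset.sum_map Finset.univ f T.toFun]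
      exact Finset.sum_le_sum_of_ne_zero fun b _ hb => T.finite_support.mem_toFinset.2 hb
    · exact Submodule.zero_mem _

theorem genMac_eq (T : Omega lam) : genMac T = macFamily T := by
  have hex : ∃ w : Families lam, w ∈ stableW lam ∧
      ∃ N : ℕ, ∀ (n : ℕ) (h : nMin lam ≤ n), N ≤ n → w ⟨n, h⟩ = symMac n (T.restrict n h) :=
    ⟨_, macFamily_mem T, T.rk, fun n h hn => if_pos hn⟩
  obtain ⟨h1, N, hN⟩ := Classical.epsilon_spec hex
  refine Compatible.eq_of_le (N := max N T.rk) h1.2.1 (compatible_macFamily T) fun n h hn => ?_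
  rw [macFamily, if_pos (le_trans (le_max_right _ _) hn)]
  exact hN n h (le_trans (le_max_left _ _) hn)

theorem genMac_apply {T : Omega lam} {n : ℕ} (h : nMin lam ≤ n) (hn : T.rk ≤ n) :
    genMac T ⟨n, h⟩ = symMac n (T.restrict n h) := by
  rw [genMac_eq, macFamily, if_pos hn]

theorem compatible_genMac (T : Omega lam) : Compatible (genMac T) := by
  rw [genMac_eq]; exact compatible_macFamily T

theorem Compatible.elemMul {w : Families lam} (hw : Compatible w) (r : ℕ) :
    Compatible (elemMul r w) := fun n h => by
  unfold VVMac.elemMul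
  rw [connecting_gElem, hw]

theorem linearCombination_apply_comp (c : Omega lam →₀ Kqt) (n : {n : ℕ // nMin lam ≤ n}) :
    Finsupp.linearCombination Kqt (genMac : Omega lam → Families lam) c n =
      Finsupp.linearCombination Kqt (fun S : Omega lam => genMac S n) c := by
  rw [Finsupp.linearCombination_apply, Finsupp.linearCombination_apply, Finsupp.sum, Finsupp.sum,
    Finset.sum_apply]
  rfl

theorem compatible_linearCombination (c : Omega lam →₀ Kqt) :
    Compatible (Finsupp.linearCombination Kqt (genMac : Omega lam → Families lam) c) := by
  intro n h
  rw [linearCombination_apply_comp, linearCombination_apply_comp, Finsupp.linearCombination_apply,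
    Finsupp.linearCombination_apply, Finsupp.sum, Finsupp.sum, map_sum]
  refine Finset.sum_congr rfl fun S _ => ?_
  rw [map_smul, compatible_genMac S n h]

/-- The coefficients of a combination of generalized symmetric Macdonald functions are determined
by a component of large index. -/
theorem coeffFun_linearCombination (c : Omega lam →₀ Kqt) {n : ℕ} (h : nMin lam ≤ n)
    (hc : ∀ S ∈ c.support, S.rk ≤ n) {S : Omega lam} (hS : S.rk ≤ n) :
    coeffFun n (S.restrict n h) (modEquiv n _
      (Finsupp.linearCombination Kqt (genMac : Omega lam → Families lam) c ⟨n, h⟩)) = c S := by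
  rw [linearCombination_apply_comp, Finsupp.linearCombination_apply, Finsupp.sum, map_sum, map_sum,
    Finset.sum_eq_single S]
  · rw [map_smul, map_smul, genMac_apply h hS, symMac_padded, LinearEquiv.apply_symm_apply,
      coeffFun_symVec (card_box_padded h), smul_eq_mul, mul_one]
  · intro S' hS' hne
    have h1 := hc S' hS'
    rw [map_smul, map_smul, genMac_apply h h1, symMac_padded, LinearEquiv.apply_symm_apply,
      coeffFun_symVec_of_ne, smul_zero]
    intro e
    apply hne
    rw [← S'.ofRSSYT_restrict (h := h) h1, e, S.ofRSSYT_restrict hS]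
  · intro hS'
    rw [Finsupp.notMem_support_iff.1 hS', zero_smul, map_zero, map_zero]

theorem linearCombination_injective :
    Function.Injective (Finsupp.linearCombination Kqt (genMac : Omega lam → Families lam)) := by
  intro c c' hcc
  ext S
  -- Large enough for all labellings in both supports and for S, so that a single component sees
  -- every coefficient.
  let n := nMin lam + S.rk + ∑ S' ∈ c.support, S'.rk + ∑ S' ∈ c'.support, S'.rk
  have h : nMin lam ≤ n := by simp only [n]; omega
  have h1 : ∀ S' ∈ c.support, S'.rk ≤ n := fun S' hS' => by
    have := Finset.single_le_sum (f := fun S : Omega lam => S.rk) (fun _ _ => Nat.zero_le _) hS'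
    simp only [n]; omega
  have h2 : ∀ S' ∈ c'.support, S'.rk ≤ n := fun S' hS' => by
    have := Finset.single_le_sum (f := fun S : Omega lam => S.rk) (fun _ _ => Nat.zero_le _) hS'
    simp only [n]; omega
  have h3 : S.rk ≤ n := by simp only [n]; omega
  rw [← coeffFun_linearCombination c h h1 h3, hcc, coeffFun_linearCombination c' h h2 h3]

end GenMac

end VVMac

namespace VVMac

open PSYT

/-! ### Stability of the Pieri coefficients -/

section Stability

variable {lam : YoungDiagram} {n r : ℕ}

/-- A label of index at least r, counted from zero, does not reach the front before r steps are
over. -/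
theorem PSYT.psi_iterate_wt {mu : YoungDiagram} (τ : PSYT n mu) {b : Box mu}
    (h : r ≤ (τ.idx b : ℕ)) : (PSYT.psi^[r] τ).wt b = τ.wt b := by
  induction r generalizing τ with
  | zero => rfl
  | succ r ih =>
    rw [Function.iterate_succ_apply, ih τ.psi, psi_wt, if_neg (by omega)]
    rw [psi_idx, if_neg (by omega)]
    omega

theorem le_idx_newBox (T : Omega lam) (h : nMin lam ≤ n) (hn : T.rk + r ≤ n)
    {τ : PSYT (n + 1) (padded lam (n + 1) (Nat.le_succ_of_le h))}
    (hτ : τ.wt = (T.restrict (n + 1) (Nat.le_succ_of_le h)).toFun) :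
    r ≤ (τ.idx (newBox lam n h) : ℕ) := by
  have hle : lam.card ≤ T.rk := le_trans (Nat.le_add_right _ _) T.nMin_le_rk
  -- From column rk(T) - |λ| on, the first row has exponent zero, so label indices increase strictly
  -- along it; the k-th such box, counted from zero, has index at least k.
  have key : ∀ k (b : Box (padded lam (n + 1) (Nat.le_succ_of_le h))), b.1.1 = 0 →
      b.1.2 = T.rk + k - lam.card → k ≤ (τ.idx b : ℕ) := by
    intro k
    induction k with
    | zero => exact fun _ _ _ => Nat.zero_le _
    | succ k ih =>
      intro b h1 h2
      let a : Box (padded lam (n + 1) (Nat.le_succ_of_le h)) :=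
        ⟨(0, T.rk + k - lam.card), (padded lam (n + 1) _).up_left_mem (Nat.zero_le _)
          (by rw [h2]; omega) b.2⟩
      have hz : ∀ c : Box (padded lam (n + 1) (Nat.le_succ_of_le h)), T.rk - lam.card ≤ c.1.2 →
          τ.wt c = 0 := by
        intro c hc
        rw [hτ]
        refine T.eq_zero_of_notMem (h := T.nMin_le_rk) le_rfl fun hm => ?_
        have := col_lt_of_mem_padded hm
        change c.1.2 < _ at this
        omega
      have e1 : a.1.1 = 0 := rfl
      have e2 : a.1.2 = T.rk + k - lam.card := rfl
      have h3 := τ.row_lt a b (e1.trans h1.symm) (by omega)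
      have h4 := ih a rfl rfl
      rw [hz a (by omega), hz b (by omega)] at h3
      simp only [labelLT] at h3
      omega
  have h5 := key (n - T.rk) (newBox lam n h) rfl (by
    change n - lam.card = _
    omega)
  omega

/-- The sum in the formula is empty: Ψ^r cannot raise the exponent of the new box, which is zero
under T. -/
theorem pieriFormula_eq_zero (T : Omega lam) (h : nMin lam ≤ n) (hn : T.rk + r ≤ n)
    {S : RSSYT (padded lam (n + 1) (Nat.le_succ_of_le h))} (hS : S.toFun (newBox lam n h) ≠ 0) :
    pieriFormula (n + 1) r S (T.restrict (n + 1) (Nat.le_succ_of_le h)) = 0 := by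
  rw [pieriFormula]
  have hz : ∀ τ : PSYT (n + 1) (padded lam (n + 1) (Nat.le_succ_of_le h)),
      ¬ (τ.wt = (T.restrict (n + 1) (Nat.le_succ_of_le h)).toFun ∧
        (PSYT.psi^[r] τ).wt = S.toFun) := by
    rintro τ ⟨h1, h2⟩
    apply hS
    rw [← h2, psi_iterate_wt τ (le_idx_newBox T h hn h1), h1]
    exact T.restrict_newBox h (by omega)
  refine mul_eq_zero_of_right _ (finsum_eq_zero_of_forall_eq_zero fun τ => ?_)
  classical
  rw [finsum_eq_if, if_neg (hz τ)]

theorem coeffFun_linearCombination_symMac (h : nMin lam ≤ n) (d : RSSYT (padded lam n h) →₀ Kqt)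
    (S : RSSYT (padded lam n h)) :
    coeffFun n S (modEquiv n _ (Finsupp.linearCombination Kqt (symMac n) d)) = d S := by
  rw [Finsupp.linearCombination_apply, Finsupp.sum, map_sum, map_sum, Finset.sum_eq_single S]
  · rw [map_smul, map_smul, symMac_padded, LinearEquiv.apply_symm_apply,
      coeffFun_symVec (card_box_padded h), smul_eq_mul, mul_one]
  · intro S' _ hne
    rw [map_smul, map_smul, symMac_padded, LinearEquiv.apply_symm_apply, coeffFun_symVec_of_ne hne,
      smul_zero]
  · intro hS
    rw [Finsupp.notMem_support_iff.1 hS, zero_smul, map_zero, map_zero]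

theorem rk_ofRSSYT_of_newBox (h : nMin lam ≤ n)
    {S : RSSYT (padded lam (n + 1) (Nat.le_succ_of_le h))} (hS : S.toFun (newBox lam n h) = 0) :
    (Omega.ofRSSYT S).rk ≤ n := by
  by_contra hcon
  refine (Omega.ofRSSYT S).restrict_newBox_ne h (by omega) ?_
  rw [Omega.restrict_ofRSSYT, hS]

/-- The connecting map is applied to the expansion for n + 1. Terms with a nonzero entry in the new
box vanish, the others restrict to distinct labellings, and the coefficient functional compares the
results. -/
theorem expansion_succ (T : Omega lam) (h : nMin lam ≤ n) (hn : T.rk ≤ n)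
    {d : RSSYT (padded lam n h) →₀ Kqt}
    {d' : RSSYT (padded lam (n + 1) (Nat.le_succ_of_le h)) →₀ Kqt}
    (hd : IsUniqueExpansion (symMac n) (gElem n r • symMac n (T.restrict n h)) d)
    (hd' : IsUniqueExpansion (symMac (n + 1))
      (gElem (n + 1) r • symMac (n + 1) (T.restrict (n + 1) (Nat.le_succ_of_le h))) d')
    {S : Omega lam} (hS : S.rk ≤ n) :
    d' (S.restrict (n + 1) (Nat.le_succ_of_le h)) = d (S.restrict n h) := by
  have e1 := (hd d).2 rfl
  have e2 := (hd' d').2 rfl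
  rw [← connecting_symMac T h hn, ← connecting_gElem, ← e2] at e1
  rw [← coeffFun_linearCombination_symMac h d, e1, Finsupp.linearCombination_apply, Finsupp.sum,
    map_sum, map_sum, map_sum, Finset.sum_eq_single (S.restrict (n + 1) (Nat.le_succ_of_le h))]
  · rw [map_smul, map_smul, map_smul, connecting_symMac S h hS, symMac_padded,
      LinearEquiv.apply_symm_apply, coeffFun_symVec (card_box_padded h), smul_eq_mul, mul_one]
  · intro S' _ hne
    rw [map_smul, map_smul, map_smul]
    by_cases hz : S'.toFun (newBox lam n h) = 0
    · have hrk := rk_ofRSSYT_of_newBox h hz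
      have e3 := connecting_symMac (Omega.ofRSSYT S') h hrk
      rw [Omega.restrict_ofRSSYT] at e3
      rw [e3, symMac_padded, LinearEquiv.apply_symm_apply, coeffFun_symVec_of_ne, smul_zero]
      intro e
      apply hne
      rw [← Omega.restrict_ofRSSYT S', ← (Omega.ofRSSYT S').ofRSSYT_restrict (h := h) hrk, e,
        S.ofRSSYT_restrict hS]
    · rw [connecting_symMac_of_ne h S' hz, map_zero, map_zero, smul_zero]
  · intro hS'
    rw [Finsupp.notMem_support_iff.1 hS', zero_smul, map_zero, map_zero, map_zero]

end Stability

end VVMac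

/-! ### Assembly of the stable expansion. -/

theorem mainTheorem3 (lam : YoungDiagram) (r : ℕ) (hr : 1 ≤ r) (T : Omega lam) :
    ∃ D : Omega lam →₀ Kqt,
      IsUniqueExpansion genMac (elemMul r (genMac T)) D ∧
      ∀ (n : ℕ) (hn : nMin lam ≤ n), T.rk + r ≤ n →
        ∃ d : RSSYT (padded lam n hn) →₀ Kqt,
          IsUniqueExpansion (symMac n) (gElem n r • symMac n (T.restrict n hn)) d ∧
          (∀ S : RSSYT (padded lam n hn), d S = pieriFormula n r S (T.restrict n hn)) ∧
          (∀ S : Omega lam, S.rk ≤ n → D S = d (S.restrict n hn)) ∧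
          (∀ S : Omega lam, n < S.rk → D S = 0) ∧
          (T.rk + r < n → ∀ S : Omega lam, D S = d (S.restrict n hn)) := by
  have hex : ∀ (n : ℕ) (hn : nMin lam ≤ n), T.rk + r ≤ n →
      ∃ d : RSSYT (padded lam n hn) →₀ Kqt,
        IsUniqueExpansion (symMac n) (gElem n r • symMac n (T.restrict n hn)) d ∧
          ∀ S, d S = pieriFormula n r S (T.restrict n hn) := fun n hn hle =>
    exists_isUniqueExpansion (card_box_padded hn) (by omega) _
  choose d hd1 hd2 using hex
  have hN : nMin lam ≤ T.rk + r := le_trans T.nMin_le_rk (Nat.le_add_right _ _)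
  -- The smallest admissible n, namely rk(T) + r, already carries all coefficients; labellings are
  -- extended by zero.
  set D : Omega lam →₀ Kqt :=
    Finsupp.embDomain ⟨Omega.ofRSSYT, Omega.ofRSSYT_injective⟩ (d _ hN le_rfl) with hD
  have hD1 : ∀ S : Omega lam, S.rk ≤ T.rk + r → D S = d _ hN le_rfl (S.restrict _ hN) := by
    intro S hS
    conv_lhs => rw [← S.ofRSSYT_restrict (h := hN) hS]
    exact Finsupp.embDomain_apply_self _ _ _
  have hD0 : ∀ S : Omega lam, T.rk + r < S.rk → D S = 0 := by
    intro S hS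
    refine Finsupp.embDomain_of_notMem_range _ _ _ ?_
    rintro ⟨S', rfl⟩
    exact absurd (Omega.rk_ofRSSYT S') (not_le.2 hS)
  have hvanish : ∀ (n : ℕ) (hn : nMin lam ≤ n) (hle : T.rk + r ≤ n)
      (S : RSSYT (padded lam (n + 1) (Nat.le_succ_of_le hn))), S.toFun (newBox lam n hn) ≠ 0 →
      d (n + 1) (Nat.le_succ_of_le hn) (Nat.le_succ_of_le hle) S = 0 := fun n hn hle S hS => by
    rw [hd2, pieriFormula_eq_zero T hn hle hS]
  -- Along n, old labellings keep their coefficients by `expansion_succ`, and those of rank exactly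
  -- n + 1 have coefficient zero on both sides.
  have hstab : ∀ (n : ℕ) (hn : nMin lam ≤ n) (hle : T.rk + r ≤ n) (S : Omega lam), S.rk ≤ n →
      D S = d n hn hle (S.restrict n hn) := by
    intro n hn hle
    induction n, hle using Nat.le_induction with
    | base => exact hD1
    | succ n hle ih =>
      intro S hS
      have hn' : nMin lam ≤ n := le_trans hN hle
      rcases hS.lt_or_eq with hS | hS
      · rw [ih hn' S (by omega), expansion_succ T hn' (by omega) (hd1 n hn' hle)
          (hd1 (n + 1) hn (Nat.le_succ_of_le hle)) (by omega)]
      · rw [hD0 S (by omega), hvanish n hn' hle _ (S.restrict_newBox_ne hn' (by omega))]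
  have hcomp : ∀ (n : ℕ) (hn : nMin lam ≤ n), T.rk + r ≤ n →
      Finsupp.linearCombination Kqt (genMac : Omega lam → Families lam) D ⟨n, hn⟩ =
        elemMul r (genMac T) ⟨n, hn⟩ := by
    intro n hn hle
    -- Stability shows that the definition of `D` does not depend on the admissible n chosen for it;
    -- the expansion in component n is then the finite one.
    have e : D = Finsupp.embDomain ⟨Omega.ofRSSYT, Omega.ofRSSYT_injective⟩ (d n hn hle) := by
      ext S
      by_cases hS : S.rk ≤ n
      · rw [hstab n hn hle S hS]
        conv_rhs => rw [← S.ofRSSYT_restrict (h := hn) hS]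
        exact (Finsupp.embDomain_apply_self _ _ _).symm
      · rw [hD0 S (by omega), Finsupp.embDomain_of_notMem_range]
        rintro ⟨S', rfl⟩
        exact hS (Omega.rk_ofRSSYT S')
    have e2 := (hd1 n hn hle (d n hn hle)).2 rfl
    rw [linearCombination_apply_comp, e, Finsupp.linearCombination_embDomain]
    unfold elemMul
    rw [genMac_apply hn (by omega), ← e2]
    congr 1
    congr 1
    funext S
    change genMac (Omega.ofRSSYT S) ⟨n, hn⟩ = symMac n S
    rw [genMac_apply hn (Omega.rk_ofRSSYT S), Omega.restrict_ofRSSYT]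
  have hDeq : Finsupp.linearCombination Kqt (genMac : Omega lam → Families lam) D =
      elemMul r (genMac T) :=
    (compatible_linearCombination D).eq_of_le ((compatible_genMac T).elemMul r) hcomp
  refine ⟨D, fun c => ⟨fun hc => linearCombination_injective (hc.trans hDeq.symm), fun hc => ?_⟩,
    fun n hn hle => ⟨d n hn hle, hd1 n hn hle, hd2 n hn hle, hstab n hn hle,
      fun S hS => hD0 S (by omega), fun hlt S => ?_⟩⟩
  · rw [hc]; exact hDeq
  · by_cases hS : S.rk ≤ n
    · exact hstab n hn hle S hS
    -- Strictness makes m = n - 1 admissible too. As S has rank larger than n, its truncation is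
    -- nonzero on the box added in passing from m to n, so the finite coefficient vanishes as well.
    · obtain ⟨m, rfl⟩ : ∃ m, n = m + 1 := ⟨n - 1, by omega⟩
      have hm : nMin lam ≤ m := by omega
      rw [hD0 S (by omega), hvanish m hm (by omega) _ (S.restrict_newBox_ne hm (by omega))]
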